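/- Let $A$ be a symmetric non-degenerate $r\times r$ matrix with integer coefficients, $Q(x)=\frac12\langle x,Ax\rangle$ and $B(x,y)=\langle x,Ay\rangle$ for $x,y\in\mathbb C^r$. Assume that $Q$ has type $(r-1,1)$, i.e. the largest dimension of a linear subspace of $\mathbb R^r$ on which $Q$ is negative definite is $1$. Fix $c_0\in\mathbb R^r$ with $Q(c_0)<0$ and put $$C_Q=\{c\in\mathbb R^r\mid Q(c)<0,\ B(c,c_0)<0\},\qquad S_Q=\{c\in\mathbb Z^r\mid c\text{ primitive},\ Q(c)=0,\ B(c,c_0)<0\},\qquad \overline C_Q=C_Q\cup S_Q .$$ Let $\mathbb H$ be the upper half-plane. For $c\in\overline C_Q$ let $R(c)=\mathbb R^r$ if $c\in C_Q$, $R(c)=\{a\in\mathbb R^r\mid B(c,a)\notin\mathbb Z\}$ if $c\in S_Q$, and $$D(c)=\{(z,\tau)\in\mathbb C^r\times\mathbb H\mid \operatorname{Im}(z)/\operatorname{Im}(\tau)\in R(c)\}.$$ Put $E(x)=2\int_0^x e^{-\pi u^2}\,du$ for $x\in\mathbb R$, let $\operatorname{sgn}$ be the sign function ($\operatorname{sgn}(0)=0$),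 and for $\nu\in\mathbb R^r$, $\tau\in\mathbb H$, $y=\operatorname{Im}(\tau)$, $$\rho^{c}(\nu;\tau)=\begin{cases}E\Bigl(\frac{B(c,\nu)}{\sqrt{-Q(c)}}\,y^{1/2}\Bigr)&c\in C_Q,\\ \operatorname{sgn}(B(c,\nu))&c\in S_Q,\end{cases}\qquad \rho^{c_1,c_2}=\rho^{c_1}-\rho^{c_2}.$$ For $c_1,c_2\in\overline C_Q$ and $(z,\tau)\in D(c_1)\cap D(c_2)$ let $a=\operatorname{Im}(z)/\operatorname{Im}(\tau)$ and $$\theta(z;\tau)=\theta^{c_1,c_2}(z;\tau)=\sum_{n\in\mathbb Z^r}\rho^{c_1,c_2}(n+a;\tau)\,e^{2\pi iQ(n)\tau+2\pi iB(n,z)} .$$ Then this series converges absolutely, and the following hold. In (2), (3), (6) and (7) $c_1,c_2\in\overline C_Q$ are arbitrary; in (2), (3) and (6) $(z,\tau)\in D(c_1)\cap D(c_2)$ is arbitrary; and all arguments at which $\theta$ is evaluated in (2), (3), (6) and (7) lie in $D(c_1)\cap D(c_2)$ too. (1) $\theta^{c_1,c_2}(z;\tau)+\theta^{c_2,c_1}(z;\tau)=0$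 for $c_1,c_2\in\overline C_Q$ and $(z,\tau)\in D(c_1)\cap D(c_2)$; and $\theta^{c_1,c_2}(z;\tau)+\theta^{c_2,c_3}(z;\tau)+\theta^{c_3,c_1}(z;\tau)=0$ for $c_1,c_2,c_3\in\overline C_Q$ and $(z,\tau)\in D(c_1)\cap D(c_2)\cap D(c_3)$. (2) $\theta(z+\lambda\tau+\mu;\tau)=e^{-2\pi iQ(\lambda)\tau-2\pi iB(z,\lambda)}\,\theta(z;\tau)$ for all $\lambda\in\mathbb Z^r$ and $\mu\in A^{-1}\mathbb Z^r$. (3) $\theta(-z;\tau)=-\theta(z;\tau)$. (4) For all $(z,\tau)\in\mathbb C^r\times\mathbb H$ the function $(c_1,c_2)\mapsto\theta^{c_1,c_2}(z;\tau)$ is continuous on $C_Q\times C_Q$. (5) Let $c_1,c_3\in C_Q$, $c_2\in S_Q$ and $(z,\tau)\in D(c_2)$. Set $c(t)=c_2+tc_3$. Then $c(t)\in C_Q$ for all $t\in(0,\infty)$, and $\lim_{t\downarrow0}\theta^{c_1,c(t)}(z;\tau)=\theta^{c_1,c_2}(z;\tau)$. (6) $\theta(z;\tau+1)=\theta(z+\frac12A^{-1}A^*;\tau)$,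 where $A^*=(A_{11},\dots,A_{rr})^T$. In particular $\theta(z;\tau+2)=\theta(z;\tau)$, and if $A$ is even (all $A_{ii}$ are even) then $\theta(z;\tau+1)=\theta(z;\tau)$. (7) For $c\in\overline C_Q$ let $D'(c)=\{(z,\tau)\in D(c)\mid(\frac z\tau,-\frac1\tau)\in D(c)\}$. Then $D'(c)=\{(a\tau+b,\tau)\mid\tau\in\mathbb H,\ a,b\in R(c)\}$. The group $A^{-1}\mathbb Z^r/\mathbb Z^r$ is finite, and if $(z,\tau)\in D'(c_1)\cap D'(c_2)$ then $$\theta\Bigl(\frac z\tau;-\frac1\tau\Bigr)=\frac{i}{\sqrt{-\det A}}\,(-i\tau)^{r/2}\sum_{p\in A^{-1}\mathbb Z^r/\mathbb Z^r}e^{2\pi iQ(z+p\tau)/\tau}\,\theta(z+p\tau;\tau),$$ with the principal branch of the power and for every choice of representatives $p$ of the classes. -/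

import Mathlib

open Matrix Filter Topology

noncomputable section

namespace IndefTheta

/-- The bilinear form `B(x, y) = ⟨x, A y⟩` of an integral matrix `A`, on `K ^ r` (`K = ℝ` or `ℂ`). -/
def B {r : ℕ} (A : Matrix (Fin r) (Fin r) ℤ) {K : Type*} [Field K] (x y : Fin r → K) : K :=
  x ⬝ᵥ (A.map (Int.cast : ℤ → K) *ᵥ y)

/-- The quadratic form `Q(x) = ⟨x, A x⟩ / 2`, on `K ^ r`. -/
def Q {r : ℕ} (A : Matrix (Fin r) (Fin r) ℤ) {K : Type*} [Field K] (x : Fin r → K) : K :=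
  1 / 2 * B A x x

/-- `Q` has type `(r - s, s)`: `s` is the largest dimension of a linear subspace of `ℝ ^ r` on which
`Q` is negative definite. -/
def HasType {r : ℕ} (A : Matrix (Fin r) (Fin r) ℤ) (p s : ℕ) : Prop :=
  p + s = r ∧
  IsGreatest {d : ℕ | ∃ W : Submodule ℝ (Fin r → ℝ),
    Module.finrank ℝ W = d ∧ ∀ x ∈ W, x ≠ 0 → Q A x < 0} s

/-- The component `C_Q` of `{c | Q(c) < 0}` that contains the vector `c₀` (where `Q(c₀) < 0`). -/
def coneC {r : ℕ} (A : Matrix (Fin r) (Fin r) ℤ) (c₀ : Fin r → ℝ) : Set (Fin r → ℝ) :=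
  {c | Q A c < 0 ∧ B A c c₀ < 0}

/-- `S_Q`: the primitive integral vectors `c` with `Q(c) = 0` and `B(c, c₀) < 0`. -/
def cuspS {r : ℕ} (A : Matrix (Fin r) (Fin r) ℤ) (c₀ : Fin r → ℝ) : Set (Fin r → ℝ) :=
  {c | (∃ m : Fin r → ℤ, Finset.univ.gcd m = 1 ∧ c = fun i => (m i : ℝ)) ∧
    Q A c = 0 ∧ B A c c₀ < 0}

/-- `C_Q ∪ S_Q`. -/
def coneBar {r : ℕ} (A : Matrix (Fin r) (Fin r) ℤ) (c₀ : Fin r → ℝ) : Set (Fin r → ℝ) :=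
  coneC A c₀ ∪ cuspS A c₀

/-- `R(c)` for `c ∈ C_Q ∪ S_Q`: all of `ℝ ^ r` if `Q(c) < 0` (that is, `c ∈ C_Q`), and
`{a | B(c, a) ∉ ℤ}` otherwise (that is, `c ∈ S_Q`). -/
def R {r : ℕ} (A : Matrix (Fin r) (Fin r) ℤ) (c : Fin r → ℝ) : Set (Fin r → ℝ) :=
  if Q A c < 0 then Set.univ else {a | ∀ m : ℤ, B A c a ≠ (m : ℝ)}

/-- The vector `a = Im(z) / Im(τ)`. -/
def imQuot {r : ℕ} (z : Fin r → ℂ) (τ : ℂ) : Fin r → ℝ :=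
  fun i => (z i).im / τ.im

/-- `D(c)`: the pairs `(z, τ)` with `τ` in the upper half-plane and `Im(z) / Im(τ) ∈ R(c)`. -/
def D {r : ℕ} (A : Matrix (Fin r) (Fin r) ℤ) (c : Fin r → ℝ) : Set ((Fin r → ℂ) × ℂ) :=
  {p | 0 < p.2.im ∧ imQuot p.1 p.2 ∈ R A c}

/-- `D'(c)`: the pairs `(z, τ) ∈ D(c)` with `(z / τ, -1 / τ) ∈ D(c)`. -/
def D' {r : ℕ} (A : Matrix (Fin r) (Fin r) ℤ) (c : Fin r → ℝ) : Set ((Fin r → ℂ) × ℂ) :=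
  {p | p ∈ D A c ∧ ((fun i => p.1 i / p.2), -1 / p.2) ∈ D A c}

/-- `E(x) = 2 ∫₀ˣ exp(-π u²) du` for real `x`. -/
def E (x : ℝ) : ℝ :=
  2 * ∫ u in (0 : ℝ)..x, Real.exp (-Real.pi * u ^ 2)

/-- `ρ^c(ν; τ)` for `c ∈ C_Q ∪ S_Q`. -/
def rhoOne {r : ℕ} (A : Matrix (Fin r) (Fin r) ℤ) (c ν : Fin r → ℝ) (τ : ℂ) : ℝ :=
  if Q A c < 0 then E (B A c ν / √(-Q A c) * √τ.im) else Real.sign (B A c ν)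

/-- `ρ^{c₁,c₂}(ν; τ) = ρ^{c₁}(ν; τ) - ρ^{c₂}(ν; τ)`. -/
def rho {r : ℕ} (A : Matrix (Fin r) (Fin r) ℤ) (c₁ c₂ ν : Fin r → ℝ) (τ : ℂ) : ℝ :=
  rhoOne A c₁ ν τ - rhoOne A c₂ ν τ

/-- The term of index `n ∈ ℤ ^ r` of the series that defines `θ^{c₁,c₂}(z; τ)`. -/
def thetaTerm {r : ℕ} (A : Matrix (Fin r) (Fin r) ℤ) (c₁ c₂ : Fin r → ℝ)
    (z : Fin r → ℂ) (τ : ℂ) (n : Fin r → ℤ) : ℂ :=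
  (rho A c₁ c₂ (fun i => (n i : ℝ) + imQuot z τ i) τ : ℂ) *
    Complex.exp (2 * Real.pi * Complex.I * Q A (fun i => (n i : ℂ)) * τ +
      2 * Real.pi * Complex.I * B A (fun i => (n i : ℂ)) z)

/-- The indefinite theta function `θ^{c₁,c₂}(z; τ)`. -/
def theta {r : ℕ} (A : Matrix (Fin r) (Fin r) ℤ) (c₁ c₂ : Fin r → ℝ)
    (z : Fin r → ℂ) (τ : ℂ) : ℂ :=
  ∑' n : Fin r → ℤ, thetaTerm A c₁ c₂ z τ n

/-- A real vector seen as a complex vector. -/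
def toC {r : ℕ} (x : Fin r → ℝ) : Fin r → ℂ :=
  fun i => (x i : ℂ)

/-- The lattice `ℤ ^ r` in `ℝ ^ r`. -/
def intLattice (r : ℕ) : AddSubgroup (Fin r → ℝ) :=
  ((Int.castAddHom ℝ).compLeft (Fin r)).range

/-- The lattice `A⁻¹ ℤ ^ r` in `ℝ ^ r`. -/
def dualLattice {r : ℕ} (A : Matrix (Fin r) (Fin r) ℤ) : AddSubgroup (Fin r → ℝ) :=
  (intLattice r).map ((A.map (Int.cast : ℤ → ℝ))⁻¹.mulVecLin).toAddMonoidHom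

/-- The discriminant group `A⁻¹ ℤ ^ r / ℤ ^ r`. -/
abbrev DiscGroup {r : ℕ} (A : Matrix (Fin r) (Fin r) ℤ) : Type :=
  dualLattice A ⧸ (intLattice r).addSubgroupOf (dualLattice A)

/-- The vector `A⁻¹ A^* / 2`, where `A^*` is the vector of diagonal entries of `A`. -/
def halfDiag {r : ℕ} (A : Matrix (Fin r) (Fin r) ℤ) : Fin r → ℝ :=
  (1 / 2 : ℝ) • ((A.map (Int.cast : ℤ → ℝ))⁻¹ *ᵥ fun i => (A i i : ℝ))

end IndefTheta

end

open IndefTheta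

/-! Write $z=a\tau+b$ with real $a,b$. Completing the square turns the theta series into a constant
times the sum over $n$ of `thetaKer` at $n+a$ times the character $e^{2\pi iB(n+a,b)}$
(`thetaTerm_eq`). Oddness, the elliptic law and the translations of $\tau$ are then termwise
identities.

The analysis concerns two vectors of the open cone, scaled to norm $-1$. If distinct, they lie on a
hyperbola $c(u)=e^uk+e^{-u}k'$ with $k,k'$ isotropic and $B(k,k')=-1$
(`IsLorentzian.exists_hypPair`). The difference of their error functions is the integral of its
derivative along this curve, so the kernel is an integral over $u$ of $B(c'(u),v)\exp(2\pi
iQ(v)\tau-\pi yB(c(u),v)^2)$ (`errKer_hypPath`). The absolute value of the exponential is $\exp(-\pi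
y(2Q(v)+B(c,v)^2))$, and $2Q+B(c,\cdot)^2$ is positive definite because $Q$ is positive on
$c^\perp$. This gives decay, and it reduces the Fourier transform to a Gaussian one. Since
$c'(u)\perp c(u)$, the linear factor is handled by integration by parts in the direction $c'(u)$
(`IsLorentzian.integral_linear_gaussKer`). The kernel is thus, up to a constant, carried to itself
at $-1/\tau$, and Poisson summation gives the inversion formula for cone points; the dual lattice
$A^{-1}\mathbb Z^r$ is split into classes modulo $\mathbb Z^r$ (`IsLorentzian.tsum_errKer`,
`theta_inversion_cone`).

A cusp is the end $u\to\infty$ of such a hyperbola. There the majorant degenerates in one direction,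
but $B(c,a)\notin\mathbb Z$ keeps $|B(k,n+a)|$ away from $0$. This yields a summable bound
independent of $u$ (`IsHypPair.exists_errKer_cusp_le`), hence convergence at cusps and the limit (5)
by dominated convergence. The cocycle relation through the base point $c_0$ then extends absolute
convergence to all pairs, and with the cusp limit the inversion formula too. Continuity in
$(c_1,c_2)$ is another dominated convergence. -/

/-! ### Polynomial decay and unit cubes of the lattice. -/

/-- The weight `(1 + ‖x‖) ^ (-(r + 1))`, integrable on `ℝ ^ r` and summable over `ℤ ^ r`. -/
noncomputable def decayWeight {r : ℕ} (x : Fin r → ℝ) : ℝ := ((1 + ‖x‖) ^ (r + 1))⁻¹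

/-- An integral vector seen as a real vector. -/
def intVec {r : ℕ} (n : Fin r → ℤ) : Fin r → ℝ := fun i => (n i : ℝ)

lemma decayWeight_pos {r : ℕ} (x : Fin r → ℝ) : 0 < decayWeight x := by
  unfold decayWeight; positivity

lemma integrable_decayWeight {r : ℕ} :
    MeasureTheory.Integrable (decayWeight (r := r)) := by
  have h := integrable_one_add_norm (E := Fin r → ℝ) (μ := MeasureTheory.volume)
    (r := (r + 1 : ℕ)) (by simp)
  refine h.congr (Eventually.of_forall fun x => ?_)
  simp only [decayWeight]
  rw [Real.rpow_neg (by positivity), Real.rpow_natCast]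

lemma decayWeight_le_mul {r : ℕ} {R : ℝ} (x y : Fin r → ℝ) (h : ‖x‖ ≤ ‖y‖ + R) (hR : 0 ≤ R) :
    decayWeight y ≤ (1 + R) ^ (r + 1) * decayWeight x := by
  unfold decayWeight
  rw [← div_eq_mul_inv, inv_eq_one_div, div_le_div_iff₀ (by positivity) (by positivity), one_mul,
    ← mul_pow]
  gcongr
  nlinarith [norm_nonneg y]

/-- The half-open unit cube at `n`. -/
def unitCube {r : ℕ} (n : Fin r → ℤ) : Set (Fin r → ℝ) :=
  {x | ∀ i, x i ∈ Set.Ioc (n i : ℝ) (n i + 1)}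

lemma measurableSet_unitCube {r : ℕ} (n : Fin r → ℤ) : MeasurableSet (unitCube n) :=
  MeasurableSet.univ_pi' fun _ => measurableSet_Ioc

/-- The cubes are open on the left, the convention of `UnitAddTorus.mFourierCoeff_eq_integral`;
hence `⌈x i⌉ - 1` and not the floor. -/
lemma mem_unitCube_iff {r : ℕ} {n : Fin r → ℤ} {x : Fin r → ℝ} :
    x ∈ unitCube n ↔ (fun i => ⌈x i⌉ - 1) = n := by
  simp only [unitCube, Set.mem_ofPred_eq, Set.mem_Ioc, funext_iff]
  refine forall_congr' fun i => ?_
  rw [sub_eq_iff_eq_add, Int.ceil_eq_iff]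
  simp

lemma pairwise_disjoint_unitCube {r : ℕ} :
    Pairwise (Function.onFun Disjoint (unitCube (r := r))) := by
  intro m n hmn
  refine Set.disjoint_left.2 fun x hx hy => hmn ?_
  rw [← mem_unitCube_iff.1 hx, ← mem_unitCube_iff.1 hy]

lemma iUnion_unitCube {r : ℕ} : ⋃ n : Fin r → ℤ, unitCube n = Set.univ := by
  refine Set.eq_univ_of_forall fun x => Set.mem_iUnion.2 ⟨_, mem_unitCube_iff.2 rfl⟩

lemma hasSum_integral_unitCube {r : ℕ} {E : Type*} [NormedAddCommGroup E] [NormedSpace ℝ E]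
    {f : (Fin r → ℝ) → E} (hf : MeasureTheory.Integrable f) :
    HasSum (fun n : Fin r → ℤ => ∫ x in unitCube n, f x) (∫ x, f x) := by
  have h := MeasureTheory.hasSum_integral_iUnion (f := f) (μ := MeasureTheory.volume)
    measurableSet_unitCube pairwise_disjoint_unitCube hf.integrableOn
  rwa [iUnion_unitCube, MeasureTheory.setIntegral_univ] at h

lemma setIntegral_unitCube {r : ℕ} {E : Type*} [NormedAddCommGroup E] [NormedSpace ℝ E]
    (g : (Fin r → ℝ) → E) (n : Fin r → ℤ) :
    ∫ x in unitCube n, g x = ∫ x in unitCube 0, g (intVec n + x) := by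
  have hmp := MeasureTheory.measurePreserving_add_left
    (MeasureTheory.volume : MeasureTheory.Measure (Fin r → ℝ)) (intVec n)
  rw [← hmp.setIntegral_preimage_emb (measurableEmbedding_addLeft _)]
  congr 2
  ext x
  simp only [unitCube, intVec, Set.mem_preimage, Set.mem_ofPred_eq, Pi.add_apply, Set.mem_Ioc,
    Pi.zero_apply, Int.cast_zero, zero_add]
  refine forall_congr' fun i => and_congr ?_ ?_ <;> constructor <;> intro h <;> linarith

lemma norm_sub_le_of_mem_unitCube {r : ℕ} {n : Fin r → ℤ} {x : Fin r → ℝ} (hx : x ∈ unitCube n) :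
    ‖x - intVec n‖ ≤ 1 := by
  refine (pi_norm_le_iff_of_nonneg zero_le_one).2 fun i => ?_
  have h := hx i
  simp only [intVec, Pi.sub_apply, Real.norm_eq_abs]
  rw [abs_le]
  constructor <;> linarith [h.1, h.2]

lemma volume_unitCube {r : ℕ} (n : Fin r → ℤ) : MeasureTheory.volume (unitCube n) = 1 := by
  have : unitCube n = Set.pi Set.univ fun i => Set.Ioc (n i : ℝ) (n i + 1) := by
    ext; simp [unitCube]
  rw [this, Real.volume_pi_Ioc]
  simp

/-- Integral comparison: the weight at the corner of a unit cube is at most $2^{r+1}$ times the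
weight at any point of that cube. -/
lemma summable_decayWeight {r : ℕ} : Summable fun n : Fin r → ℤ => decayWeight (intVec n) := by
  refine Summable.of_nonneg_of_le (fun n => (decayWeight_pos _).le) (fun n => ?_)
    ((hasSum_integral_unitCube integrable_decayWeight).summable.mul_left ((1 + 1) ^ (r + 1)))
  have h1 : ∫ x in unitCube n, decayWeight (intVec n) = decayWeight (intVec n) := by
    simp [MeasureTheory.Measure.real, volume_unitCube]
  rw [← h1, ← MeasureTheory.integral_const_mul]
  refine MeasureTheory.setIntegral_mono_on ?_ ?_ (measurableSet_unitCube n) fun x hx => ?_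
  · exact MeasureTheory.integrableOn_const (by simp [volume_unitCube])
  · exact (integrable_decayWeight.const_mul _).integrableOn
  · refine decayWeight_le_mul _ _ ?_ zero_le_one
    have := norm_sub_le_of_mem_unitCube hx
    have h2 : x = (x - intVec n) + intVec n := by abel
    have h3 := norm_add_le (x - intVec n) (intVec n)
    rw [← h2] at h3
    linarith

lemma decayWeight_add_le {r : ℕ} (x y : Fin r → ℝ) :
    decayWeight (x + y) ≤ (1 + ‖y‖) ^ (r + 1) * decayWeight x := by
  refine decayWeight_le_mul _ _ ?_ (norm_nonneg y)
  simpa using norm_sub_le (x + y) y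

lemma summable_decayWeight_add {r : ℕ} (a : Fin r → ℝ) :
    Summable fun n : Fin r → ℤ => decayWeight (intVec n + a) :=
  Summable.of_nonneg_of_le (fun _ => (decayWeight_pos _).le) (fun _ => decayWeight_add_le _ _)
    (summable_decayWeight.mul_left _)

lemma mFourier_coe {r : ℕ} (m : Fin r → ℤ) (x : Fin r → ℝ) :
    UnitAddTorus.mFourier m (fun i => (x i : UnitAddCircle)) =
      Complex.exp (2 * Real.pi * Complex.I * ∑ i, (m i : ℂ) * (x i : ℂ)) := by
  simp only [UnitAddTorus.mFourier, ContinuousMap.coe_mk, fourier_coe_apply, ← Complex.exp_sum,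
    Finset.mul_sum]
  congr 1
  refine Finset.sum_congr rfl fun i _ => ?_
  push_cast
  ring

/-! ### Periodization and Poisson summation. -/

section Periodization

variable {r : ℕ} {f : (Fin r → ℝ) → ℂ} {C : ℝ}

/-- The series converges uniformly on each ball of radius $1$, by the weight bound. -/
lemma continuous_tsum_intVec_add (hf : Continuous f) (hC : ∀ x, ‖f x‖ ≤ C * decayWeight x) :
    Continuous fun x => ∑' n : Fin r → ℤ, f (intVec n + x) := by
  have hC0 : 0 ≤ C := by
    have := (norm_nonneg _).trans (hC 0)
    exact nonneg_of_mul_nonneg_left this (decayWeight_pos _)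
  rw [continuous_iff_continuousAt]
  intro x
  have : ContinuousOn (fun x => ∑' n : Fin r → ℤ, f (intVec n + x))
      (Metric.closedBall x 1) := by
    refine continuousOn_tsum (u := fun n => C * ((1 + (‖x‖ + 1)) ^ (r + 1) *
      decayWeight (intVec n))) (fun n => by fun_prop)
      ((summable_decayWeight.mul_left _).mul_left _) fun n y hy => ?_
    refine (hC _).trans ?_
    gcongr
    refine (decayWeight_add_le _ _).trans ?_
    gcongr
    · exact (decayWeight_pos _).le
    · have h2 : y = (y - x) + x := by abel
      have h3 := norm_add_le (y - x) x
      rw [← h2] at h3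
      have := mem_closedBall_iff_norm.1 hy
      linarith
  exact this.continuousAt (Metric.closedBall_mem_nhds x one_pos)

lemma tsum_intVec_add_periodic (m : Fin r → ℤ) (x : Fin r → ℝ) :
    ∑' n : Fin r → ℤ, f (intVec n + (intVec m + x)) = ∑' n : Fin r → ℤ, f (intVec n + x) := by
  rw [← (Equiv.addRight m).tsum_eq (fun n => f (intVec n + x))]
  refine tsum_congr fun n => congrArg f ?_
  ext i
  simp [intVec, add_assoc]

/-- The function on the torus with the given periodization. -/
lemma exists_periodization (hf : Continuous f) (hC : ∀ x, ‖f x‖ ≤ C * decayWeight x) :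
    ∃ F : C(UnitAddTorus (Fin r), ℂ), ∀ x : Fin r → ℝ,
      F (fun i => (x i : UnitAddCircle)) = ∑' n : Fin r → ℤ, f (intVec n + x) := by
  let p : (Fin r → ℝ) → UnitAddTorus (Fin r) := fun x i => (x i : UnitAddCircle)
  -- Openness is what makes the product of the maps $\mathbb R\to\mathbb R/\mathbb Z$ a quotient
  -- map, so continuity on the torus can be tested on $\mathbb R^r$.
  have hp : IsOpenQuotientMap p := by
    refine IsOpenQuotientMap.piMap (f := fun _ (y : ℝ) => (y : UnitAddCircle)) fun i => ?_
    exact QuotientAddGroup.isOpenQuotientMap_mk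
  have hfac : ∀ x y, p x = p y → ∑' n : Fin r → ℤ, f (intVec n + x) =
      ∑' n : Fin r → ℤ, f (intVec n + y) := by
    intro x y hxy
    have : ∀ i, ∃ m : ℤ, x i = m + y i := by
      intro i
      have h : ((x i - y i : ℝ) : UnitAddCircle) = 0 := by
        rw [AddCircle.coe_sub, sub_eq_zero]
        exact congrFun hxy i
      obtain ⟨m, hm⟩ := AddCircle.coe_eq_zero_iff (1 : ℝ) |>.1 h
      refine ⟨m, ?_⟩
      simp only [zsmul_eq_mul, mul_one] at hm
      linarith
    choose m hm using this
    rw [← tsum_intVec_add_periodic m y]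
    congr! with n
    ext i
    simp [intVec, hm i]
  refine ⟨⟨fun t => ∑' n : Fin r → ℤ, f (intVec n + Function.surjInv hp.surjective t), ?_⟩,
    fun x => ?_⟩
  · rw [← hp.continuous_comp_iff]
    refine (continuous_tsum_intVec_add hf hC).congr fun x => ?_
    exact hfac _ _ (Function.surjInv_eq hp.surjective _).symm
  · exact hfac _ _ (Function.surjInv_eq hp.surjective _)

lemma exp_two_pi_sum_intVec (m n : Fin r → ℤ) :
    Complex.exp (2 * Real.pi * Complex.I * ∑ i, (m i : ℂ) * (n i : ℂ)) = 1 := by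
  rw [Complex.exp_eq_one_iff]
  exact ⟨∑ i, m i * n i, by push_cast; ring⟩

lemma integrable_of_le_decayWeight (hf : Continuous f) (hC : ∀ x, ‖f x‖ ≤ C * decayWeight x) :
    MeasureTheory.Integrable f :=
  (integrable_decayWeight.const_mul C).mono' hf.aestronglyMeasurable (Eventually.of_forall hC)

/-- Poisson summation on `ℤ ^ r`. -/
theorem tsum_intVec_eq_tsum_fourier (hf : Continuous f) (hC : ∀ x, ‖f x‖ ≤ C * decayWeight x)
    (hs : Summable fun m : Fin r → ℤ =>
      ∫ x : Fin r → ℝ,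
        Complex.exp (2 * Real.pi * Complex.I * ∑ i, (m i : ℂ) * (x i : ℂ)) * f x) :
    ∑' n : Fin r → ℤ, f (intVec n) = ∑' m : Fin r → ℤ,
      ∫ x : Fin r → ℝ,
        Complex.exp (2 * Real.pi * Complex.I * ∑ i, (m i : ℂ) * (x i : ℂ)) * f x := by
  obtain ⟨F, hF⟩ := exists_periodization hf hC
  -- A Fourier coefficient pairs with the inverse character, whence `-m`. Unfolding the cube
  -- integral of the periodization gives the integral over $\mathbb R^r$, as the character is
  -- invariant under $\mathbb Z^r$.
  have hcoeff : ∀ m : Fin r → ℤ, UnitAddTorus.mFourierCoeff F (-m) =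
      ∫ x : Fin r → ℝ,
        Complex.exp (2 * Real.pi * Complex.I * ∑ i, (m i : ℂ) * (x i : ℂ)) * f x := by
    intro m
    set g : (Fin r → ℝ) → ℂ := fun x =>
      Complex.exp (2 * Real.pi * Complex.I * ∑ i, (m i : ℂ) * (x i : ℂ)) * f x with hg
    have hgn : ∀ x, ‖g x‖ = ‖f x‖ := by
      intro x
      have : 2 * Real.pi * Complex.I * ∑ i, (m i : ℂ) * (x i : ℂ) =
        ((2 * Real.pi * ∑ i, (m i : ℝ) * x i : ℝ) : ℂ) * Complex.I := by push_cast; ring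
      rw [hg]
      simp only [norm_mul, this, Complex.norm_exp_ofReal_mul_I, one_mul]
    have hgc : Continuous g := by fun_prop
    have hgC : ∀ x, ‖g x‖ ≤ C * decayWeight x := fun x => (hgn x).trans_le (hC x)
    have hgi := integrable_of_le_decayWeight hgc hgC
    rw [UnitAddTorus.mFourierCoeff_eq_integral _ _ 0, neg_neg]
    have hcube : {x : Fin r → ℝ | ∀ i, x i ∈ Set.Ioc ((0 : Fin r → ℝ) i)
        ((0 : Fin r → ℝ) i + 1)} = unitCube 0 := by ext; simp [unitCube]
    rw [hcube]
    have hsum := hasSum_integral_unitCube hgi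
    simp_rw [setIntegral_unitCube g] at hsum
    rw [← hsum.tsum_eq]
    rw [MeasureTheory.integral_tsum_of_summable_integral_norm
      (μ := MeasureTheory.volume.restrict (unitCube 0)) (F := fun n x => g (intVec n + x))]
    · refine MeasureTheory.setIntegral_congr_fun (measurableSet_unitCube 0) fun x _ => ?_
      simp only [hF, mFourier_coe, smul_eq_mul, hg]
      rw [← tsum_mul_left]
      refine tsum_congr fun n => ?_
      congr 1
      simp only [intVec, Pi.add_apply, Complex.ofReal_add, mul_add, Finset.sum_add_distrib,
        Complex.exp_add, Complex.ofReal_intCast]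
      rw [exp_two_pi_sum_intVec, one_mul]
    · intro n
      exact (hgi.comp_add_left (intVec n)).integrableOn
    · have h2 := (hasSum_integral_unitCube hgi.norm).summable
      exact h2.congr fun n => setIntegral_unitCube _ n
  have hs' : Summable (UnitAddTorus.mFourierCoeff F) := by
    rw [← (Equiv.neg (Fin r → ℤ)).summable_iff]
    exact hs.congr fun m => (hcoeff m).symm
  -- Poisson summation is the Fourier series of the periodization, evaluated at $0$.
  have h := UnitAddTorus.hasSum_mFourier_series_apply_of_summable hs'
    (fun i => ((0 : Fin r → ℝ) i : UnitAddCircle))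
  rw [hF] at h
  simp only [add_zero] at h
  rw [← h.tsum_eq, ← (Equiv.neg (Fin r → ℤ)).tsum_eq]
  refine tsum_congr fun m => ?_
  rw [mFourier_coe]
  simp [hcoeff]

end Periodization

/-! ### Algebra of the forms $B$ and $Q$. -/

section Bilinear

variable {r : ℕ} {A : Matrix (Fin r) (Fin r) ℤ} {K : Type*} [Field K]

lemma B_add_left (x y z : Fin r → K) : B A (x + y) z = B A x z + B A y z := by
  simp [B, add_dotProduct]

lemma B_add_right (x y z : Fin r → K) : B A x (y + z) = B A x y + B A x z := by
  simp [B, mulVec_add, dotProduct_add]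

lemma B_smul_left (t : K) (x y : Fin r → K) : B A (t • x) y = t * B A x y := by
  simp [B, smul_dotProduct]

lemma B_smul_right (t : K) (x y : Fin r → K) : B A x (t • y) = t * B A x y := by
  simp [B, mulVec_smul, dotProduct_smul]

lemma B_neg_left (x y : Fin r → K) : B A (-x) y = -B A x y := by simp [B]

lemma B_neg_right (x y : Fin r → K) : B A x (-y) = -B A x y := by
  simp [B, mulVec_neg, dotProduct_neg]

lemma B_sub_left (x y z : Fin r → K) : B A (x - y) z = B A x z - B A y z := by
  simp [B, sub_dotProduct]

lemma B_sub_right (x y z : Fin r → K) : B A x (y - z) = B A x y - B A x z := by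
  simp [B, mulVec_sub, dotProduct_sub]

lemma B_comm (hsymm : A.IsSymm) (x y : Fin r → K) : B A x y = B A y x := by
  have h : (A.map (Int.cast : ℤ → K))ᵀ = A.map (Int.cast : ℤ → K) := by
    rw [← transpose_map, hsymm.eq]
  rw [B, B, dotProduct_mulVec, dotProduct_comm, ← mulVec_transpose, h]

lemma Q_neg (x : Fin r → K) : Q A (-x) = Q A x := by simp [Q, B_neg_left, B_neg_right]

lemma Q_smul (t : K) (x : Fin r → K) : Q A (t • x) = t ^ 2 * Q A x := by
  simp only [Q, B_smul_left, B_smul_right]; ring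

variable [CharZero K]

lemma B_self (x : Fin r → K) : B A x x = 2 * Q A x := by rw [Q]; ring

lemma Q_add (hsymm : A.IsSymm) (x y : Fin r → K) : Q A (x + y) = Q A x + Q A y + B A x y := by
  simp only [Q, B_add_left, B_add_right, B_comm hsymm y x]; ring

lemma Q_sub (hsymm : A.IsSymm) (x y : Fin r → K) : Q A (x - y) = Q A x + Q A y - B A x y := by
  simp only [Q, B_sub_left, B_sub_right, B_comm hsymm y x]; ring

end Bilinear

section Casts

variable {r : ℕ} {A : Matrix (Fin r) (Fin r) ℤ}

lemma B_toC (x y : Fin r → ℝ) : B A (toC x) (toC y) = ((B A x y : ℝ) : ℂ) := by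
  simp [B, toC, dotProduct, mulVec]

lemma Q_toC (x : Fin r → ℝ) : Q A (toC x) = ((Q A x : ℝ) : ℂ) := by
  simp [Q, B_toC]

lemma toC_add (x y : Fin r → ℝ) : toC (x + y) = toC x + toC y := by ext; simp [toC]

lemma toC_neg (x : Fin r → ℝ) : toC (-x) = -toC x := by ext; simp [toC]

lemma toC_intVec (n : Fin r → ℤ) : toC (intVec n) = fun i => (n i : ℂ) := by
  ext; simp [toC, intVec]

lemma intVec_add (m n : Fin r → ℤ) : intVec (m + n) = intVec m + intVec n := by
  ext; simp [intVec]

lemma intVec_neg (n : Fin r → ℤ) : intVec (-n) = -intVec n := by ext; simp [intVec]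

lemma B_intVec (m n : Fin r → ℤ) : B A (intVec m) (intVec n) = ((m ⬝ᵥ (A *ᵥ n) : ℤ) : ℝ) := by
  simp [B, intVec, dotProduct, mulVec]

lemma continuous_B {X : Type*} [TopologicalSpace X] {f g : X → Fin r → ℝ} (hf : Continuous f)
    (hg : Continuous g) : Continuous fun x => B A (f x) (g x) := by
  simp only [B]
  fun_prop

lemma continuous_Q {X : Type*} [TopologicalSpace X] {f : X → Fin r → ℝ} (hf : Continuous f) :
    Continuous fun x => Q A (f x) :=
  continuous_const.mul (continuous_B hf hf)

/-- `|B(c, v)| ≤ C ‖v‖`. -/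
lemma exists_abs_B_le (A : Matrix (Fin r) (Fin r) ℤ) : ∃ C : ℝ, 0 ≤ C ∧
    ∀ c v : Fin r → ℝ, |B A c v| ≤ C * ‖c‖ * ‖v‖ := by
  refine ⟨∑ i, ∑ j, |(A i j : ℝ)|, by positivity, fun c v => ?_⟩
  simp only [B, dotProduct, mulVec, map_apply]
  refine (Finset.abs_sum_le_sum_abs _ _).trans ?_
  simp only [Finset.sum_mul, abs_mul]
  refine Finset.sum_le_sum fun i _ => ?_
  rw [← Finset.sum_mul, ← Finset.sum_mul]
  have h1 : |c i| ≤ ‖c‖ := norm_le_pi_norm c i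
  have h2 : |∑ j, (A i j : ℝ) * v j| ≤ (∑ j, |(A i j : ℝ)|) * ‖v‖ := by
    refine (Finset.abs_sum_le_sum_abs _ _).trans ?_
    rw [Finset.sum_mul]
    refine Finset.sum_le_sum fun j _ => ?_
    rw [abs_mul]
    gcongr
    exact norm_le_pi_norm v j
  calc |c i| * |∑ j, (A i j : ℝ) * v j| ≤ ‖c‖ * ((∑ j, |(A i j : ℝ)|) * ‖v‖) := by gcongr
    _ = _ := by ring

end Casts

/-! ### Lorentzian geometry: consequences of the type $(r-1,1)$. -/

/-- `A` is symmetric, non-degenerate, and its form is positive definite on the orthogonal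
complement of every vector of negative norm. -/
structure IsLorentzian {r : ℕ} (A : Matrix (Fin r) (Fin r) ℤ) : Prop where
  symm : A.IsSymm
  det_ne_zero : A.det ≠ 0
  pos_of_orthogonal : ∀ c v : Fin r → ℝ, Q A c < 0 → B A c v = 0 → v ≠ 0 → 0 < Q A v

section Lorentzian

variable {r : ℕ} {A : Matrix (Fin r) (Fin r) ℤ}

lemma det_map_ne_zero (hdet : A.det ≠ 0) : (A.map (Int.cast : ℤ → ℝ)).det ≠ 0 := by
  have : (A.map (Int.cast : ℤ → ℝ)).det = (A.det : ℝ) := by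
    rw [Int.cast_det]
  rw [this]
  exact_mod_cast hdet

lemma exists_B_ne_zero (hdet : A.det ≠ 0) {v : Fin r → ℝ} (hv : v ≠ 0) : ∃ w, B A w v ≠ 0 := by
  -- For $w=Av$ the value $B(w,v)$ is the Euclidean square of $Av$.
  refine ⟨A.map (Int.cast : ℤ → ℝ) *ᵥ v, fun h => hv ?_⟩
  exact eq_zero_of_mulVec_eq_zero (det_map_ne_zero hdet) (dotProduct_self_eq_zero.1 h)

/-- Otherwise $c$ and $v$ would span a negative definite plane. -/
lemma nonneg_of_orthogonal (hsymm : A.IsSymm) (htype : HasType A (r - 1) 1) {c v : Fin r → ℝ}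
    (hc : Q A c < 0) (hcv : B A c v = 0) : 0 ≤ Q A v := by
  by_contra! hv
  have hQ : ∀ s t : ℝ, Q A (s • c + t • v) = s ^ 2 * Q A c + t ^ 2 * Q A v := by
    intro s t
    simp [Q_add hsymm, Q_smul, B_smul_left, B_smul_right, hcv]
  have hneg : ∀ s t : ℝ, s ≠ 0 ∨ t ≠ 0 → Q A (s • c + t • v) < 0 := by
    rintro s t (h | h) <;> rw [hQ]
    · have := sq_pos_of_ne_zero h
      nlinarith [sq_nonneg t]
    · have := sq_pos_of_ne_zero h
      nlinarith [sq_nonneg s]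
  have hli : LinearIndependent ℝ ![c, v] := by
    rw [LinearIndependent.pair_iff]
    intro s t hst
    by_contra h
    have := hneg s t (by tauto)
    rw [hst] at this
    simp [Q, B] at this
  have h2 : (2 : ℕ) ≤ 1 := by
    refine htype.2.2 ⟨Submodule.span ℝ {c, v}, ?_, fun x hx hx0 => ?_⟩
    · have := finrank_span_eq_card hli
      rwa [Matrix.range_cons_cons_empty, Fintype.card_fin] at this
    · obtain ⟨s, t, rfl⟩ := Submodule.mem_span_pair.1 hx
      refine hneg s t ?_
      by_contra! h
      simp [h.1, h.2] at hx0
  omega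

/-- An isotropic $v\ne0$ in $c^\perp$ pairs nontrivially with some $w'\in c^\perp$, by
non-degeneracy. Then $Q(w'+tv)$ is affine and non-constant in $t$, hence takes the value $-1$ on
$c^\perp$, a contradiction. -/
lemma isLorentzian_of_hasType (hsymm : A.IsSymm) (hdet : A.det ≠ 0)
    (htype : HasType A (r - 1) 1) : IsLorentzian A := by
  refine ⟨hsymm, hdet, fun c v hc hcv hv => ?_⟩
  refine lt_of_le_of_ne (nonneg_of_orthogonal hsymm htype hc hcv) fun h0 => ?_
  obtain ⟨w, hw⟩ := exists_B_ne_zero hdet hv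
  set w' := w - (B A c w / (2 * Q A c)) • c with hw'
  have h1 : B A c w' = 0 := by
    rw [hw', B_sub_right, B_smul_right, B_self, div_mul_cancel₀ _ (by linarith), sub_self]
  have h2 : B A w' v = B A w v := by
    rw [hw', B_sub_left, B_smul_left, hcv]; simp
  have h3 := nonneg_of_orthogonal hsymm htype hc
    (v := w' + (-(Q A w' + 1) / B A w v) • v) (by rw [B_add_right, B_smul_right, h1, hcv]; simp)
  rw [Q_add hsymm, Q_smul, ← h0, B_smul_right, h2, div_mul_cancel₀ _ hw] at h3
  linarith

namespace IsLorentzian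

variable (hA : IsLorentzian A)
include hA

lemma nonneg_of_orthogonal {c v : Fin r → ℝ} (hc : Q A c < 0) (hcv : B A c v = 0) : 0 ≤ Q A v := by
  by_cases hv : v = 0
  · simp [hv, Q, B]
  · exact (hA.pos_of_orthogonal c v hc hcv hv).le

/-- Reversed Cauchy–Schwarz inequality: $Q\ge0$ on the projection of $v$ to $c^\perp$. -/
lemma four_mul_le {c : Fin r → ℝ} (hc : Q A c < 0) (v : Fin r → ℝ) :
    4 * Q A c * Q A v ≤ B A c v ^ 2 := by
  have h1 : B A c (v - (B A c v / (2 * Q A c)) • c) = 0 := by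
    rw [B_sub_right, B_smul_right, B_self, div_mul_cancel₀ _ (by linarith), sub_self]
  have h2 := hA.nonneg_of_orthogonal hc h1
  rw [Q_sub hA.symm, Q_smul, B_smul_right, B_comm hA.symm v c] at h2
  have h3 : Q A v + (B A c v / (2 * Q A c)) ^ 2 * Q A c - B A c v / (2 * Q A c) * B A c v =
    Q A v - B A c v ^ 2 / (4 * Q A c) := by field_simp; ring
  rw [h3, sub_nonneg, div_le_iff_of_neg (by linarith)] at h2
  linarith

/-- After splitting off the component along $c$, the coefficient of $B(c,v)^2$ is
$(1+2Q(c))/(2Q(c))$, which is positive exactly when $Q(c)<-1/2$ (given $Q(c)<0$). An open condition,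
rather than $Q(c)=-1$, leaves room for $c$ to vary in a ball. -/
lemma majorant_pos {c v : Fin r → ℝ} (hc : Q A c < -(1 / 2)) (hv : v ≠ 0) :
    0 < 2 * Q A v + B A c v ^ 2 := by
  have hc0 : Q A c < 0 := by linarith
  set v' := v - (B A c v / (2 * Q A c)) • c with hv'
  have h1 : B A c v' = 0 := by
    rw [hv', B_sub_right, B_smul_right, B_self, div_mul_cancel₀ _ (by linarith), sub_self]
  have h4 : Q A v' = Q A v - B A c v ^ 2 / (4 * Q A c) := by
    rw [hv', Q_sub hA.symm, Q_smul, B_smul_right, B_comm hA.symm v c]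
    field_simp; ring
  have h5 : 2 * Q A v + B A c v ^ 2 =
      2 * Q A v' + B A c v ^ 2 * ((1 + 2 * Q A c) / (2 * Q A c)) := by
    have h0 : Q A c ≠ 0 := hc0.ne
    rw [h4]; field_simp; ring
  have h6 : 0 < (1 + 2 * Q A c) / (2 * Q A c) := div_pos_of_neg_of_neg (by linarith) (by linarith)
  rw [h5]
  by_cases h : v' = 0
  · have h7 : B A c v ≠ 0 := by
      intro h0
      rw [h0] at hv'
      simp [h] at hv'
      exact hv hv'.symm
    have := hA.nonneg_of_orthogonal hc0 h1
    positivity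
  · have := hA.pos_of_orthogonal c v' hc0 h1 h
    positivity

/-- By compactness of `K` times the unit sphere, and homogeneity in $v$. -/
lemma exists_majorant_ge {K : Set (Fin r → ℝ)} (hK : IsCompact K)
    (hKQ : ∀ c ∈ K, Q A c < -(1 / 2)) :
    ∃ δ > 0, ∀ c ∈ K, ∀ v : Fin r → ℝ, δ * ‖v‖ ^ 2 ≤ 2 * Q A v + B A c v ^ 2 := by
  have hcomp : IsCompact (K ×ˢ Metric.sphere (0 : Fin r → ℝ) 1) := hK.prod (isCompact_sphere _ _)
  have hcont : Continuous fun p : (Fin r → ℝ) × (Fin r → ℝ) => 2 * Q A p.2 + B A p.1 p.2 ^ 2 :=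
    (continuous_const.mul (continuous_Q continuous_snd)).add
      ((continuous_B continuous_fst continuous_snd).pow 2)
  obtain ⟨δ, hδ, h⟩ := hcomp.exists_forall_le' hcont.continuousOn (a := 0) fun p hp => by
    refine hA.majorant_pos (hKQ _ hp.1) fun h0 => ?_
    have := hp.2
    simp [h0] at this
  refine ⟨δ, hδ, fun c hc v => ?_⟩
  by_cases hv : v = 0
  · simp [hv, Q, B]
  have hv' : ‖v‖ ≠ 0 := norm_ne_zero_iff.2 hv
  have h1 := h (c, ‖v‖⁻¹ • v) ⟨hc, by simp [norm_smul, hv']⟩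
  simp only [Q_smul, B_smul_right] at h1
  have h2 : 2 * (‖v‖⁻¹ ^ 2 * Q A v) + (‖v‖⁻¹ * B A c v) ^ 2 =
      (2 * Q A v + B A c v ^ 2) / ‖v‖ ^ 2 := by field_simp
  rwa [h2, le_div_iff₀ (by positivity)] at h1

variable {c₀ : Fin r → ℝ}

/-- The combination $B(c',c_0)c-B(c,c_0)c'$ is orthogonal to $c_0$, so $Q\ge0$ on it; if
$B(c,c')\ge0$, expanding gives a negative value. Here $c'$ may be isotropic, which covers cusps. -/
lemma B_neg_of_mem (hc₀ : Q A c₀ < 0) {c c' : Fin r → ℝ} (hc : Q A c < 0) (hcc : B A c c₀ < 0)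
    (hc' : Q A c' ≤ 0) (hcc' : B A c' c₀ < 0) : B A c c' < 0 := by
  by_contra! h
  have h1 : B A c₀ (B A c' c₀ • c - B A c c₀ • c') = 0 := by
    rw [B_sub_right, B_smul_right, B_smul_right, B_comm hA.symm c₀ c, B_comm hA.symm c₀ c']
    ring
  have h2 := hA.nonneg_of_orthogonal hc₀ h1
  rw [Q_sub hA.symm, Q_smul, Q_smul, B_smul_left, B_smul_right] at h2
  have h3 : 0 < B A c' c₀ ^ 2 := sq_pos_of_neg hcc'
  have h4 : 0 < B A c c₀ ^ 2 := sq_pos_of_neg hcc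
  have h5 : 0 < B A c' c₀ * B A c c₀ := mul_pos_of_neg_of_neg hcc' hcc
  nlinarith [mul_nonneg h5.le h]

end IsLorentzian

lemma mem_coneC {c₀ : Fin r → ℝ} (hc₀ : Q A c₀ < 0) : c₀ ∈ coneC A c₀ :=
  ⟨hc₀, by rw [B_self]; linarith⟩

end Lorentzian

/-! ### Simultaneous diagonalization of the form and its majorant. -/

section Diagonalization

variable {r : ℕ}

lemma exists_orthogonal_mulVec_single {e : Fin r → ℝ} (he : e ⬝ᵥ e = 1) (i₀ : Fin r) :
    ∃ O : Matrix (Fin r) (Fin r) ℝ, Oᵀ * O = 1 ∧ O *ᵥ Pi.single i₀ 1 = e := by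
  let e' : EuclideanSpace ℝ (Fin r) := WithLp.toLp 2 e
  have he' : ‖e'‖ = 1 := by
    have h : inner ℝ e' e' = (1 : ℝ) := by
      rw [EuclideanSpace.inner_eq_star_dotProduct]
      simpa [e'] using he
    rw [real_inner_self_eq_norm_sq] at h
    exact (pow_eq_one_iff_of_nonneg (norm_nonneg _) two_ne_zero).1 h
  have hv : Orthonormal ℝ (({i₀} : Set (Fin r)).domRestrict fun _ => e') := by
    refine ⟨fun i => he', fun i j hij => ?_⟩
    exact absurd (Subsingleton.elim i j) hij
  obtain ⟨b, hb⟩ := hv.exists_orthonormalBasis_extension_of_card_eq (by simp)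
  refine ⟨Matrix.of fun i j => b j i, ?_, ?_⟩
  · ext i j
    have h := orthonormal_iff_ite.1 b.orthonormal i j
    rw [EuclideanSpace.inner_eq_star_dotProduct] at h
    rw [mul_apply, one_apply, ← h]
    simp [dotProduct, mul_comm]
  · ext i
    simp [hb i₀ rfl, e']

/-- A vector of norm `-1` can be completed to an orthogonal basis that diagonalizes the form. -/
lemma IsLorentzian.exists_diagonalizing {A : Matrix (Fin r) (Fin r) ℤ} (hA : IsLorentzian A)
    {c : Fin r → ℝ} (hc : Q A c = -1) (i₀ : Fin r) : ∃ P : Matrix (Fin r) (Fin r) ℝ,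
      (∀ u v, B A (P *ᵥ u) (P *ᵥ v) = ∑ i, (if i = i₀ then -1 else 1) * (u i * v i)) ∧
      (∀ u, B A c (P *ᵥ u) ^ 2 = 2 * u i₀ ^ 2) := by
  classical
  set A' := A.map (Int.cast : ℤ → ℝ) with hA'
  have hsym : A'ᵀ = A' := by rw [hA', ← transpose_map, hA.symm.eq]
  -- `M` is the Gram matrix of the majorant. With $M=S^TS$ one has $|Sc|^2=-2+4=2$, so some
  -- orthogonal $O$ sends a basis vector to $Sc/\sqrt2$, and $P=S^{-1}O$ works: the majorant becomes
  -- the identity, and subtracting $B(c,\cdot)^2$ flips one sign.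
  set M : Matrix (Fin r) (Fin r) ℝ := A' + vecMulVec (A' *ᵥ c) (A' *ᵥ c) with hM
  have hMB : ∀ x y, x ⬝ᵥ (M *ᵥ y) = B A x y + B A c x * B A c y := by
    intro x y
    rw [hM, add_mulVec, dotProduct_add, vecMulVec_mulVec, B_comm hA.symm c x, B_comm hA.symm c y]
    simp only [B, ← hA', dotProduct_smul]
    rw [dotProduct_comm y]
    simp
  have hpos : M.PosDef := by
    refine PosDef.of_dotProduct_mulVec_pos ?_ fun x hx => ?_
    · rw [IsHermitian, conjTranspose_eq_transpose_of_trivial, hM, transpose_add, hsym,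
        transpose_vecMulVec]
    · have := hA.majorant_pos (c := c) (v := x) (by rw [hc]; norm_num) hx
      simp only [star_trivial]
      rw [hMB, B_self]
      nlinarith
  obtain ⟨S, hS⟩ : ∃ S : Matrix (Fin r) (Fin r) ℝ, M = Sᵀ * S := by
    open scoped MatrixOrder in
    obtain ⟨S, hS⟩ := CStarAlgebra.nonneg_iff_eq_star_mul_self.mp hpos.posSemidef.nonneg
    exact ⟨S, by rw [hS, star_eq_conjTranspose, conjTranspose_eq_transpose_of_trivial]⟩
  have hSB : ∀ x y, (S *ᵥ x) ⬝ᵥ (S *ᵥ y) = B A x y + B A c x * B A c y := by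
    intro x y
    rw [← hMB, hS, ← mulVec_mulVec, dotProduct_mulVec x, vecMul_transpose]
  have hSdet : IsUnit S.det := by
    have := hpos.isUnit
    rw [hS, isUnit_iff_isUnit_det, det_mul] at this
    exact isUnit_of_mul_isUnit_right this
  have hBcc : B A c c = -2 := by rw [B_self, hc]; norm_num
  have h2 : (√2 : ℝ) ^ 2 = 2 := Real.sq_sqrt (by norm_num)
  have h20 : (√2 : ℝ) ≠ 0 := by positivity
  obtain ⟨O, hO, hOe⟩ := exists_orthogonal_mulVec_single (e := (√2)⁻¹ • (S *ᵥ c)) (by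
    rw [smul_dotProduct, dotProduct_smul, hSB, hBcc]
    simp only [smul_eq_mul]
    field_simp
    linarith) i₀
  have hOO : ∀ u v, (O *ᵥ u) ⬝ᵥ (O *ᵥ v) = u ⬝ᵥ v := by
    intro u v
    rw [dotProduct_mulVec, vecMul_mulVec, ← dotProduct_mulVec, hO, one_mulVec]
  have hSP : ∀ u, S *ᵥ ((S⁻¹ * O) *ᵥ u) = O *ᵥ u := by
    intro u
    rw [mulVec_mulVec, ← Matrix.mul_assoc, mul_nonsing_inv _ hSdet, Matrix.one_mul]
  have hcP : ∀ u, B A c ((S⁻¹ * O) *ᵥ u) = -√2 * u i₀ := by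
    intro u
    have h1 := hSB c ((S⁻¹ * O) *ᵥ u)
    rw [hSP, hBcc] at h1
    have h3 : S *ᵥ c = √2 • (O *ᵥ Pi.single i₀ 1) := by
      rw [hOe, smul_smul, mul_inv_cancel₀ h20, one_smul]
    rw [h3, smul_dotProduct, hOO, single_dotProduct, smul_eq_mul] at h1
    linarith
  refine ⟨S⁻¹ * O, fun u v => ?_, fun u => ?_⟩
  · have h1 := hSB ((S⁻¹ * O) *ᵥ u) ((S⁻¹ * O) *ᵥ v)
    rw [hSP, hSP, hOO, hcP, hcP] at h1
    have h3 : ∑ i, (if i = i₀ then (-1 : ℝ) else 1) * (u i * v i) =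
        ∑ i, (u i * v i - if i = i₀ then 2 * (u i * v i) else 0) := by
      refine Finset.sum_congr rfl fun i _ => ?_
      split_ifs <;> ring
    rw [h3, Finset.sum_sub_distrib, Finset.sum_ite_eq' Finset.univ i₀]
    simp only [Finset.mem_univ, if_true]
    rw [dotProduct] at h1
    linear_combination -h1 - u i₀ * v i₀ * h2
  · rw [hcP, mul_pow, neg_sq, h2]

/-- It follows that $\det A<0$, and that the Jacobian $|\det P|$ equals $1/\sqrt{-\det A}$. -/
lemma det_of_diagonalizing {A : Matrix (Fin r) (Fin r) ℤ} {P : Matrix (Fin r) (Fin r) ℝ}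
    {i₀ : Fin r}
    (h : ∀ u v, B A (P *ᵥ u) (P *ᵥ v) = ∑ i, (if i = i₀ then -1 else 1) * (u i * v i)) :
    (A.det : ℝ) * P.det ^ 2 = -1 := by
  have h1 : Pᵀ * A.map (Int.cast : ℤ → ℝ) * P =
      diagonal fun i => if i = i₀ then (-1 : ℝ) else 1 := by
    ext i j
    have h2 := h (Pi.single i 1) (Pi.single j 1)
    rw [B, mulVec_mulVec, ← vecMul_transpose, ← dotProduct_mulVec, mulVec_mulVec,
      single_one_dotProduct, mulVec_single_one, ← Matrix.mul_assoc] at h2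
    rw [col_apply] at h2
    rw [h2, diagonal_apply]
    simp only [Pi.single_apply]
    by_cases hij : i = j
    · subst hij; simp
    · rw [if_neg hij]
      refine Finset.sum_eq_zero fun k _ => ?_
      by_cases hk : k = i
      · subst hk; simp [hij]
      · simp [hk]
  have h3 := congrArg det h1
  rw [det_mul, det_mul, det_transpose, det_diagonal, Finset.prod_ite_eq'] at h3
  rw [Int.cast_det]
  simp only [Finset.mem_univ, if_true] at h3
  linear_combination h3

end Diagonalization

/-! ### Fourier transform of the Gaussian. -/

section Gaussian

variable {r : ℕ} {A : Matrix (Fin r) (Fin r) ℤ}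

/-- The Gaussian `exp(2πi Q(v) τ - π Im(τ) B(c, v) ^ 2)`. -/
noncomputable def gaussKer (A : Matrix (Fin r) (Fin r) ℤ) (c : Fin r → ℝ) (τ : ℂ)
    (v : Fin r → ℝ) : ℂ :=
  Complex.exp (2 * Real.pi * Complex.I * (Q A v : ℝ) * τ - Real.pi * τ.im * (B A c v : ℝ) ^ 2)

/-- The character `exp(2πi B(v, b))`. -/
noncomputable def latChar (A : Matrix (Fin r) (Fin r) ℤ) (v b : Fin r → ℝ) : ℂ :=
  Complex.exp (2 * Real.pi * Complex.I * (B A v b : ℝ))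

/-- The constant in the Fourier transform of `gaussKer`. -/
noncomputable def gaussConst (A : Matrix (Fin r) (Fin r) ℤ) (τ : ℂ) : ℂ :=
  (((-Complex.I * τ) ^ (1 / 2 : ℂ)) ^ r)⁻¹ * (-Complex.I * τ / (‖τ‖ : ℝ)) *
    ((√(-(A.det : ℝ)))⁻¹ : ℝ)

lemma integral_eq_abs_det_mul_integral_mulVec {P : Matrix (Fin r) (Fin r) ℝ} (hP : P.det ≠ 0)
    {f : (Fin r → ℝ) → ℂ} (hf : Continuous f) :
    ∫ x, f x = (|P.det| : ℝ) * ∫ u, f (P *ᵥ u) := by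
  have h := Real.map_matrix_volume_pi_eq_smul_volume_pi hP
  have h1 : ∫ u, f (P *ᵥ u) = ∫ x, f x ∂(MeasureTheory.Measure.map (toLin' P)
      MeasureTheory.volume) := by
    rw [MeasureTheory.integral_map]
    · rfl
    · exact (LinearMap.continuous_of_finiteDimensional _).aemeasurable
    · exact hf.aestronglyMeasurable
  rw [h1, h, MeasureTheory.integral_smul_measure, ENNReal.toReal_ofReal (abs_nonneg _),
    abs_inv, Complex.real_smul, ← mul_assoc, ← Complex.ofReal_mul,
    mul_inv_cancel₀ (abs_ne_zero.2 hP), Complex.ofReal_one, one_mul]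

lemma continuous_gaussKer (c : Fin r → ℝ) (τ : ℂ) : Continuous (gaussKer A c τ) := by
  unfold gaussKer
  have h1 : Continuous fun v : Fin r → ℝ => Q A v := continuous_Q continuous_id
  have h2 : Continuous fun v : Fin r → ℝ => B A c v := continuous_B continuous_const continuous_id
  fun_prop

lemma continuous_latChar (b : Fin r → ℝ) : Continuous fun v => latChar A v b := by
  unfold latChar
  have h2 : Continuous fun v : Fin r → ℝ => B A v b := continuous_B continuous_id continuous_const
  fun_prop

lemma norm_latChar (v b : Fin r → ℝ) : ‖latChar A v b‖ = 1 := by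
  have : 2 * Real.pi * Complex.I * (B A v b : ℝ) =
      ((2 * Real.pi * B A v b : ℝ) : ℂ) * Complex.I := by push_cast; ring
  rw [latChar, this, Complex.norm_exp_ofReal_mul_I]

lemma neg_one_div_im (τ : ℂ) : (-1 / τ).im = τ.im / ‖τ‖ ^ 2 := by
  rw [neg_div, one_div, Complex.neg_im, Complex.inv_im, Complex.normSq_eq_norm_sq]
  ring

lemma neg_one_div_im_pos {τ : ℂ} (hτ : 0 < τ.im) : 0 < (-1 / τ).im := by
  have : τ ≠ 0 := by rintro rfl; simp at hτ
  rw [neg_one_div_im]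
  positivity

/-- With $w=-i\tau$ and $h=w^{1/2}$, each positive direction contributes $h^{-1}$ and the negative
one $\bar h^{-1}=h^{-1}\cdot h/\bar h$, where $h/\bar h=h^2/|h|^2=w/|\tau|$. -/
lemma gaussian_const_aux {τ : ℂ} (hτ : 0 < τ.im) (i₀ : Fin r) :
    ∏ i : Fin r, (Real.pi / (if i = i₀ then Real.pi * Complex.I * (starRingEnd ℂ) τ
      else -(Real.pi * Complex.I * τ))) ^ (1 / 2 : ℂ) =
    (((-Complex.I * τ) ^ (1 / 2 : ℂ)) ^ r)⁻¹ * (-Complex.I * τ / (‖τ‖ : ℝ)) := by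
  have hτ0 : τ ≠ 0 := by rintro rfl; simp at hτ
  have hpi : (Real.pi : ℂ) ≠ 0 := by exact_mod_cast Real.pi_ne_zero
  set w : ℂ := -Complex.I * τ with hw
  have hwre : 0 < w.re := by simpa [hw] using hτ
  have hw0 : w ≠ 0 := by rintro h; simp [h] at hwre
  have harg : w.arg ≠ Real.pi := by
    intro h
    rw [Complex.arg_eq_pi_iff] at h
    linarith [h.1]
  have hconj : (starRingEnd ℂ) w = Complex.I * (starRingEnd ℂ) τ := by simp [hw]
  set h := w ^ (1 / 2 : ℂ) with hh
  have hh0 : h ≠ 0 := by simp [hh, hw0]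
  have hsq : h * h = w := by
    rw [hh, ← Complex.cpow_add _ _ hw0]; norm_num
  have h1 : ((Real.pi : ℂ) / (-(Real.pi * Complex.I * τ))) ^ (1 / 2 : ℂ) = h⁻¹ := by
    have : (Real.pi : ℂ) / (-(Real.pi * Complex.I * τ)) = w⁻¹ := by
      rw [hw, div_eq_iff (by simp [hτ0])]
      field_simp
    rw [this, Complex.inv_cpow _ _ harg]
  have h2 : ((Real.pi : ℂ) / (Real.pi * Complex.I * (starRingEnd ℂ) τ)) ^ (1 / 2 : ℂ) =
      ((starRingEnd ℂ) h)⁻¹ := by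
    have : (Real.pi : ℂ) / (Real.pi * Complex.I * (starRingEnd ℂ) τ) = ((starRingEnd ℂ) w)⁻¹ := by
      rw [hconj, mul_assoc, div_mul_cancel_left₀ hpi]
    have harg' : ((starRingEnd ℂ) w).arg ≠ Real.pi := by
      intro h
      rw [Complex.arg_eq_pi_iff] at h
      simp at h
      linarith [h.1]
    rw [this, Complex.inv_cpow _ _ harg', Complex.conj_cpow _ _ harg, hh, map_div₀, map_one,
      Complex.conj_ofNat]
  have h3 : ∀ i : Fin r, ((Real.pi : ℂ) / (if i = i₀ then Real.pi * Complex.I * (starRingEnd ℂ) τ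
      else -(Real.pi * Complex.I * τ))) ^ (1 / 2 : ℂ) =
      h⁻¹ * if i = i₀ then h / (starRingEnd ℂ) h else 1 := by
    intro i
    split_ifs
    · rw [h2]; field_simp
    · rw [h1, mul_one]
  simp_rw [h3]
  rw [Finset.prod_mul_distrib, Finset.prod_ite_eq']
  simp only [Finset.prod_const, Finset.card_univ, Fintype.card_fin, Finset.mem_univ, if_true,
    inv_pow]
  congr 1
  have hnorm : (‖τ‖ : ℂ) = h * (starRingEnd ℂ) h := by
    rw [Complex.mul_conj, Complex.normSq_eq_norm_sq, ← norm_pow, sq, hsq, hw]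
    simp
  have hc0 : (starRingEnd ℂ) h ≠ 0 := by simpa using hh0
  rw [hnorm, ← hsq]
  field_simp

/-- The Fourier transform of `gaussKer`. -/
theorem IsLorentzian.integral_gaussKer (hA : IsLorentzian A) {c : Fin r → ℝ} (hc : Q A c = -1)
    {τ : ℂ} (hτ : 0 < τ.im) (b : Fin r → ℝ) :
    ∫ v, gaussKer A c τ v * latChar A v b = gaussConst A τ * gaussKer A c (-1 / τ) b := by
  have hτ0 : τ ≠ 0 := by rintro rfl; simp at hτ
  have hpi : (Real.pi : ℂ) ≠ 0 := by exact_mod_cast Real.pi_ne_zero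
  have hr : 0 < r := by
    rcases Nat.eq_zero_or_pos r with rfl | h
    · simp [Q, B] at hc
    · exact h
  let i₀ : Fin r := ⟨0, hr⟩
  obtain ⟨P, hPB, hPc⟩ := hA.exists_diagonalizing hc i₀
  have hdet := det_of_diagonalizing hPB
  have hP : P.det ≠ 0 := by rintro h; simp [h] at hdet
  have hPabs : |P.det| = (√(-(A.det : ℝ)))⁻¹ := by
    have h1 : -(A.det : ℝ) = (P.det ^ 2)⁻¹ := by
      refine eq_inv_of_mul_eq_one_left ?_; linarith
    rw [h1, Real.sqrt_inv, Real.sqrt_sq_eq_abs, inv_inv]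
  obtain ⟨β, rfl⟩ : ∃ β, b = P *ᵥ β := ⟨P⁻¹ *ᵥ b, by
    rw [mulVec_mulVec, mul_nonsing_inv _ (isUnit_iff_ne_zero.2 hP), one_mulVec]⟩
  rw [integral_eq_abs_det_mul_integral_mulVec hP
    (f := fun v => gaussKer A c τ v * latChar A v (P *ᵥ β))
    ((continuous_gaussKer c τ).mul (continuous_latChar _))]
  -- Along the negative direction the exponent is $-\pi i\tau-2\pi\operatorname{Im}\tau=-\pi
  -- i\bar\tau$ times $u_{i_0}^2$: the extra Gaussian replaces $\tau$ by its conjugate.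
  set bb : Fin r → ℂ := fun i => if i = i₀ then Real.pi * Complex.I * (starRingEnd ℂ) τ
      else -(Real.pi * Complex.I * τ) with hbb
  set cc : Fin r → ℂ := fun i => 2 * Real.pi * Complex.I * ((if i = i₀ then -1 else 1) * β i)
    with hcc
  have hbre : ∀ i, 0 < (bb i).re := by
    intro i
    simp only [hbb]
    split_ifs
    · simp; positivity
    · simp; positivity
  have hconj : (starRingEnd ℂ) τ = τ - 2 * τ.im * Complex.I := by
    apply Complex.ext <;> simp
    ring
  have hsq : ∀ u : Fin r → ℝ, ((B A c (P *ᵥ u) : ℝ) : ℂ) ^ 2 =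
      ∑ i, if i = i₀ then 2 * (u i : ℂ) ^ 2 else 0 := by
    intro u
    rw [← Complex.ofReal_pow, hPc, Finset.sum_ite_eq']
    simp
  have hQ : ∀ u : Fin r → ℝ, ((Q A (P *ᵥ u) : ℝ) : ℂ) =
      ∑ i, 1 / 2 * ((if i = i₀ then -1 else 1) * (u i : ℂ) ^ 2) := by
    intro u
    rw [Q, hPB, Complex.ofReal_mul, ← Finset.mul_sum, Complex.ofReal_sum]
    congr 1
    · norm_num
    · refine Finset.sum_congr rfl fun i _ => ?_
      split_ifs <;> push_cast <;> ring
  have hint : ∀ u : Fin r → ℝ, gaussKer A c τ (P *ᵥ u) * latChar A (P *ᵥ u) (P *ᵥ β) =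
      Complex.exp (-∑ i, bb i * (u i : ℂ) ^ 2 + ∑ i, cc i * u i) := by
    intro u
    rw [gaussKer, latChar, ← Complex.exp_add, hsq, hQ, hPB]
    congr 1
    rw [Complex.ofReal_sum]
    simp only [Finset.mul_sum, Finset.sum_mul, ← Finset.sum_neg_distrib, ← Finset.sum_add_distrib,
      ← Finset.sum_sub_distrib]
    refine Finset.sum_congr rfl fun i _ => ?_
    simp only [hbb, hcc, hconj]
    split_ifs
    · push_cast
      ring_nf
      simp only [Complex.I_sq]
      ring
    · push_cast
      ring
  simp_rw [hint]
  rw [GaussianFourier.integral_cexp_neg_sum_mul_add hbre, Finset.prod_mul_distrib,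
    ← Complex.exp_sum, gaussian_const_aux hτ, gaussConst, hPabs]
  have hexp : ∑ i, cc i ^ 2 / (4 * bb i) = 2 * Real.pi * Complex.I * (Q A (P *ᵥ β) : ℝ) * (-1 / τ)
      - Real.pi * (-1 / τ).im * (B A c (P *ᵥ β) : ℝ) ^ 2 := by
    have him : (((-1 / τ).im : ℝ) : ℂ) = τ.im / (τ * (starRingEnd ℂ) τ) := by
      rw [neg_one_div_im, Complex.mul_conj, Complex.normSq_eq_norm_sq]
      push_cast; rfl
    have hc0 : (starRingEnd ℂ) τ ≠ 0 := by simpa using hτ0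
    have him2 : (τ.im : ℂ) = (τ - (starRingEnd ℂ) τ) / (2 * Complex.I) := by
      rw [hconj]; field_simp; ring
    rw [hsq, hQ, him, him2]
    simp only [Finset.mul_sum, Finset.sum_mul, ← Finset.sum_sub_distrib]
    refine Finset.sum_congr rfl fun i _ => ?_
    simp only [hbb, hcc]
    split_ifs
    · field_simp
      ring_nf
      simp only [Complex.I_sq]
      ring
    · field_simp
      ring_nf
  rw [hexp, gaussKer]
  ring

end Gaussian

/-! ### Decay of the Gaussian against the weight. -/

section Decay

variable {r : ℕ} {A : Matrix (Fin r) (Fin r) ℤ}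

lemma exists_one_add_mul_exp_le (r : ℕ) {δ : ℝ} (hδ : 0 < δ) : ∃ C : ℝ, 0 ≤ C ∧
    ∀ v : Fin r → ℝ, (1 + ‖v‖) * Real.exp (-δ * ‖v‖) ≤ C * decayWeight v := by
  refine ⟨(r + 2).factorial / δ ^ (r + 2) * Real.exp δ, by positivity, fun v => ?_⟩
  rw [decayWeight, ← div_eq_mul_inv, le_div_iff₀ (by positivity)]
  -- The exponent is $r+2$: $r+1$ for the weight and one more for the factor $1+\|v\|$, which later
  -- absorbs a linear form.
  have h := Real.pow_div_factorial_le_exp (δ * (1 + ‖v‖)) (by positivity) (r + 2)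
  rw [div_le_iff₀ (by positivity), mul_pow, mul_add, mul_one, Real.exp_add] at h
  have h1 : Real.exp (δ * ‖v‖) * Real.exp (-δ * ‖v‖) = 1 := by
    rw [← Real.exp_add]; simp
  have h2 : (1 + ‖v‖) ^ (r + 2) ≤ (r + 2).factorial / δ ^ (r + 2) * Real.exp δ *
      Real.exp (δ * ‖v‖) := by
    rw [div_mul_eq_mul_div, div_mul_eq_mul_div, le_div_iff₀ (by positivity)]
    linarith
  calc (1 + ‖v‖) * Real.exp (-δ * ‖v‖) * (1 + ‖v‖) ^ (r + 1)
      = (1 + ‖v‖) ^ (r + 2) * Real.exp (-δ * ‖v‖) := by ring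
    _ ≤ ((r + 2).factorial / δ ^ (r + 2) * Real.exp δ * Real.exp (δ * ‖v‖)) *
        Real.exp (-δ * ‖v‖) := by gcongr
    _ = _ := by rw [mul_assoc, h1, mul_one]

lemma exists_one_add_mul_exp_sq_le (r : ℕ) {δ : ℝ} (hδ : 0 < δ) : ∃ C : ℝ, 0 ≤ C ∧
    ∀ v : Fin r → ℝ, (1 + ‖v‖) * Real.exp (-δ * ‖v‖ ^ 2) ≤ C * decayWeight v := by
  obtain ⟨C, hC0, hC⟩ := exists_one_add_mul_exp_le r hδ
  refine ⟨Real.exp δ * C, by positivity, fun v => ?_⟩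
  have h1 : Real.exp (-δ * ‖v‖ ^ 2) ≤ Real.exp δ * Real.exp (-δ * ‖v‖) := by
    rw [← Real.exp_add]
    refine Real.exp_le_exp.2 ?_
    nlinarith [sq_nonneg (‖v‖ - 1), norm_nonneg v]
  calc (1 + ‖v‖) * Real.exp (-δ * ‖v‖ ^ 2)
      ≤ (1 + ‖v‖) * (Real.exp δ * Real.exp (-δ * ‖v‖)) := by gcongr
    _ = Real.exp δ * ((1 + ‖v‖) * Real.exp (-δ * ‖v‖)) := by ring
    _ ≤ Real.exp δ * (C * decayWeight v) := mul_le_mul_of_nonneg_left (hC v) (Real.exp_nonneg _)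
    _ = _ := by ring

lemma norm_gaussKer (c : Fin r → ℝ) (τ : ℂ) (v : Fin r → ℝ) :
    ‖gaussKer A c τ v‖ = Real.exp (-(Real.pi * τ.im) * (2 * Q A v + B A c v ^ 2)) := by
  rw [gaussKer, Complex.norm_exp]
  congr 1
  rw [← Complex.ofReal_pow]
  simp [-Complex.ofReal_pow]
  ring

lemma IsLorentzian.exists_gaussKer_le (hA : IsLorentzian A) {K : Set (Fin r → ℝ)}
    (hK : IsCompact K) (hKQ : ∀ c ∈ K, Q A c < -(1 / 2)) {τ : ℂ} (hτ : 0 < τ.im) :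
    ∃ C : ℝ, 0 ≤ C ∧ ∀ c ∈ K, ∀ v : Fin r → ℝ,
      (1 + ‖v‖) * ‖gaussKer A c τ v‖ ≤ C * decayWeight v := by
  obtain ⟨δ, hδ, h⟩ := hA.exists_majorant_ge hK hKQ
  obtain ⟨C, hC0, hC⟩ := exists_one_add_mul_exp_sq_le r (δ := Real.pi * τ.im * δ) (by positivity)
  refine ⟨C, hC0, fun c hc v => le_trans ?_ (hC v)⟩
  rw [norm_gaussKer]
  refine mul_le_mul_of_nonneg_left (Real.exp_le_exp.2 ?_) (by positivity)
  have := mul_le_mul_of_nonneg_left (h c hc v) (show 0 ≤ Real.pi * τ.im by positivity)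
  linarith

end Decay

/-! ### A Gaussian times a linear form. -/

section LinearFactor

variable {r : ℕ} {A : Matrix (Fin r) (Fin r) ℤ}

/-- As $w\perp c$, the factor with $B(c,v)^2$ is constant along $w$, and only $Q(v)\tau+B(v,b)$ is
differentiated. -/
lemma hasLineDerivAt_gaussKer_mul_latChar (hsymm : A.IsSymm) {c w : Fin r → ℝ}
    (hcw : B A c w = 0) (τ : ℂ) (b v : Fin r → ℝ) :
    HasLineDerivAt ℝ (fun v => gaussKer A c τ v * latChar A v b)
      ((2 * Real.pi * Complex.I * (τ * (B A w v : ℝ) + (B A w b : ℝ))) *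
        (gaussKer A c τ v * latChar A v b)) v w := by
  have h1 : ∀ t : ℝ, gaussKer A c τ (v + t • w) * latChar A (v + t • w) b =
      Complex.exp ((2 * Real.pi * Complex.I * (Q A v : ℝ) * τ - Real.pi * τ.im *
        (B A c v : ℝ) ^ 2 + 2 * Real.pi * Complex.I * (B A v b : ℝ)) +
        (t : ℂ) * (2 * Real.pi * Complex.I * (τ * (B A w v : ℝ) + (B A w b : ℝ))) +
        (t : ℂ) ^ 2 * (2 * Real.pi * Complex.I * (Q A w : ℝ) * τ)) := by
    intro t
    rw [gaussKer, latChar, ← Complex.exp_add]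
    congr 1
    rw [Q_add hsymm, Q_smul, B_smul_right, B_add_right, B_smul_right, hcw, B_add_left,
      B_smul_left, B_comm hsymm v w]
    push_cast
    ring
  unfold HasLineDerivAt
  simp_rw [h1]
  set α := (2 * Real.pi * Complex.I * (Q A v : ℝ) * τ - Real.pi * τ.im *
        (B A c v : ℝ) ^ 2 + 2 * Real.pi * Complex.I * (B A v b : ℝ))
  set β := 2 * Real.pi * Complex.I * (τ * (B A w v : ℝ) + (B A w b : ℝ))
  set γ := 2 * Real.pi * Complex.I * (Q A w : ℝ) * τ
  have h2 : HasDerivAt (fun t : ℝ => Complex.exp (α + (t : ℂ) * β + (t : ℂ) ^ 2 * γ))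
      (Complex.exp (α + ((0 : ℝ) : ℂ) * β + ((0 : ℝ) : ℂ) ^ 2 * γ) *
        (1 * β + (2 * ((0 : ℝ) : ℂ) ^ (2 - 1) * 1) * γ)) 0 := by
    have ht : HasDerivAt (fun t : ℝ => (t : ℂ)) 1 0 := by
      simpa using (hasDerivAt_id (0 : ℝ)).ofReal_comp
    have := (((ht.mul_const β).const_add α).add ((ht.pow 2).mul_const γ)).cexp
    simpa using this
  refine h2.congr_deriv ?_
  simp only [gaussKer, latChar, ← Complex.exp_add, Complex.ofReal_zero, zero_mul, add_zero,
    zero_pow, ne_eq,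
    OfNat.ofNat_ne_zero,
    not_false_eq_true, one_mul]
  simp [α, mul_comm]

lemma IsLorentzian.exists_linear_gaussKer_le (hA : IsLorentzian A) {c : Fin r → ℝ}
    (hc : Q A c = -1) (w : Fin r → ℝ) {τ : ℂ} (hτ : 0 < τ.im) (s t : ℂ) (b : Fin r → ℝ) :
    ∃ C : ℝ, ∀ v : Fin r → ℝ, ‖(s * (B A w v : ℝ) + t) * (gaussKer A c τ v * latChar A v b)‖ ≤
      C * decayWeight v := by
  obtain ⟨C, hC0, hC⟩ := hA.exists_gaussKer_le (isCompact_singleton (x := c))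
    (by rintro _ rfl; rw [hc]; norm_num) hτ
  obtain ⟨C₁, hC₁, hB⟩ := exists_abs_B_le A
  refine ⟨(‖s‖ * (C₁ * ‖w‖) + ‖t‖) * C, fun v => ?_⟩
  rw [norm_mul, norm_mul, norm_latChar, mul_one]
  have h1 : ‖s * (B A w v : ℝ) + t‖ ≤ (‖s‖ * (C₁ * ‖w‖) + ‖t‖) * (1 + ‖v‖) := by
    calc ‖s * (B A w v : ℝ) + t‖ ≤ ‖s‖ * (C₁ * ‖w‖ * ‖v‖) + ‖t‖ := by
          refine (norm_add_le _ _).trans ?_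
          rw [norm_mul, Complex.norm_real, Real.norm_eq_abs]
          gcongr
          exact hB w v
      _ ≤ _ := by
          have h3 : 0 ≤ ‖s‖ * (C₁ * ‖w‖) := by positivity
          nlinarith [norm_nonneg v, norm_nonneg t, mul_nonneg (norm_nonneg t) (norm_nonneg v)]
  calc ‖s * (B A w v : ℝ) + t‖ * ‖gaussKer A c τ v‖
      ≤ ((‖s‖ * (C₁ * ‖w‖) + ‖t‖) * (1 + ‖v‖)) * ‖gaussKer A c τ v‖ := by gcongr
    _ = (‖s‖ * (C₁ * ‖w‖) + ‖t‖) * ((1 + ‖v‖) * ‖gaussKer A c τ v‖) := by ring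
    _ ≤ (‖s‖ * (C₁ * ‖w‖) + ‖t‖) * (C * decayWeight v) :=
        mul_le_mul_of_nonneg_left (hC c rfl v) (by positivity)
    _ = _ := by ring

lemma IsLorentzian.integrable_linear_gaussKer (hA : IsLorentzian A) {c : Fin r → ℝ}
    (hc : Q A c = -1) (w : Fin r → ℝ) {τ : ℂ} (hτ : 0 < τ.im) (s t : ℂ) (b : Fin r → ℝ) :
    MeasureTheory.Integrable fun v : Fin r → ℝ =>
      (s * (B A w v : ℝ) + t) * (gaussKer A c τ v * latChar A v b) := by
  obtain ⟨C, hC⟩ := hA.exists_linear_gaussKer_le hc w hτ s t b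
  refine integrable_of_le_decayWeight ?_ hC
  have h1 : Continuous fun v : Fin r → ℝ => B A w v := continuous_B continuous_const continuous_id
  have h2 := continuous_gaussKer (A := A) c τ
  have h3 := continuous_latChar (A := A) b
  fun_prop

/-- The Fourier transform of `gaussKer` times a linear form that vanishes at `c`. -/
theorem IsLorentzian.integral_linear_gaussKer (hA : IsLorentzian A) {c w : Fin r → ℝ}
    (hc : Q A c = -1) (hcw : B A c w = 0) {τ : ℂ} (hτ : 0 < τ.im) (b : Fin r → ℝ) :
    ∫ v, (B A w v : ℝ) * (gaussKer A c τ v * latChar A v b) =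
      -(B A w b : ℝ) / τ * (gaussConst A τ * gaussKer A c (-1 / τ) b) := by
  have hτ0 : τ ≠ 0 := by rintro rfl; simp at hτ
  rw [← hA.integral_gaussKer hc hτ b]
  have hI := (hA.integrable_linear_gaussKer hc w hτ (2 * Real.pi * Complex.I * τ)
    (2 * Real.pi * Complex.I * (B A w b : ℝ)) b).congr (Eventually.of_forall fun v =>
      show _ = (2 * Real.pi * Complex.I * (τ * (B A w v : ℝ) + (B A w b : ℝ))) *
        (gaussKer A c τ v * latChar A v b) by ring)
  -- Integration by parts against the constant $1$: the integral of the derivative along $w$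
  -- vanishes, which relates the two wanted integrals.
  have h0 := integral_bilinear_hasLineDerivAt_right_eq_neg_left_of_integrable
    (μ := MeasureTheory.volume) (f := fun _ : Fin r → ℝ => (1 : ℂ)) (f' := fun _ => 0)
    (g := fun v => gaussKer A c τ v * latChar A v b) (v := w)
    (B := ContinuousLinearMap.mul ℝ ℂ) (by simp)
    (by simpa only [ContinuousLinearMap.mul_apply', one_mul] using hI)
    (by simpa using hA.integrable_linear_gaussKer hc w hτ 0 1 b)
    (fun v _ => by
      have := (hasFDerivAt_const (1 : ℂ) v).hasLineDerivAt (𝕜 := ℝ) w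
      simpa using this)
    (fun v _ => hasLineDerivAt_gaussKer_mul_latChar hA.symm hcw τ b v)
  simp only [ContinuousLinearMap.mul_apply', one_mul, zero_mul, MeasureTheory.integral_zero,
    neg_zero] at h0
  have h1 := hA.integrable_linear_gaussKer hc w hτ 1 0 b
  have h2 := hA.integrable_linear_gaussKer hc w hτ 0 1 b
  simp only [one_mul, zero_mul, zero_add, add_zero] at h1 h2
  have h3 : ∀ v, (2 * Real.pi * Complex.I * (τ * (B A w v : ℝ) + (B A w b : ℝ))) *
        (gaussKer A c τ v * latChar A v b) = (2 * Real.pi * Complex.I * τ) *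
        ((B A w v : ℝ) * (gaussKer A c τ v * latChar A v b)) +
        (2 * Real.pi * Complex.I * (B A w b : ℝ)) * (gaussKer A c τ v * latChar A v b) := by
    intro v; ring
  simp_rw [h3] at h0
  rw [MeasureTheory.integral_add (h1.const_mul _) (h2.const_mul _),
    MeasureTheory.integral_const_mul, MeasureTheory.integral_const_mul] at h0
  have hpi : (2 * Real.pi * Complex.I : ℂ) ≠ 0 := Complex.two_pi_I_ne_zero
  have h4 : (2 * Real.pi * Complex.I) * (τ * (∫ v, (B A w v : ℝ) *
      (gaussKer A c τ v * latChar A v b)) +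
      (B A w b : ℝ) * ∫ v, gaussKer A c τ v * latChar A v b) = 0 := by
    linear_combination h0
  have h5 := (mul_eq_zero.1 h4).resolve_left hpi
  rw [div_mul_eq_mul_div, eq_div_iff hτ0]
  linear_combination h5

end LinearFactor

/-! ### The function $E$. -/

section ErrorFunction

lemma hasDerivAt_E (x : ℝ) : HasDerivAt E (2 * Real.exp (-Real.pi * x ^ 2)) x := by
  have hc : Continuous fun u : ℝ => Real.exp (-Real.pi * u ^ 2) := by fun_prop
  exact ((hc.integral_hasStrictDerivAt 0 x).hasDerivAt).const_mul 2

lemma continuous_E : Continuous E :=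
  continuous_iff_continuousAt.2 fun x => (hasDerivAt_E x).continuousAt

lemma E_neg (x : ℝ) : E (-x) = -E x := by
  have h := intervalIntegral.integral_comp_neg (a := 0) (b := x)
    (fun u : ℝ => Real.exp (-Real.pi * u ^ 2))
  simp only [neg_sq, neg_zero] at h
  rw [E, E, h, intervalIntegral.integral_symm]
  ring

lemma tendsto_E_atTop : Tendsto E atTop (𝓝 1) := by
  have hi : MeasureTheory.IntegrableOn (fun u : ℝ => Real.exp (-Real.pi * u ^ 2)) (Set.Ioi 0) :=
    (integrable_exp_neg_mul_sq Real.pi_pos).integrableOn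
  have h := MeasureTheory.intervalIntegral_tendsto_integral_Ioi 0 hi tendsto_id
  rw [integral_gaussian_Ioi, div_self Real.pi_ne_zero, Real.sqrt_one] at h
  have h2 := h.const_mul 2
  rw [show (2 : ℝ) * (1 / 2) = 1 by norm_num] at h2
  exact h2

lemma tendsto_E_atBot : Tendsto E atBot (𝓝 (-1)) := by
  have h := (tendsto_E_atTop.comp tendsto_neg_atBot_atTop).neg
  refine h.congr fun x => ?_
  simp [E_neg]

end ErrorFunction

/-! ### Error-function kernels as integrals along a hyperbola. -/

/-- Isotropic vectors `k`, `k'` with `B(k, k') = -1`. -/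
structure IsHypPair {r : ℕ} (A : Matrix (Fin r) (Fin r) ℤ) (k k' : Fin r → ℝ) : Prop where
  left : Q A k = 0
  right : Q A k' = 0
  pair : B A k k' = -1

/-- The curve of vectors of norm `-1` in the plane of a hyperbolic pair. -/
noncomputable def hypPath {r : ℕ} (k k' : Fin r → ℝ) (u : ℝ) : Fin r → ℝ :=
  Real.exp u • k + Real.exp (-u) • k'

/-- The derivative of `hypPath`. -/
noncomputable def hypPathDeriv {r : ℕ} (k k' : Fin r → ℝ) (u : ℝ) : Fin r → ℝ :=
  Real.exp u • k - Real.exp (-u) • k'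

/-- The difference of error functions attached to two vectors of norm `-1`, times
`exp(2πi Q(v) τ)`. -/
noncomputable def errKer {r : ℕ} (A : Matrix (Fin r) (Fin r) ℤ) (c₁ c₂ : Fin r → ℝ) (τ : ℂ)
    (v : Fin r → ℝ) : ℂ :=
  ((E (B A c₁ v * √τ.im) - E (B A c₂ v * √τ.im) : ℝ) : ℂ) *
    Complex.exp (2 * Real.pi * Complex.I * (Q A v : ℝ) * τ)

section HypPath

variable {r : ℕ} {A : Matrix (Fin r) (Fin r) ℤ} {k k' : Fin r → ℝ}

lemma continuous_hypPath : Continuous (hypPath k k') := by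
  unfold hypPath; fun_prop

lemma continuous_hypPathDeriv : Continuous (hypPathDeriv k k') := by
  unfold hypPathDeriv; fun_prop

lemma IsHypPair.Q_hypPath (hk : IsHypPair A k k') (hsymm : A.IsSymm) (u : ℝ) :
    Q A (hypPath k k' u) = -1 := by
  rw [hypPath, Q_add hsymm, Q_smul, Q_smul, B_smul_left, B_smul_right, hk.left, hk.right, hk.pair,
    mul_zero, mul_zero, ← mul_assoc, ← Real.exp_add]
  simp

lemma IsHypPair.B_hypPath_deriv (hk : IsHypPair A k k') (hsymm : A.IsSymm) (u : ℝ) :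
    B A (hypPath k k' u) (hypPathDeriv k k' u) = 0 := by
  simp only [hypPath, hypPathDeriv, B_add_left, B_sub_right, B_smul_left, B_smul_right, B_self,
    hk.left, hk.right, hk.pair, B_comm hsymm k' k]
  ring

lemma hasDerivAt_E_hypPath (τ : ℂ) (v : Fin r → ℝ) (u : ℝ) :
    HasDerivAt (fun u => E (B A (hypPath k k' u) v * √τ.im))
      (2 * √τ.im * B A (hypPathDeriv k k' u) v *
        Real.exp (-Real.pi * (B A (hypPath k k' u) v * √τ.im) ^ 2)) u := by
  have h1 : HasDerivAt (fun u => B A (hypPath k k' u) v * √τ.im)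
      (B A (hypPathDeriv k k' u) v * √τ.im) u := by
    simp only [hypPath, hypPathDeriv, B_add_left, B_sub_left, B_smul_left]
    have h2 := (Real.hasDerivAt_exp u).mul_const (B A k v)
    have h3 := ((hasDerivAt_neg u).exp).mul_const (B A k' v)
    have h4 := (h2.add h3).mul_const (√τ.im)
    refine h4.congr_deriv ?_
    ring
  refine ((hasDerivAt_E _).comp u h1).congr_deriv ?_
  ring

lemma gaussKer_eq {τ : ℂ} (hτ : 0 < τ.im) (c v : Fin r → ℝ) :
    gaussKer A c τ v = (Real.exp (-Real.pi * (B A c v * √τ.im) ^ 2) : ℝ) *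
      Complex.exp (2 * Real.pi * Complex.I * (Q A v : ℝ) * τ) := by
  rw [gaussKer, Complex.ofReal_exp, ← Complex.exp_add, mul_pow, Real.sq_sqrt hτ.le]
  congr 1
  push_cast
  ring

/-- The fundamental theorem of calculus along the hyperbola: $E'$ contributes exactly the Gaussian
that turns $e^{2\pi iQ(v)\tau}$ into `gaussKer`. -/
lemma errKer_hypPath {τ : ℂ} (hτ : 0 < τ.im) (u₁ u₂ : ℝ) (v : Fin r → ℝ) :
    errKer A (hypPath k k' u₂) (hypPath k k' u₁) τ v =
      ∫ u in u₁..u₂, ((2 * √τ.im : ℝ) : ℂ) * ((B A (hypPathDeriv k k' u) v : ℝ) *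
        gaussKer A (hypPath k k' u) τ v) := by
  have hint : ∀ u, ((2 * √τ.im : ℝ) : ℂ) * ((B A (hypPathDeriv k k' u) v : ℝ) *
        gaussKer A (hypPath k k' u) τ v) =
      ((2 * √τ.im * B A (hypPathDeriv k k' u) v *
        Real.exp (-Real.pi * (B A (hypPath k k' u) v * √τ.im) ^ 2) : ℝ) : ℂ) *
        Complex.exp (2 * Real.pi * Complex.I * (Q A v : ℝ) * τ) := by
    intro u
    rw [gaussKer_eq hτ]
    push_cast
    ring
  simp_rw [hint]
  rw [intervalIntegral.integral_mul_const, intervalIntegral.integral_ofReal, errKer]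
  congr 2
  rw [intervalIntegral.integral_eq_sub_of_hasDerivAt
    (fun u _ => hasDerivAt_E_hypPath (A := A) (k := k) (k' := k') τ v u)]
  refine Continuous.intervalIntegrable ?_ _ _
  have h1 : Continuous fun u => B A (hypPathDeriv k k' u) v :=
    continuous_B continuous_hypPathDeriv continuous_const
  have h2 : Continuous fun u => B A (hypPath k k' u) v :=
    continuous_B continuous_hypPath continuous_const
  fun_prop

lemma continuous_gaussKer_hypPath (τ : ℂ) :
    Continuous fun p : ℝ × (Fin r → ℝ) => ((2 * √τ.im : ℝ) : ℂ) *
      ((B A (hypPathDeriv k k' p.1) p.2 : ℝ) * gaussKer A (hypPath k k' p.1) τ p.2) := by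
  unfold gaussKer
  have h1 : Continuous fun p : ℝ × (Fin r → ℝ) => B A (hypPathDeriv k k' p.1) p.2 :=
    continuous_B (continuous_hypPathDeriv.comp continuous_fst) continuous_snd
  have h2 : Continuous fun p : ℝ × (Fin r → ℝ) => B A (hypPath k k' p.1) p.2 :=
    continuous_B (continuous_hypPath.comp continuous_fst) continuous_snd
  have h3 : Continuous fun p : ℝ × (Fin r → ℝ) => Q A p.2 := continuous_Q continuous_snd
  fun_prop

/-- The arc is compact and consists of vectors of norm $-1$, so the majorants are uniformly positive
along it. The bound serves both the decay of `errKer` and Fubini. -/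
lemma IsHypPair.exists_integrand_le (hk : IsHypPair A k k') (hA : IsLorentzian A) {τ : ℂ}
    (hτ : 0 < τ.im) (u₁ u₂ : ℝ) : ∃ C : ℝ, 0 ≤ C ∧ ∀ u ∈ Set.uIcc u₁ u₂, ∀ v : Fin r → ℝ,
      ‖((2 * √τ.im : ℝ) : ℂ) * ((B A (hypPathDeriv k k' u) v : ℝ) *
        gaussKer A (hypPath k k' u) τ v)‖ ≤ C * decayWeight v := by
  obtain ⟨C, hC0, hC⟩ := hA.exists_gaussKer_le (isCompact_uIcc.image continuous_hypPath)
    (K := hypPath k k' '' Set.uIcc u₁ u₂)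
    (by rintro _ ⟨u, -, rfl⟩; rw [hk.Q_hypPath hA.symm]; norm_num) hτ
  obtain ⟨C₁, hC₁, hB⟩ := exists_abs_B_le A
  obtain ⟨D, hD⟩ := (isCompact_uIcc (a := u₁) (b := u₂)).exists_bound_of_continuousOn
    (continuous_hypPathDeriv (k := k) (k' := k')).continuousOn
  have hD0 : 0 ≤ D := (norm_nonneg _).trans (hD u₁ Set.left_mem_uIcc)
  refine ⟨2 * √τ.im * (C₁ * D) * C, by positivity, fun u hu v => ?_⟩
  rw [norm_mul, norm_mul, Complex.norm_real, Complex.norm_real, Real.norm_of_nonneg (by positivity),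
    Real.norm_eq_abs]
  calc 2 * √τ.im * (|B A (hypPathDeriv k k' u) v| * ‖gaussKer A (hypPath k k' u) τ v‖)
      ≤ 2 * √τ.im * ((C₁ * D * (1 + ‖v‖)) * ‖gaussKer A (hypPath k k' u) τ v‖) := by
        gcongr
        refine (hB _ _).trans ?_
        have := hD u hu
        gcongr
        linarith [norm_nonneg v]
    _ = 2 * √τ.im * (C₁ * D) * ((1 + ‖v‖) * ‖gaussKer A (hypPath k k' u) τ v‖) := by ring
    _ ≤ 2 * √τ.im * (C₁ * D) * (C * decayWeight v) :=
        mul_le_mul_of_nonneg_left (hC _ ⟨u, hu, rfl⟩ v) (by positivity)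
    _ = _ := by ring

lemma IsHypPair.exists_errKer_le (hk : IsHypPair A k k') (hA : IsLorentzian A) {τ : ℂ}
    (hτ : 0 < τ.im) (u₁ u₂ : ℝ) : ∃ C : ℝ, ∀ v : Fin r → ℝ,
      ‖errKer A (hypPath k k' u₂) (hypPath k k' u₁) τ v‖ ≤ C * decayWeight v := by
  obtain ⟨C, hC0, hC⟩ := hk.exists_integrand_le hA hτ u₁ u₂
  refine ⟨C * |u₂ - u₁|, fun v => ?_⟩
  rw [errKer_hypPath hτ]
  refine (intervalIntegral.norm_integral_le_of_norm_le_const fun u hu =>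
    hC u (Set.uIoc_subset_uIcc hu) v).trans_eq ?_
  ring

/-- The constant in the Fourier transform of `errKer`. -/
noncomputable def errConst (A : Matrix (Fin r) (Fin r) ℤ) (τ : ℂ) : ℂ :=
  Complex.I * (((-Complex.I * τ) ^ (1 / 2 : ℂ)) ^ r)⁻¹ * ((√(-(A.det : ℝ)))⁻¹ : ℝ)

/-- The Fourier transform of `errKer`. -/
theorem IsHypPair.integral_errKer (hk : IsHypPair A k k') (hA : IsLorentzian A) {τ : ℂ}
    (hτ : 0 < τ.im) {u₁ u₂ : ℝ} (hu : u₁ ≤ u₂) (b : Fin r → ℝ) :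
    ∫ v, errKer A (hypPath k k' u₂) (hypPath k k' u₁) τ v * latChar A v b =
      errConst A τ * errKer A (hypPath k k' u₂) (hypPath k k' u₁) (-1 / τ) b := by
  have hτ0 : τ ≠ 0 := by rintro rfl; simp at hτ
  have hn0 : (‖τ‖ : ℂ) ≠ 0 := by simpa using hτ0
  rw [errKer_hypPath (neg_one_div_im_pos hτ), ← intervalIntegral.integral_const_mul]
  simp_rw [errKer_hypPath hτ, intervalIntegral.integral_of_le hu,
    ← MeasureTheory.integral_mul_const]
  rw [MeasureTheory.integral_integral_swap]
  · refine MeasureTheory.integral_congr_ae (Eventually.of_forall fun u => ?_)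
    simp only
    -- The factor $-i\tau/|\tau|$ in `gaussConst` times the $-1/\tau$ of the linear form is
    -- $i/|\tau|$, and $\sqrt y/|\tau|$ is the normalization of the kernel at $-1/\tau$. The
    -- constant is therefore independent of $u$.
    have hs : √((-1 / τ).im) = √τ.im / ‖τ‖ := by
      rw [neg_one_div_im, Real.sqrt_div' _ (by positivity), Real.sqrt_sq (norm_nonneg _)]
    simp_rw [mul_assoc]
    rw [MeasureTheory.integral_const_mul, hA.integral_linear_gaussKer (hk.Q_hypPath hA.symm u)
      (hk.B_hypPath_deriv hA.symm u) hτ, hs, gaussConst, errConst]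
    push_cast
    field_simp
  · obtain ⟨C, hC0, hC⟩ := hk.exists_integrand_le hA hτ u₁ u₂
    have hfin : MeasureTheory.Integrable (fun _ : ℝ => (1 : ℝ))
        (MeasureTheory.volume.restrict (Set.Ioc u₁ u₂)) := MeasureTheory.integrable_const _
    have hbound := ((integrable_decayWeight (r := r)).const_mul C).mul_prod hfin
    have hcont : Continuous (Function.uncurry fun (v : Fin r → ℝ) (u : ℝ) =>
        ((2 * √τ.im : ℝ) : ℂ) * ((B A (hypPathDeriv k k' u) v : ℝ) *
        gaussKer A (hypPath k k' u) τ v) * latChar A v b) := by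
      have h1 := (continuous_gaussKer_hypPath (A := A) (k := k) (k' := k') τ).comp
        (continuous_swap (X := Fin r → ℝ) (Y := ℝ))
      exact h1.mul ((continuous_latChar b).comp continuous_fst)
    refine hbound.mono' hcont.aestronglyMeasurable ?_
    have hae : ∀ᵐ p : (Fin r → ℝ) × ℝ ∂(MeasureTheory.volume.prod
        (MeasureTheory.volume.restrict (Set.Ioc u₁ u₂))), p.2 ∈ Set.Ioc u₁ u₂ :=
      MeasureTheory.Measure.quasiMeasurePreserving_snd.ae
        (MeasureTheory.ae_restrict_mem measurableSet_Ioc)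
    filter_upwards [hae] with p hp
    rw [Function.uncurry_apply_pair (f := _) p.1 p.2, norm_mul, norm_latChar, mul_one, mul_one]
    exact hC p.2 (by rw [Set.uIcc_of_le hu]; exact Set.Ioc_subset_Icc_self hp) p.1

end HypPath

/-! ### Kernels of two vectors of norm $-1$, and their lattice sums. -/

section ErrKer

variable {r : ℕ} {A : Matrix (Fin r) (Fin r) ℤ}

/-- Put $T=-B(c_1,c_2)/2=\cosh u$, which exceeds $1$ by the reversed Cauchy–Schwarz inequality and
$c_1\neq c_2$. With $s=e^u=T+\sqrt{T^2-1}$, solve $k+k'=c_1$ and $sk+s^{-1}k'=c_2$ for $k$ and $k'$.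
-/
lemma IsLorentzian.exists_hypPair (hA : IsLorentzian A) {c₁ c₂ : Fin r → ℝ} (h₁ : Q A c₁ = -1)
    (h₂ : Q A c₂ = -1) (h₁₂ : B A c₁ c₂ < 0) (hne : c₁ ≠ c₂) :
    ∃ k k' : Fin r → ℝ, ∃ u : ℝ, 0 ≤ u ∧ IsHypPair A k k' ∧ hypPath k k' 0 = c₁ ∧
      hypPath k k' u = c₂ := by
  set T := -B A c₁ c₂ / 2 with hT
  have hB : B A c₁ c₂ = -2 * T := by rw [hT]; ring
  have hT1 : 1 < T := by
    have hT0 : 0 < T := by rw [hT]; linarith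
    have h := hA.four_mul_le (c := c₁) (by linarith) c₂
    rw [h₁, h₂, hB] at h
    have h1 : 1 ≤ T := by nlinarith
    refine lt_of_le_of_ne h1 fun hTe => ?_
    have h3 : B A c₁ (c₁ - c₂) = 0 := by rw [B_sub_right, B_self, h₁, hB, ← hTe]; norm_num
    have h4 := hA.pos_of_orthogonal c₁ (c₁ - c₂) (by linarith) h3 (sub_ne_zero.2 hne)
    rw [Q_sub hA.symm, h₁, h₂, hB, ← hTe] at h4
    norm_num at h4
  set s := T + √(T ^ 2 - 1) with hs
  have hsq : √(T ^ 2 - 1) ^ 2 = T ^ 2 - 1 := Real.sq_sqrt (by nlinarith)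
  have hs1 : 1 < s := lt_add_of_lt_of_nonneg hT1 (Real.sqrt_nonneg _)
  have hs0 : s ≠ 0 := by linarith
  have hinv : s⁻¹ = T - √(T ^ 2 - 1) := by
    refine inv_eq_of_mul_eq_one_right ?_
    rw [hs]; linear_combination -hsq
  have hTs : 2 * T = s + s⁻¹ := by rw [hinv, hs]; ring
  have hinv1 : s⁻¹ < 1 := inv_lt_one_of_one_lt₀ hs1
  have hd : s - s⁻¹ ≠ 0 := by linarith
  have hss : s * s⁻¹ = 1 := mul_inv_cancel₀ hs0
  refine ⟨(s - s⁻¹)⁻¹ • (c₂ - s⁻¹ • c₁), (s - s⁻¹)⁻¹ • (s • c₁ - c₂), Real.log s,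
    Real.log_nonneg hs1.le, ⟨?_, ?_, ?_⟩, ?_, ?_⟩
  · rw [Q_smul, Q_sub hA.symm, Q_smul, B_smul_right, B_comm hA.symm c₂ c₁, h₁, h₂, hB]
    linear_combination (s - s⁻¹)⁻¹ ^ 2 * (s⁻¹ * hTs + hss)
  · rw [Q_smul, Q_sub hA.symm, Q_smul, B_smul_left, h₁, h₂, hB]
    linear_combination (s - s⁻¹)⁻¹ ^ 2 * (s * hTs + hss)
  · rw [B_smul_left, B_smul_right, B_sub_left, B_sub_right, B_smul_left, B_sub_right, B_smul_right,
      B_smul_right, B_self, B_self, B_comm hA.symm c₂ c₁, h₁, h₂, hB]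
    have : (s - s⁻¹)⁻¹ * (s - s⁻¹) = 1 := inv_mul_cancel₀ hd
    linear_combination (-(s - s⁻¹)⁻¹ ^ 2) * ((s + s⁻¹) * hTs) +
      (-((s - s⁻¹)⁻¹ * (s - s⁻¹) + 1)) * this + (s - s⁻¹)⁻¹ ^ 2 * (-2) * hss
  · have h5 : ((s - s⁻¹)⁻¹ * (s - s⁻¹)) = 1 := inv_mul_cancel₀ hd
    simp only [hypPath, neg_zero, Real.exp_zero, one_smul]
    ext i
    simp only [Pi.add_apply, Pi.smul_apply, Pi.sub_apply, smul_eq_mul]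
    linear_combination c₁ i * h5
  · have h5 : ((s - s⁻¹)⁻¹ * (s - s⁻¹)) = 1 := inv_mul_cancel₀ hd
    simp only [hypPath, Real.exp_neg, Real.exp_log (by linarith : 0 < s)]
    ext i
    simp only [Pi.add_apply, Pi.smul_apply, Pi.sub_apply, smul_eq_mul]
    linear_combination c₂ i * h5

lemma errKer_swap (c₁ c₂ : Fin r → ℝ) (τ : ℂ) (v : Fin r → ℝ) :
    errKer A c₁ c₂ τ v = -errKer A c₂ c₁ τ v := by
  simp only [errKer]; push_cast; ring

lemma errKer_self (c : Fin r → ℝ) (τ : ℂ) (v : Fin r → ℝ) : errKer A c c τ v = 0 := by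
  simp [errKer]

lemma continuous_errKer (c₁ c₂ : Fin r → ℝ) (τ : ℂ) : Continuous (errKer A c₁ c₂ τ) := by
  unfold errKer
  have h1 : Continuous fun v : Fin r → ℝ => B A c₁ v := continuous_B continuous_const continuous_id
  have h2 : Continuous fun v : Fin r → ℝ => B A c₂ v := continuous_B continuous_const continuous_id
  have h3 : Continuous fun v : Fin r → ℝ => Q A v := continuous_Q continuous_id
  have h4 := continuous_E
  fun_prop

lemma IsLorentzian.exists_errKer_le (hA : IsLorentzian A) {c₁ c₂ : Fin r → ℝ} (h₁ : Q A c₁ = -1)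
    (h₂ : Q A c₂ = -1) (h₁₂ : B A c₁ c₂ < 0) {τ : ℂ} (hτ : 0 < τ.im) :
    ∃ C : ℝ, ∀ v : Fin r → ℝ, ‖errKer A c₁ c₂ τ v‖ ≤ C * decayWeight v := by
  by_cases hne : c₁ = c₂
  · exact ⟨0, fun v => by simp [hne, errKer_self]⟩
  obtain ⟨k, k', u, -, hk, rfl, rfl⟩ := hA.exists_hypPair h₁ h₂ h₁₂ hne
  exact hk.exists_errKer_le hA hτ u 0

theorem IsLorentzian.integral_errKer (hA : IsLorentzian A) {c₁ c₂ : Fin r → ℝ} (h₁ : Q A c₁ = -1)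
    (h₂ : Q A c₂ = -1) (h₁₂ : B A c₁ c₂ < 0) {τ : ℂ} (hτ : 0 < τ.im) (b : Fin r → ℝ) :
    ∫ v, errKer A c₁ c₂ τ v * latChar A v b = errConst A τ * errKer A c₁ c₂ (-1 / τ) b := by
  by_cases hne : c₁ = c₂
  · simp [hne, errKer_self]
  obtain ⟨k, k', u, hu, hk, rfl, rfl⟩ := hA.exists_hypPair h₁ h₂ h₁₂ hne
  simp_rw [errKer_swap (hypPath k k' 0), neg_mul]
  rw [MeasureTheory.integral_neg, hk.integral_errKer hA hτ hu]
  ring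

/-- The vector `A⁻¹ m`. -/
noncomputable def dualVec (A : Matrix (Fin r) (Fin r) ℤ) (m : Fin r → ℤ) : Fin r → ℝ :=
  (A.map (Int.cast : ℤ → ℝ))⁻¹ *ᵥ intVec m

lemma isUnit_det_map (hdet : A.det ≠ 0) : IsUnit (A.map (Int.cast : ℤ → ℝ)).det :=
  isUnit_iff_ne_zero.2 (det_map_ne_zero hdet)

lemma B_dualVec_right (hdet : A.det ≠ 0) (x : Fin r → ℝ) (m : Fin r → ℤ) :
    B A x (dualVec A m) = x ⬝ᵥ intVec m := by
  rw [B, dualVec, mulVec_mulVec, mul_nonsing_inv _ (isUnit_det_map hdet), one_mulVec]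

/-- Applying $A$, which is bounded, moves the points to a translate of $\mathbb Z^r$. The constant
`L` is at least $1$, so that $1+\|Ax\|\le L(1+\|x\|)$. -/
lemma summable_decayWeight_dualVec_add (hdet : A.det ≠ 0) (a : Fin r → ℝ) :
    Summable fun m : Fin r → ℤ => decayWeight (dualVec A m + a) := by
  set A' := A.map (Int.cast : ℤ → ℝ)
  obtain ⟨K, hK⟩ : ∃ K : ℝ, ∀ x : Fin r → ℝ, ‖A' *ᵥ x‖ ≤ K * ‖x‖ :=
    ⟨‖(toLin' A').toContinuousLinearMap‖, fun x => (toLin' A').toContinuousLinearMap.le_opNorm x⟩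
  set L := max K 1 with hL
  have hL1 : 1 ≤ L := le_max_right _ _
  refine Summable.of_nonneg_of_le (fun _ => (decayWeight_pos _).le) (fun m => ?_)
    ((summable_decayWeight_add (A' *ᵥ a)).mul_left (L ^ (r + 1)))
  have h1 : intVec m + A' *ᵥ a = A' *ᵥ (dualVec A m + a) := by
    rw [mulVec_add, dualVec, mulVec_mulVec, mul_nonsing_inv _ (isUnit_det_map hdet), one_mulVec]
  unfold decayWeight
  rw [← div_eq_mul_inv, inv_eq_one_div, div_le_div_iff₀ (by positivity) (by positivity), one_mul,
    ← mul_pow]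
  gcongr
  rw [h1]
  have h2 := hK (dualVec A m + a)
  have h3 : K ≤ L := le_max_left _ _
  nlinarith [norm_nonneg (dualVec A m + a)]

lemma latChar_add_left (x y b : Fin r → ℝ) :
    latChar A (x + y) b = latChar A x b * latChar A y b := by
  simp only [latChar, ← Complex.exp_add, B_add_left]
  congr 1; push_cast; ring

lemma latChar_add_right (x a b : Fin r → ℝ) :
    latChar A x (a + b) = latChar A x a * latChar A x b := by
  simp only [latChar, ← Complex.exp_add, B_add_right]
  congr 1; push_cast; ring

lemma latChar_comm (hsymm : A.IsSymm) (x y : Fin r → ℝ) : latChar A x y = latChar A y x := by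
  rw [latChar, latChar, B_comm hsymm]

/-- Since $B(x,A^{-1}m)=\langle x,m\rangle$, the frequencies of Poisson summation become the points
of $A^{-1}\mathbb Z^r$. -/
lemma exp_sum_eq_latChar (hdet : A.det ≠ 0) (m : Fin r → ℤ) (x : Fin r → ℝ) :
    Complex.exp (2 * Real.pi * Complex.I * ∑ i, (m i : ℂ) * (x i : ℂ)) =
      latChar A x (dualVec A m) := by
  rw [latChar, B_dualVec_right hdet]
  congr 2
  simp [dotProduct, intVec, mul_comm]

/-- The inversion formula for lattice sums of `errKer`. -/
theorem IsLorentzian.tsum_errKer (hA : IsLorentzian A) {c₁ c₂ : Fin r → ℝ} (h₁ : Q A c₁ = -1)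
    (h₂ : Q A c₂ = -1) (h₁₂ : B A c₁ c₂ < 0) {τ : ℂ} (hτ : 0 < τ.im) (a b : Fin r → ℝ) :
    ∑' n : Fin r → ℤ, errKer A c₁ c₂ (-1 / τ) (intVec n - b) * latChar A (intVec n) a =
      errConst A (-1 / τ) * ∑' m : Fin r → ℤ,
        errKer A c₁ c₂ τ (dualVec A m + a) * latChar A (dualVec A m + a) b := by
  have hτ0 : τ ≠ 0 := by rintro rfl; simp at hτ
  have hτ' := neg_one_div_im_pos hτ
  set φ : (Fin r → ℝ) → ℂ := fun x => errKer A c₁ c₂ (-1 / τ) (x - b) * latChar A x a with hφ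
  have hφc : Continuous φ :=
    ((continuous_errKer c₁ c₂ (-1 / τ)).comp (continuous_id.sub continuous_const)).mul
      (continuous_latChar a)
  obtain ⟨C, hC⟩ := hA.exists_errKer_le h₁ h₂ h₁₂ hτ'
  obtain ⟨C', hC'⟩ := hA.exists_errKer_le h₁ h₂ h₁₂ hτ
  have hC0 : 0 ≤ C := nonneg_of_mul_nonneg_left ((norm_nonneg _).trans (hC 0)) (decayWeight_pos _)
  have hφC : ∀ x, ‖φ x‖ ≤ (C * (1 + ‖-b‖) ^ (r + 1)) * decayWeight x := by
    intro x
    rw [hφ]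
    simp only
    rw [norm_mul, norm_latChar, mul_one, mul_assoc]
    refine (hC _).trans ?_
    rw [sub_eq_add_neg]
    gcongr
    exact decayWeight_add_le _ _
  have hint : ∀ m : Fin r → ℤ, ∫ x : Fin r → ℝ,
      Complex.exp (2 * Real.pi * Complex.I * ∑ i, (m i : ℂ) * (x i : ℂ)) * φ x =
      errConst A (-1 / τ) * (errKer A c₁ c₂ τ (dualVec A m + a) *
        latChar A (dualVec A m + a) b) := by
    intro m
    have h3 : -1 / (-1 / τ) = τ := by field_simp
    -- Shifting by $b$ centres the kernel and releases the character $e^{2\pi iB(A^{-1}m+a,b)}$.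
    rw [← MeasureTheory.integral_add_right_eq_self _ b]
    have h4 : ∀ x, Complex.exp (2 * Real.pi * Complex.I * ∑ i, (m i : ℂ) * ((x + b) i : ℝ)) *
        φ (x + b) = errKer A c₁ c₂ (-1 / τ) x * latChar A x (dualVec A m + a) *
          latChar A (dualVec A m + a) b := by
      intro x
      rw [exp_sum_eq_latChar hA.det_ne_zero, hφ]
      simp only [add_sub_cancel_right]
      rw [latChar_comm hA.symm (dualVec A m + a) b, latChar_add_left, latChar_add_left,
        latChar_add_right, latChar_add_right]
      ring
    simp_rw [h4]
    rw [MeasureTheory.integral_mul_const, hA.integral_errKer h₁ h₂ h₁₂ hτ', h3, mul_assoc]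
  have h := tsum_intVec_eq_tsum_fourier hφc hφC (by
    simp_rw [hint]
    refine Summable.mul_left _ (Summable.of_norm ?_)
    refine Summable.of_nonneg_of_le (fun _ => norm_nonneg _) (fun m => ?_)
      ((summable_decayWeight_dualVec_add hA.det_ne_zero a).mul_left C')
    rw [norm_mul, norm_latChar, mul_one]
    exact hC' _)
  simp_rw [hint] at h
  rw [tsum_mul_left] at h
  exact h

end ErrKer

/-! ### Bounds uniform up to a cusp, and over a convex compact set. -/

section CuspBound

variable {r : ℕ} {A : Matrix (Fin r) (Fin r) ℤ} {k k' : Fin r → ℝ}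

lemma norm_errKer (c₁ c₂ : Fin r → ℝ) (τ : ℂ) (v : Fin r → ℝ) :
    ‖errKer A c₁ c₂ τ v‖ = |E (B A c₁ v * √τ.im) - E (B A c₂ v * √τ.im)| *
      Real.exp (-(2 * Real.pi * τ.im) * Q A v) := by
  rw [errKer, norm_mul, Complex.norm_real, Real.norm_eq_abs, Complex.norm_exp]
  congr 2
  simp
  ring

/-- The quantity is $Q$ of $v+B(k',v)k+B(k,v)k'$, the projection of $v$ to the orthogonal complement
of the plane of $k,k'$. -/
lemma IsHypPair.orthogonal_part_nonneg (hk : IsHypPair A k k') (hA : IsLorentzian A)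
    (v : Fin r → ℝ) : 0 ≤ Q A v + B A k v * B A k' v := by
  have h1 : B A (hypPath k k' 0) (v + (B A k' v • k + B A k v • k')) = 0 := by
    simp only [hypPath, neg_zero, Real.exp_zero, one_smul, B_add_left, B_add_right, B_smul_right,
      B_self, hk.left, hk.right, hk.pair, B_comm hA.symm k' k]
    ring
  have h2 := hA.nonneg_of_orthogonal (by rw [hk.Q_hypPath hA.symm]; norm_num) h1
  rw [Q_add hA.symm, Q_add hA.symm, Q_smul, Q_smul, B_add_right, B_smul_right, B_smul_right,
    B_smul_left, B_smul_right, hk.left, hk.right, hk.pair, B_comm hA.symm v k,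
    B_comm hA.symm v k'] at h2
  linarith

lemma majorant_hypPath (v : Fin r → ℝ) (u : ℝ) :
    2 * Q A v + B A (hypPath k k' u) v ^ 2 = 2 * (Q A v + B A k v * B A k' v) +
      (Real.exp u ^ 2 * B A k v ^ 2 + Real.exp (-u) ^ 2 * B A k' v ^ 2) := by
  have h : Real.exp u * Real.exp (-u) = 1 := by rw [← Real.exp_add]; simp
  simp only [hypPath, B_add_left, B_smul_left]
  linear_combination 2 * B A k v * B A k' v * h

/-- Near a cusp the tangent vector grows like $e^u$, against a gain of $e^{-\gamma e^{2u}}$; what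
remains is integrable on $[0,\infty)$. -/
lemma exp_mul_exp_neg_mul_exp_sq_le {γ : ℝ} (hγ : 0 < γ) (u : ℝ) :
    Real.exp u * Real.exp (-γ * Real.exp u ^ 2) ≤ γ⁻¹ * Real.exp (-u) := by
  have h1 : γ * Real.exp u ^ 2 ≤ Real.exp (γ * Real.exp u ^ 2) :=
    (by linarith : γ * Real.exp u ^ 2 ≤ γ * Real.exp u ^ 2 + 1).trans (Real.add_one_le_exp _)
  rw [neg_mul, Real.exp_neg, Real.exp_neg, ← div_eq_mul_inv, ← mul_inv,
    div_le_iff₀ (Real.exp_pos _), inv_mul_eq_div, le_div_iff₀ (by positivity)]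
  nlinarith [Real.exp_pos u]

/-- Let $p=B(k,v)$, $p'=B(k',v)$. The coefficient $e^{-2u}$ of $p'^2$ excludes a quadratic bound
uniform in $u$. However, $X=e^{2u}p^2+e^{-2u}p'^2\ge2|pp'|\ge2\varepsilon|p'|$, which is enough for
a bound linear in $\|v\|$. A third of $X$ is spent on $|p'|$, a third on $p^2$ and a third on
$\varepsilon^2e^{2u}$, which explains the constants. -/
lemma IsHypPair.exists_majorant_ge (hk : IsHypPair A k k') (hA : IsLorentzian A) {ε : ℝ}
    (hε : 0 < ε) : ∃ δ > 0, ∃ M : ℝ, ∀ u : ℝ, 0 ≤ u → ∀ v : Fin r → ℝ, ε ≤ |B A k v| →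
      δ * ‖v‖ - M + ε ^ 2 / 3 * Real.exp u ^ 2 ≤ 2 * Q A v + B A (hypPath k k' u) v ^ 2 := by
  obtain ⟨δ, hδ, h⟩ := hA.exists_majorant_ge (isCompact_singleton (x := hypPath k k' 0))
    (by rintro _ rfl; rw [hk.Q_hypPath hA.symm]; norm_num)
  set m := min (1 / 3 : ℝ) (2 * ε / 3) with hm
  have hm0 : 0 < m := lt_min (by norm_num) (by positivity)
  have hm1 : m ≤ 1 / 3 := min_le_left _ _
  have hm2 : m ≤ 2 * ε / 3 := min_le_right _ _
  refine ⟨m * √δ, by positivity, 2 * m, fun u hu v hv => ?_⟩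
  have h0 := h _ rfl v
  rw [majorant_hypPath] at h0 ⊢
  simp only [Real.exp_zero, neg_zero, one_pow, one_mul] at h0
  have hq := hk.orthogonal_part_nonneg hA v
  set q := Q A v + B A k v * B A k' v
  set p := B A k v
  set p' := B A k' v
  have hs : √δ ^ 2 = δ := Real.sq_sqrt hδ.le
  have hnorm : √δ * ‖v‖ ≤ (2 * q + 1) + (p ^ 2 + 1) + |p'| := by
    refine abs_le_of_sq_le_sq' ?_ (by positivity) |>.2
    have e1 : (√δ * ‖v‖) ^ 2 = δ * ‖v‖ ^ 2 := by rw [mul_pow, hs]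
    rw [e1]
    nlinarith [sq_abs p', abs_nonneg p', sq_nonneg p, mul_nonneg hq (sq_nonneg p),
      mul_nonneg hq (abs_nonneg p'), mul_nonneg (sq_nonneg p) (abs_nonneg p'), sq_nonneg q,
      sq_nonneg (p ^ 2)]
  have hexp : Real.exp u * Real.exp (-u) = 1 := by rw [← Real.exp_add]; simp
  have hu1 : 1 ≤ Real.exp u ^ 2 := one_le_pow₀ (Real.one_le_exp hu)
  have hp2 : ε ^ 2 ≤ p ^ 2 := by rw [← sq_abs p]; gcongr
  have hX1 : 2 * ε * |p'| ≤ Real.exp u ^ 2 * p ^ 2 + Real.exp (-u) ^ 2 * p' ^ 2 := by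
    have h3 : 0 ≤ (Real.exp u * |p| - Real.exp (-u) * |p'|) ^ 2 := sq_nonneg _
    have h4 : (Real.exp u * |p| - Real.exp (-u) * |p'|) ^ 2 = Real.exp u ^ 2 * p ^ 2 +
        Real.exp (-u) ^ 2 * p' ^ 2 - 2 * |p| * |p'| := by
      rw [← sq_abs p, ← sq_abs p']
      linear_combination (-2 * |p| * |p'|) * hexp
    have h5 := mul_le_mul_of_nonneg_right hv (abs_nonneg p')
    linarith
  have hX2 : p ^ 2 ≤ Real.exp u ^ 2 * p ^ 2 + Real.exp (-u) ^ 2 * p' ^ 2 := by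
    have := mul_le_mul_of_nonneg_right hu1 (sq_nonneg p)
    have h6 : 0 ≤ Real.exp (-u) ^ 2 * p' ^ 2 := by positivity
    linarith
  have hX3 : ε ^ 2 * Real.exp u ^ 2 ≤
      Real.exp u ^ 2 * p ^ 2 + Real.exp (-u) ^ 2 * p' ^ 2 := by
    have := mul_le_mul_of_nonneg_right hp2 (sq_nonneg (Real.exp u))
    have h6 : 0 ≤ Real.exp (-u) ^ 2 * p' ^ 2 := by positivity
    linarith
  have h7 : m * (√δ * ‖v‖) ≤ m * ((2 * q + 1) + (p ^ 2 + 1) + |p'|) := by gcongr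
  have h8 : m * (2 * q) ≤ 2 * q := by nlinarith
  have h9 : m * p ^ 2 ≤ 1 / 3 * p ^ 2 := by gcongr
  have h10 : m * |p'| ≤ 2 * ε / 3 * |p'| := by gcongr
  linarith

/-- The integrand along the hyperbola is at most a constant times the weight times $e^{-t}$, so
integrating over $[0,u]$ costs a factor at most $1$, whatever $u$ is. -/
lemma IsHypPair.exists_errKer_cusp_le (hk : IsHypPair A k k') (hA : IsLorentzian A) {τ : ℂ}
    (hτ : 0 < τ.im) {ε : ℝ} (hε : 0 < ε) : ∃ C : ℝ, ∀ u : ℝ, 0 ≤ u → ∀ v : Fin r → ℝ,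
      ε ≤ |B A k v| → ‖errKer A (hypPath k k' u) (hypPath k k' 0) τ v‖ ≤ C * decayWeight v := by
  obtain ⟨δ, hδ, M, hM⟩ := hk.exists_majorant_ge hA hε
  set y := Real.pi * τ.im with hy
  have hy0 : 0 < y := by positivity
  obtain ⟨C, hC0, hC⟩ := exists_one_add_mul_exp_le r (δ := y * δ) (by positivity)
  obtain ⟨C₁, hC₁, hB⟩ := exists_abs_B_le A
  set γ := y * (ε ^ 2 / 3) with hγ
  have hγ0 : 0 < γ := by positivity
  set D := 2 * √τ.im * (C₁ * (‖k‖ + ‖k'‖)) * γ⁻¹ * Real.exp (y * M) * C with hD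
  have hD0 : 0 ≤ D := by positivity
  refine ⟨D, fun u hu v hv => ?_⟩
  have hbound : ∀ t, 0 ≤ t → ‖((2 * √τ.im : ℝ) : ℂ) * ((B A (hypPathDeriv k k' t) v : ℝ) *
      gaussKer A (hypPath k k' t) τ v)‖ ≤ D * decayWeight v * Real.exp (-t) := by
    intro t ht
    rw [norm_mul, norm_mul, Complex.norm_real, Complex.norm_real,
      Real.norm_of_nonneg (by positivity), Real.norm_eq_abs, norm_gaussKer]
    have h1 : |B A (hypPathDeriv k k' t) v| ≤
        Real.exp t * (C₁ * (‖k‖ + ‖k'‖) * (1 + ‖v‖)) := by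
      have hle : Real.exp (-t) ≤ Real.exp t := Real.exp_le_exp.2 (by linarith)
      calc |B A (hypPathDeriv k k' t) v| = |Real.exp t * B A k v - Real.exp (-t) * B A k' v| := by
            rw [hypPathDeriv, B_sub_left, B_smul_left, B_smul_left]
        _ ≤ Real.exp t * |B A k v| + Real.exp (-t) * |B A k' v| := by
            refine (abs_sub _ _).trans_eq ?_
            rw [abs_mul, abs_mul, Real.abs_exp, Real.abs_exp]
        _ ≤ Real.exp t * (C₁ * ‖k‖ * ‖v‖) + Real.exp t * (C₁ * ‖k'‖ * ‖v‖) := by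
            gcongr
            · exact hB _ _
            · exact hB _ _
        _ = Real.exp t * (C₁ * (‖k‖ + ‖k'‖) * ‖v‖) := by ring
        _ ≤ _ := by gcongr; linarith
    have h2 : Real.exp (-y * (2 * Q A v + B A (hypPath k k' t) v ^ 2)) ≤
        Real.exp (y * M) * Real.exp (-(y * δ) * ‖v‖) * Real.exp (-γ * Real.exp t ^ 2) := by
      rw [← Real.exp_add, ← Real.exp_add]
      refine Real.exp_le_exp.2 ?_
      have := mul_le_mul_of_nonneg_left (hM t ht v hv) hy0.le
      rw [hγ]
      linarith
    calc 2 * √τ.im * (|B A (hypPathDeriv k k' t) v| *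
          Real.exp (-y * (2 * Q A v + B A (hypPath k k' t) v ^ 2)))
        ≤ 2 * √τ.im * ((Real.exp t * (C₁ * (‖k‖ + ‖k'‖) * (1 + ‖v‖))) *
          (Real.exp (y * M) * Real.exp (-(y * δ) * ‖v‖) * Real.exp (-γ * Real.exp t ^ 2))) := by
          gcongr
      _ = 2 * √τ.im * (C₁ * (‖k‖ + ‖k'‖)) * Real.exp (y * M) *
          ((1 + ‖v‖) * Real.exp (-(y * δ) * ‖v‖)) *
          (Real.exp t * Real.exp (-γ * Real.exp t ^ 2)) := by ring
      _ ≤ 2 * √τ.im * (C₁ * (‖k‖ + ‖k'‖)) * Real.exp (y * M) * (C * decayWeight v) *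
          (γ⁻¹ * Real.exp (-t)) := by
          have := decayWeight_pos v
          refine mul_le_mul ?_ (exp_mul_exp_neg_mul_exp_sq_le hγ0 t) (by positivity)
            (by positivity)
          exact mul_le_mul_of_nonneg_left (hC v) (by positivity)
      _ = _ := by rw [hD]; ring
  rw [errKer_hypPath hτ]
  have hint : IntervalIntegrable (fun t => D * decayWeight v * Real.exp (-t))
      MeasureTheory.volume 0 u :=
    Continuous.intervalIntegrable (by fun_prop) _ _
  refine (intervalIntegral.norm_integral_le_of_norm_le hu
    (Eventually.of_forall fun t ht => hbound t ht.1.le) hint).trans ?_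
  rw [intervalIntegral.integral_const_mul]
  have h3 : ∫ t in (0 : ℝ)..u, Real.exp (-t) = 1 - Real.exp (-u) := by
    rw [intervalIntegral.integral_comp_neg Real.exp, integral_exp]; simp
  rw [h3]
  refine mul_le_of_le_one_right (mul_nonneg hD0 (decayWeight_pos v).le) ?_
  linarith [Real.exp_pos (-u)]

lemma tendsto_E_hypPath {τ : ℂ} (hτ : 0 < τ.im) {v : Fin r → ℝ} (hv : B A k v ≠ 0) :
    Tendsto (fun u => E (B A (hypPath k k' u) v * √τ.im)) atTop (𝓝 (Real.sign (B A k v))) := by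
  have hy : 0 < √τ.im := Real.sqrt_pos.2 hτ
  have h0 : Tendsto (fun u : ℝ => Real.exp (-u) * B A k' v) atTop (𝓝 0) := by
    simpa using (Real.tendsto_exp_comp_nhds_zero.2 tendsto_neg_atTop_atBot).mul_const (B A k' v)
  simp only [hypPath, B_add_left, B_smul_left]
  rcases lt_or_gt_of_ne hv with h | h
  · rw [Real.sign_of_neg h]
    refine tendsto_E_atBot.comp ?_
    exact ((Real.tendsto_exp_atTop.atTop_mul_const_of_neg h).atBot_add h0).atBot_mul_const hy
  · rw [Real.sign_of_pos h]
    refine tendsto_E_atTop.comp ?_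
    exact ((Real.tendsto_exp_atTop.atTop_mul_const h).atTop_add h0).atTop_mul_const hy

/-- The mean value inequality along the segment from $c'$ to $c$, which stays in `K`, where the
majorants are uniformly positive. Uniformity in both vectors is what continuity in the parameters
needs. -/
lemma IsLorentzian.exists_errKer_le_of_convex (hA : IsLorentzian A) {K : Set (Fin r → ℝ)}
    (hK : IsCompact K) (hconv : Convex ℝ K) (hKQ : ∀ c ∈ K, Q A c < -(1 / 2)) {τ : ℂ}
    (hτ : 0 < τ.im) : ∃ C : ℝ, ∀ c ∈ K, ∀ c' ∈ K, ∀ v : Fin r → ℝ,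
      ‖errKer A c c' τ v‖ ≤ C * decayWeight v := by
  obtain ⟨C, hC0, hC⟩ := hA.exists_gaussKer_le hK hKQ hτ
  obtain ⟨C₁, hC₁, hB⟩ := exists_abs_B_le A
  obtain ⟨D, hD⟩ := hK.isBounded.exists_norm_le
  refine ⟨2 * √τ.im * (C₁ * (D + D)) * C, fun c hc c' hc' v => ?_⟩
  have hD0 : 0 ≤ D := (norm_nonneg _).trans (hD c hc)
  set p : ℝ → Fin r → ℝ := fun t => c' + t • (c - c') with hp
  have hpK : ∀ t ∈ Set.Icc (0 : ℝ) 1, p t ∈ K := fun t ht =>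
    hconv.add_smul_sub_mem hc' hc ht
  have hderiv : ∀ t : ℝ, HasDerivAt (fun t => E (B A (p t) v * √τ.im))
      (2 * √τ.im * B A (c - c') v * Real.exp (-Real.pi * (B A (p t) v * √τ.im) ^ 2)) t := by
    intro t
    have h1 : HasDerivAt (fun t => B A (p t) v * √τ.im) (B A (c - c') v * √τ.im) t := by
      simp only [hp, B_add_left, B_smul_left]
      simpa using ((((hasDerivAt_id t).mul_const (B A (c - c') v)).const_add
        (B A c' v)).mul_const (√τ.im))
    exact ((hasDerivAt_E _).comp t h1).congr_deriv (by ring)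
  -- The growth of $|e^{2\pi iQ(v)\tau}|$ is put into the derivative bound, where it combines with
  -- the Gaussian.
  set W := Real.exp (-(2 * Real.pi * τ.im) * Q A v) with hW
  have hW0 : 0 < W := Real.exp_pos _
  have hgauss : ∀ t, Real.exp (-Real.pi * (B A (p t) v * √τ.im) ^ 2) * W =
      ‖gaussKer A (p t) τ v‖ := by
    intro t
    rw [norm_gaussKer, hW, ← Real.exp_add, mul_pow, Real.sq_sqrt hτ.le]
    congr 1
    ring
  have hmv := norm_image_sub_le_of_norm_deriv_le_segment_01'
    (f := fun t => E (B A (p t) v * √τ.im))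
    (C := (2 * √τ.im * (C₁ * (D + D)) * C * decayWeight v) / W)
    (fun t _ => (hderiv t).hasDerivWithinAt) (fun t ht => by
      rw [le_div_iff₀ hW0, norm_mul, Real.norm_eq_abs (Real.exp _), Real.abs_exp, mul_assoc,
        hgauss, norm_mul, Real.norm_of_nonneg (by positivity), Real.norm_eq_abs]
      have h2 : |B A (c - c') v| ≤ C₁ * (D + D) * (1 + ‖v‖) := by
        refine (hB _ _).trans ?_
        gcongr
        · exact (norm_sub_le _ _).trans (add_le_add (hD c hc) (hD c' hc'))
        · linarith
      calc 2 * √τ.im * |B A (c - c') v| * ‖gaussKer A (p t) τ v‖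
          ≤ 2 * √τ.im * (C₁ * (D + D) * (1 + ‖v‖)) * ‖gaussKer A (p t) τ v‖ := by gcongr
        _ = 2 * √τ.im * (C₁ * (D + D)) * ((1 + ‖v‖) * ‖gaussKer A (p t) τ v‖) := by ring
        _ ≤ 2 * √τ.im * (C₁ * (D + D)) * (C * decayWeight v) :=
            mul_le_mul_of_nonneg_left (hC _ (hpK t (Set.Ico_subset_Icc_self ht)) v)
              (by positivity)
        _ = _ := by ring)
  rw [le_div_iff₀ hW0, Real.norm_eq_abs] at hmv
  rw [norm_errKer]
  simp only [hp, one_smul, zero_smul, add_zero, add_sub_cancel] at hmv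
  exact hmv

end CuspBound

/-! ### Convergence, the cocycle relation and the limit at a cusp. -/

section Theta

variable {r : ℕ} {A : Matrix (Fin r) (Fin r) ℤ}

/-- The function whose lattice sums give the indefinite theta function. -/
noncomputable def thetaKer (A : Matrix (Fin r) (Fin r) ℤ) (c₁ c₂ : Fin r → ℝ) (τ : ℂ)
    (v : Fin r → ℝ) : ℂ :=
  (rho A c₁ c₂ v τ : ℂ) * Complex.exp (2 * Real.pi * Complex.I * (Q A v : ℝ) * τ)

/-- A vector of negative norm scaled to norm `-1`. -/
noncomputable def unitVec (A : Matrix (Fin r) (Fin r) ℤ) (c : Fin r → ℝ) : Fin r → ℝ :=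
  (√(-Q A c))⁻¹ • c

lemma Q_unitVec {c : Fin r → ℝ} (hc : Q A c < 0) : Q A (unitVec A c) = -1 := by
  rw [unitVec, Q_smul, inv_pow, Real.sq_sqrt (by linarith), inv_mul_eq_div,
    div_eq_iff (by linarith)]
  ring

lemma rhoOne_of_neg {c : Fin r → ℝ} (hc : Q A c < 0) (v : Fin r → ℝ) (τ : ℂ) :
    rhoOne A c v τ = E (B A (unitVec A c) v * √τ.im) := by
  rw [rhoOne, if_pos hc, unitVec, B_smul_left, div_eq_inv_mul]

lemma rhoOne_of_not_neg {c : Fin r → ℝ} (hc : ¬Q A c < 0) (v : Fin r → ℝ) (τ : ℂ) :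
    rhoOne A c v τ = Real.sign (B A c v) := by
  rw [rhoOne, if_neg hc]

lemma thetaKer_of_neg {c₁ c₂ : Fin r → ℝ} (h₁ : Q A c₁ < 0) (h₂ : Q A c₂ < 0) (τ : ℂ)
    (v : Fin r → ℝ) : thetaKer A c₁ c₂ τ v = errKer A (unitVec A c₁) (unitVec A c₂) τ v := by
  rw [thetaKer, errKer, rho, rhoOne_of_neg h₁, rhoOne_of_neg h₂]

lemma imQuot_smul_add {τ : ℂ} (hτ : 0 < τ.im) (a b : Fin r → ℝ) :
    imQuot (τ • toC a + toC b) τ = a := by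
  ext i
  simp [imQuot, toC, hτ.ne']

lemma eq_smul_imQuot_add {τ : ℂ} (hτ : 0 < τ.im) (z : Fin r → ℂ) :
    ∃ b : Fin r → ℝ, z = τ • toC (imQuot z τ) + toC b := by
  refine ⟨fun i => (z i).re - τ.re * imQuot z τ i, ?_⟩
  ext i
  apply Complex.ext
  · simp [toC]
  · simp [toC, imQuot]
    field_simp

lemma mem_D_iff {c : Fin r → ℝ} {τ : ℂ} (a b : Fin r → ℝ) :
    ((τ • toC a + toC b, τ) : (Fin r → ℂ) × ℂ) ∈ D A c ↔ 0 < τ.im ∧ a ∈ R A c := by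
  simp only [D, Set.mem_ofPred_eq]
  refine and_congr_right fun hτ => ?_
  rw [imQuot_smul_add hτ]

/-- Completing the square: $Q(n)\tau+B(n,a\tau+b)=Q(n+a)\tau+B(n+a,b)-Q(a)\tau-B(a,b)$. -/
lemma thetaTerm_eq (hsymm : A.IsSymm) {τ : ℂ} (hτ : 0 < τ.im) (c₁ c₂ a b : Fin r → ℝ)
    (n : Fin r → ℤ) : thetaTerm A c₁ c₂ (τ • toC a + toC b) τ n =
      Complex.exp (-(2 * Real.pi * Complex.I * ((Q A a : ℝ) * τ + (B A a b : ℝ)))) *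
        (thetaKer A c₁ c₂ τ (intVec n + a) * latChar A (intVec n + a) b) := by
  rw [thetaTerm, thetaKer, latChar, imQuot_smul_add hτ, ← toC_intVec, Q_toC, B_add_right,
    B_smul_right, B_toC, B_toC, Q_add hsymm, B_add_left]
  have h : (fun i => (n i : ℝ) + a i) = intVec n + a := rfl
  have hassoc : ∀ p q s t : ℂ, p * (q * s * t) = q * (p * (s * t)) := fun p q s t => by ring
  rw [h, hassoc, ← Complex.exp_add, ← Complex.exp_add]
  congr 2
  push_cast
  ring

lemma norm_thetaTerm (hsymm : A.IsSymm) {τ : ℂ} (hτ : 0 < τ.im) (z : Fin r → ℂ) :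
    ∃ M : ℝ, 0 ≤ M ∧ ∀ (c₁ c₂ : Fin r → ℝ) (n : Fin r → ℤ), ‖thetaTerm A c₁ c₂ z τ n‖ =
      M * ‖thetaKer A c₁ c₂ τ (intVec n + imQuot z τ)‖ := by
  obtain ⟨b, hb⟩ := eq_smul_imQuot_add hτ z
  refine ⟨_, norm_nonneg (Complex.exp (-(2 * Real.pi * Complex.I *
    ((Q A (imQuot z τ) : ℝ) * τ + (B A (imQuot z τ) b : ℝ))))), fun c₁ c₂ n => ?_⟩
  conv_lhs => rw [hb]
  rw [thetaTerm_eq hsymm hτ, norm_mul, norm_mul, norm_latChar, mul_one]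

lemma thetaTerm_add (c₁ c₂ c₃ : Fin r → ℝ) (z : Fin r → ℂ) (τ : ℂ) (n : Fin r → ℤ) :
    thetaTerm A c₁ c₂ z τ n + thetaTerm A c₂ c₃ z τ n = thetaTerm A c₁ c₃ z τ n := by
  simp only [thetaTerm, rho]
  push_cast
  ring

lemma thetaTerm_swap (c₁ c₂ : Fin r → ℝ) (z : Fin r → ℂ) (τ : ℂ) (n : Fin r → ℤ) :
    thetaTerm A c₂ c₁ z τ n = -thetaTerm A c₁ c₂ z τ n := by
  simp only [thetaTerm, rho]
  push_cast
  ring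

lemma theta_swap (c₁ c₂ : Fin r → ℝ) (z : Fin r → ℂ) (τ : ℂ) :
    theta A c₂ c₁ z τ = -theta A c₁ c₂ z τ := by
  simp only [theta, thetaTerm_swap c₁ c₂, tsum_neg]

lemma B_unitVec_neg (hA : IsLorentzian A) {c₀ c₁ c₂ : Fin r → ℝ} (hc₀ : Q A c₀ < 0)
    (h₁ : c₁ ∈ coneC A c₀) (h₂ : c₂ ∈ coneC A c₀) : B A (unitVec A c₁) (unitVec A c₂) < 0 := by
  have h := hA.B_neg_of_mem hc₀ h₁.1 h₁.2 h₂.1.le h₂.2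
  have e1 : 0 < √(-Q A c₁) := Real.sqrt_pos.2 (by linarith [h₁.1])
  have e2 : 0 < √(-Q A c₂) := Real.sqrt_pos.2 (by linarith [h₂.1])
  rw [unitVec, unitVec, B_smul_left, B_smul_right]
  exact mul_neg_of_pos_of_neg (by positivity) (mul_neg_of_pos_of_neg (by positivity) h)

lemma exists_thetaKer_le (hA : IsLorentzian A) {c₀ c₁ c₂ : Fin r → ℝ} (hc₀ : Q A c₀ < 0)
    (h₁ : c₁ ∈ coneC A c₀) (h₂ : c₂ ∈ coneC A c₀) {τ : ℂ} (hτ : 0 < τ.im) :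
    ∃ C : ℝ, ∀ v, ‖thetaKer A c₁ c₂ τ v‖ ≤ C * decayWeight v := by
  simp_rw [thetaKer_of_neg h₁.1 h₂.1]
  exact hA.exists_errKer_le (Q_unitVec h₁.1) (Q_unitVec h₂.1) (B_unitVec_neg hA hc₀ h₁ h₂) hτ

lemma summable_of_thetaKer_le (hsymm : A.IsSymm) {c₁ c₂ : Fin r → ℝ} {τ : ℂ} (hτ : 0 < τ.im)
    (z : Fin r → ℂ) {C : ℝ} (hC : ∀ n : Fin r → ℤ, ‖thetaKer A c₁ c₂ τ (intVec n + imQuot z τ)‖ ≤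
      C * decayWeight (intVec n + imQuot z τ)) :
    Summable fun n => ‖thetaTerm A c₁ c₂ z τ n‖ := by
  obtain ⟨M, hM0, hM⟩ := norm_thetaTerm hsymm hτ z
  refine Summable.of_nonneg_of_le (fun _ => norm_nonneg _) (fun n => ?_)
    (((summable_decayWeight_add (imQuot z τ)).mul_left C).mul_left M)
  rw [hM]
  gcongr
  exact hC n

/-- Scale $c_3$ to $e$ of norm $-1$ and $c_2$ to $k$ with $B(k,e)=-1$; then $k'=e-k$ is isotropic.
So $c_3$ sits at $u=0$ and the cusp at $u=\infty$. -/
lemma exists_hypPair_of_cusp (hA : IsLorentzian A) {c₀ c₂ c₃ : Fin r → ℝ} (hc₀ : Q A c₀ < 0)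
    (h₂ : c₂ ∈ cuspS A c₀) (h₃ : c₃ ∈ coneC A c₀) : ∃ k k' : Fin r → ℝ, ∃ β s : ℝ, 0 < β ∧ 0 < s ∧
      IsHypPair A k k' ∧ c₂ = β • k ∧ c₃ = s • (k + k') := by
  have hneg := hA.B_neg_of_mem hc₀ h₃.1 h₃.2 h₂.2.1.le h₂.2.2
  have hs : 0 < √(-Q A c₃) := Real.sqrt_pos.2 (by linarith [h₃.1])
  set s := √(-Q A c₃) with hs_def
  have hQ := Q_unitVec h₃.1
  set e := unitVec A c₃ with he
  have hce : c₃ = s • e := by rw [he, unitVec, smul_smul, mul_inv_cancel₀ hs.ne', one_smul]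
  set β := -B A c₂ e with hβ
  have hβ0 : 0 < β := by
    rw [hβ, he, unitVec, B_smul_right, B_comm hA.symm c₂ c₃, neg_pos]
    exact mul_neg_of_pos_of_neg (inv_pos.2 hs) hneg
  have hke : B A (β⁻¹ • c₂) e = -1 := by
    rw [B_smul_left, show B A c₂ e = -β by rw [hβ]; ring]
    field_simp
  have hk0 : Q A (β⁻¹ • c₂) = 0 := by rw [Q_smul, h₂.2.1, mul_zero]
  refine ⟨β⁻¹ • c₂, e - β⁻¹ • c₂, β, s, hβ0, hs, ⟨hk0, ?_, ?_⟩, ?_, ?_⟩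
  · rw [Q_sub hA.symm, B_comm hA.symm e, hke, hk0, hQ]; norm_num
  · rw [B_sub_right, B_self, hke, hk0]; norm_num
  · rw [smul_smul, mul_inv_cancel₀ hβ0.ne', one_smul]
  · rw [add_sub_cancel]; exact hce

/-- As $Q(xk+yk')=-xy$, the normalized coefficients are $\sqrt{x/y}$ and its inverse, hence
$u=\frac12\log(x/y)$. -/
lemma unitVec_add_smul {k k' : Fin r → ℝ} (hk : IsHypPair A k k') (hsymm : A.IsSymm) {x y : ℝ}
    (hx : 0 < x) (hy : 0 < y) :
    Q A (x • k + y • k') < 0 ∧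
      unitVec A (x • k + y • k') = hypPath k k' (Real.log (x / y) / 2) := by
  have hQ : Q A (x • k + y • k') = -(x * y) := by
    rw [Q_add hsymm, Q_smul, Q_smul, B_smul_left, B_smul_right, hk.left, hk.right, hk.pair]
    ring
  have hxy : 0 < x * y := mul_pos hx hy
  refine ⟨by rw [hQ]; linarith, ?_⟩
  have hsx : √x ^ 2 = x := Real.sq_sqrt hx.le
  have hsy : √y ^ 2 = y := Real.sq_sqrt hy.le
  have hx0 : √x ≠ 0 := (Real.sqrt_pos.2 hx).ne'
  have hy0 : √y ≠ 0 := (Real.sqrt_pos.2 hy).ne'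
  have he : Real.exp (Real.log (x / y) / 2) = √x / √y := by
    rw [Real.exp_half, Real.exp_log (by positivity), Real.sqrt_div hx.le]
  have he' : Real.exp (-(Real.log (x / y) / 2)) = √y / √x := by
    rw [Real.exp_neg, he, inv_div]
  rw [unitVec, hypPath, he, he', hQ, neg_neg, Real.sqrt_mul hx.le, smul_add, smul_smul, smul_smul]
  congr 2
  · field_simp
    rw [hsx]
  · field_simp
    rw [hsy]

lemma sign_mul_of_pos {t : ℝ} (ht : 0 < t) (x : ℝ) : Real.sign (t * x) = Real.sign x := by
  rcases lt_trichotomy x 0 with h | h | h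
  · rw [Real.sign_of_neg h, Real.sign_of_neg (mul_neg_of_pos_of_neg ht h)]
  · simp [h]
  · rw [Real.sign_of_pos h, Real.sign_of_pos (mul_pos ht h)]

lemma tendsto_thetaKer_hypPath {k k' : Fin r → ℝ} (hk : IsHypPair A k k') (hsymm : A.IsSymm)
    {β s : ℝ} (hβ : 0 < β) (hs : 0 < s) {τ : ℂ} (hτ : 0 < τ.im) {v : Fin r → ℝ}
    (hv : B A k v ≠ 0) :
    Tendsto (fun u => errKer A (hypPath k k' u) (hypPath k k' 0) τ v) atTop
      (𝓝 (thetaKer A (β • k) (s • (k + k')) τ v)) := by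
  have h1 := unitVec_add_smul hk hsymm hs hs
  rw [← smul_add] at h1
  have h2 : ¬Q A (β • k) < 0 := by rw [Q_smul, hk.left]; simp
  rw [thetaKer, rho, rhoOne_of_not_neg h2, rhoOne_of_neg h1.1, h1.2, B_smul_left,
    sign_mul_of_pos hβ, div_self hs.ne', Real.log_one, zero_div]
  unfold errKer
  exact ((Complex.continuous_ofReal.tendsto _).comp
    ((tendsto_E_hypPath hτ hv).sub_const _)).mul_const _

/-- $B(c,n)$ is an integer, so the distance from $B(c,a)$ to the nearest integer is a lower bound.
This is the role of the condition defining $R(c)$. -/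
lemma exists_le_abs_B_cusp {c₀ c : Fin r → ℝ} (hc : c ∈ cuspS A c₀)
    {a : Fin r → ℝ} (ha : a ∈ R A c) : ∃ ε > 0, ∀ n : Fin r → ℤ, ε ≤ |B A c (intVec n + a)| := by
  have hnot : ¬Q A c < 0 := by rw [hc.2.1]; simp
  rw [R, if_neg hnot] at ha
  obtain ⟨m, -, rfl⟩ := hc.1
  have hint : ∀ n : Fin r → ℤ, ∃ N : ℤ, B A (fun i => (m i : ℝ)) (intVec n) = N :=
    fun n => ⟨_, B_intVec m n⟩
  set x := B A (fun i => (m i : ℝ)) a with hx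
  refine ⟨min (Int.fract x) (1 - Int.fract x), ?_, fun n => ?_⟩
  · refine lt_min ?_ (by linarith [Int.fract_lt_one x])
    refine lt_of_le_of_ne (Int.fract_nonneg x) fun h => ?_
    obtain ⟨N, hN⟩ := Int.fract_eq_zero_iff.1 h.symm
    exact ha N hN.symm
  · obtain ⟨N, hN⟩ := hint n
    rw [B_add_right, hN, ← hx, ← Int.floor_add_fract x, ← add_assoc, ← Int.cast_add]
    simp only [Int.floor_add_fract]
    rcases le_or_gt 0 (N + ⌊x⌋) with h | h
    · have h' : (0 : ℝ) ≤ ((N + ⌊x⌋ : ℤ) : ℝ) := by exact_mod_cast h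
      refine (min_le_left _ _).trans ((le_abs_self _).trans' ?_)
      linarith
    · have h' : ((N + ⌊x⌋ : ℤ) : ℝ) ≤ -1 := by exact_mod_cast (by omega : N + ⌊x⌋ ≤ -1)
      refine (min_le_right _ _).trans ((neg_le_abs _).trans' ?_)
      linarith

lemma summable_thetaTerm_cone (hA : IsLorentzian A) {c₀ c₁ c₂ : Fin r → ℝ} (hc₀ : Q A c₀ < 0)
    (h₁ : c₁ ∈ coneC A c₀) (h₂ : c₂ ∈ coneC A c₀) {τ : ℂ} (hτ : 0 < τ.im) (z : Fin r → ℂ) :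
    Summable fun n => ‖thetaTerm A c₁ c₂ z τ n‖ := by
  obtain ⟨C, hC⟩ := exists_thetaKer_le hA hc₀ h₁ h₂ hτ
  exact summable_of_thetaKer_le hA.symm hτ z fun n => hC _

/-- The terms of the theta series along a segment to a cusp are dominated, and converge. -/
lemma cusp_limit (hA : IsLorentzian A) {c₀ c₂ c₃ : Fin r → ℝ} (hc₀ : Q A c₀ < 0)
    (h₂ : c₂ ∈ cuspS A c₀) (h₃ : c₃ ∈ coneC A c₀) {z : Fin r → ℂ} {τ : ℂ}
    (hz : (z, τ) ∈ D A c₂) :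
    (Summable fun n => ‖thetaTerm A c₂ c₃ z τ n‖) ∧
      Tendsto (fun t : ℝ => theta A (c₂ + t • c₃) c₃ z τ) (𝓝[>] 0) (𝓝 (theta A c₂ c₃ z τ)) := by
  have hτ : 0 < τ.im := hz.1
  obtain ⟨k, k', β, s, hβ, hs, hk, rfl, rfl⟩ := exists_hypPair_of_cusp hA hc₀ h₂ h₃
  obtain ⟨ε, hε, hn⟩ := exists_le_abs_B_cusp h₂ hz.2
  have hn' : ∀ n : Fin r → ℤ, ε / β ≤ |B A k (intVec n + imQuot z τ)| := by
    intro n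
    have := hn n
    rw [B_smul_left, abs_mul, abs_of_pos hβ] at this
    rw [div_le_iff₀ hβ]
    linarith
  have hne : ∀ n : Fin r → ℤ, B A k (intVec n + imQuot z τ) ≠ 0 := by
    intro n h0
    have := hn' n
    rw [h0, abs_zero] at this
    have : 0 < ε / β := by positivity
    linarith
  obtain ⟨C, hC⟩ := hk.exists_errKer_cusp_le hA hτ (ε := ε / β) (by positivity)
  have hlim : ∀ n : Fin r → ℤ, Tendsto (fun u => errKer A (hypPath k k' u) (hypPath k k' 0) τ
      (intVec n + imQuot z τ)) atTop
      (𝓝 (thetaKer A (β • k) (s • (k + k')) τ (intVec n + imQuot z τ))) :=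
    fun n => tendsto_thetaKer_hypPath hk hA.symm hβ hs hτ (hne n)
  -- The bound is uniform in $u$, so it survives the limit; this is absolute convergence at the
  -- cusp.
  have hCl : ∀ n : Fin r → ℤ, ‖thetaKer A (β • k) (s • (k + k')) τ (intVec n + imQuot z τ)‖ ≤
      C * decayWeight (intVec n + imQuot z τ) := fun n =>
    le_of_tendsto (hlim n).norm ((eventually_ge_atTop 0).mono fun u hu => hC u hu _ (hn' n))
  refine ⟨summable_of_thetaKer_le hA.symm hτ z hCl, ?_⟩
  have hunit₃ := unitVec_add_smul hk hA.symm hs hs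
  rw [← smul_add, div_self hs.ne', Real.log_one, zero_div] at hunit₃
  -- $c_2+tc_3=(\beta+ts)k+tsk'$, so letting $t\downarrow0$ runs the hyperbola to $u=\infty$.
  have hpath : ∀ t : ℝ, 0 < t → ∀ v, thetaKer A (β • k + t • s • (k + k')) (s • (k + k')) τ v =
      errKer A (hypPath k k' (Real.log ((β + t * s) / (t * s)) / 2)) (hypPath k k' 0) τ v := by
    intro t ht v
    have h := unitVec_add_smul hk hA.symm (x := β + t * s) (y := t * s) (by positivity)
      (by positivity)
    have hv : β • k + t • s • (k + k') = (β + t * s) • k + (t * s) • k' := by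
      rw [smul_smul, smul_add, add_smul, add_assoc]
    rw [hv, thetaKer_of_neg h.1 hunit₃.1, h.2, hunit₃.2]
  have hu0 : ∀ t : ℝ, 0 < t → 0 ≤ Real.log ((β + t * s) / (t * s)) / 2 := by
    intro t ht
    refine div_nonneg (Real.log_nonneg ?_) zero_le_two
    rw [le_div_iff₀ (by positivity)]
    linarith
  have hulim : Tendsto (fun t : ℝ => Real.log ((β + t * s) / (t * s)) / 2) (𝓝[>] 0) atTop := by
    refine Tendsto.atTop_div_const two_pos (Real.tendsto_log_atTop.comp ?_)
    have h5 : Tendsto (fun t : ℝ => β / s * t⁻¹ + 1) (𝓝[>] 0) atTop :=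
      tendsto_atTop_add_const_right _ _
        (tendsto_inv_nhdsGT_zero.const_mul_atTop (by positivity : 0 < β / s))
    refine h5.congr' ?_
    filter_upwards [self_mem_nhdsWithin] with t ht
    have : t ≠ 0 := (Set.mem_Ioi.1 ht).ne'
    field_simp
  obtain ⟨M, hM0, hM⟩ := norm_thetaTerm hA.symm hτ z
  obtain ⟨b, hb⟩ := eq_smul_imQuot_add hτ z
  unfold theta
  refine tendsto_tsum_of_dominated_convergence
    (((summable_decayWeight_add (imQuot z τ)).mul_left C).mul_left M) (fun n => ?_) ?_
  · have h6 := ((hlim n).comp hulim).mul_const (latChar A (intVec n + imQuot z τ) b)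
    have h7 := h6.const_mul (Complex.exp (-(2 * Real.pi * Complex.I *
      ((Q A (imQuot z τ) : ℝ) * τ + (B A (imQuot z τ) b : ℝ)))))
    rw [← thetaTerm_eq hA.symm hτ, ← hb] at h7
    refine h7.congr' ?_
    filter_upwards [self_mem_nhdsWithin] with t ht
    conv_rhs => rw [hb, thetaTerm_eq hA.symm hτ, hpath t ht]
    rfl
  · filter_upwards [self_mem_nhdsWithin] with t ht n
    rw [hM, hpath t ht]
    exact mul_le_mul_of_nonneg_left (hC _ (hu0 t ht) _ (hn' n)) hM0

lemma summable_thetaTerm_right (hA : IsLorentzian A) {c₀ c c₃ : Fin r → ℝ} (hc₀ : Q A c₀ < 0)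
    (hc : c ∈ coneBar A c₀) (h₃ : c₃ ∈ coneC A c₀) {z : Fin r → ℂ} {τ : ℂ}
    (hz : (z, τ) ∈ D A c) : Summable fun n => ‖thetaTerm A c c₃ z τ n‖ := by
  rcases hc with h | h
  · exact summable_thetaTerm_cone hA hc₀ h h₃ hz.1 z
  · exact (cusp_limit hA hc₀ h h₃ hz).1

lemma summable_thetaTerm (hA : IsLorentzian A) {c₀ c₁ c₂ : Fin r → ℝ} (hc₀ : Q A c₀ < 0)
    (h₁ : c₁ ∈ coneBar A c₀) (h₂ : c₂ ∈ coneBar A c₀) {z : Fin r → ℂ} {τ : ℂ}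
    (hz₁ : (z, τ) ∈ D A c₁) (hz₂ : (z, τ) ∈ D A c₂) :
    Summable fun n => ‖thetaTerm A c₁ c₂ z τ n‖ := by
  have e1 := summable_thetaTerm_right hA hc₀ h₁ (mem_coneC hc₀) hz₁
  have e2 := summable_thetaTerm_right hA hc₀ h₂ (mem_coneC hc₀) hz₂
  refine Summable.of_nonneg_of_le (fun _ => norm_nonneg _) (fun n => ?_) (e1.add e2)
  rw [← thetaTerm_add c₁ c₀ c₂]
  refine (norm_add_le _ _).trans_eq ?_
  rw [thetaTerm_swap c₂ c₀, norm_neg]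

lemma theta_add (hA : IsLorentzian A) {c₀ c₁ c₂ c₃ : Fin r → ℝ} (hc₀ : Q A c₀ < 0)
    (h₁ : c₁ ∈ coneBar A c₀) (h₂ : c₂ ∈ coneBar A c₀) (h₃ : c₃ ∈ coneBar A c₀) {z : Fin r → ℂ}
    {τ : ℂ} (hz₁ : (z, τ) ∈ D A c₁) (hz₂ : (z, τ) ∈ D A c₂) (hz₃ : (z, τ) ∈ D A c₃) :
    theta A c₁ c₂ z τ + theta A c₂ c₃ z τ = theta A c₁ c₃ z τ := by
  unfold theta
  rw [← (summable_thetaTerm hA hc₀ h₁ h₂ hz₁ hz₂).of_norm.tsum_add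
    (summable_thetaTerm hA hc₀ h₂ h₃ hz₂ hz₃).of_norm]
  exact tsum_congr fun n => thetaTerm_add _ _ _ _ _ _

end Theta

/-! ### The lattices $\mathbb Z^r\subset A^{-1}\mathbb Z^r$ and the finite quotient. -/

section Lattices

variable {r : ℕ} {A : Matrix (Fin r) (Fin r) ℤ}

lemma mem_intLattice {x : Fin r → ℝ} : x ∈ intLattice r ↔ ∃ n : Fin r → ℤ, intVec n = x := by
  rfl

lemma mem_dualLattice {x : Fin r → ℝ} :
    x ∈ dualLattice A ↔ ∃ m : Fin r → ℤ, dualVec A m = x := by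
  constructor
  · rintro ⟨_, ⟨n, rfl⟩, rfl⟩
    exact ⟨n, rfl⟩
  · rintro ⟨n, rfl⟩
    exact ⟨_, ⟨n, rfl⟩, rfl⟩

lemma dualVec_mulVec (hdet : A.det ≠ 0) (n : Fin r → ℤ) : dualVec A (A *ᵥ n) = intVec n := by
  have h : intVec (A *ᵥ n) = A.map (Int.cast : ℤ → ℝ) *ᵥ intVec n := by
    ext i
    simp [intVec, mulVec, dotProduct]
  rw [dualVec, h, mulVec_mulVec, nonsing_inv_mul _ (isUnit_det_map hdet), one_mulVec]

lemma intVec_mem_dualLattice (hdet : A.det ≠ 0) (n : Fin r → ℤ) : intVec n ∈ dualLattice A :=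
  mem_dualLattice.2 ⟨_, dualVec_mulVec hdet n⟩

lemma dualVec_injective (hdet : A.det ≠ 0) : Function.Injective (dualVec A) := by
  intro m n h
  have h1 := congrArg (fun v => A.map (Int.cast : ℤ → ℝ) *ᵥ v) h
  simp only [dualVec, mulVec_mulVec] at h1
  rw [mul_nonsing_inv _ (isUnit_det_map hdet), one_mulVec, one_mulVec] at h1
  ext i
  have := congrFun h1 i
  simpa [intVec] using this

lemma dualVec_add (m n : Fin r → ℤ) : dualVec A (m + n) = dualVec A m + dualVec A n := by
  rw [dualVec, intVec_add, mulVec_add, dualVec, dualVec]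

/-- By the adjugate, $|\det A|$ times $A^{-1}$ is integral, so the class of $A^{-1}m$ depends only
on $m$ modulo $|\det A|$. -/
lemma finite_discGroup (hdet : A.det ≠ 0) : Finite (DiscGroup A) := by
  set d := A.det.natAbs with hd
  have hd0 : d ≠ 0 := by simpa [hd] using hdet
  have : NeZero d := ⟨hd0⟩
  let f : (Fin r → Fin d) → DiscGroup A := fun j =>
    QuotientAddGroup.mk ⟨dualVec A (fun i => ((j i : ℕ) : ℤ)), mem_dualLattice.2 ⟨_, rfl⟩⟩
  refine Finite.of_surjective f fun q => ?_
  induction q using QuotientAddGroup.induction_on with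
  | _ x =>
    obtain ⟨x, hx⟩ := x
    obtain ⟨m, rfl⟩ := mem_dualLattice.1 hx
    have hlt : ∀ i, (m i % (d : ℤ)).toNat < d := fun i => by
      have h1 := Int.emod_nonneg (m i) (b := (d : ℤ)) (by exact_mod_cast hd0)
      have h2 := Int.emod_lt_of_pos (m i) (b := (d : ℤ)) (by omega)
      omega
    refine ⟨fun i => ⟨(m i % (d : ℤ)).toNat, hlt i⟩, ?_⟩
    refine QuotientAddGroup.eq.2 ?_
    rw [AddSubgroup.mem_addSubgroupOf, mem_intLattice]
    obtain ⟨e, he⟩ : ∃ e : ℤ, (d : ℤ) = A.det * e :=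
      ⟨A.det.sign, (Int.mul_sign_self A.det).symm⟩
    refine ⟨e • (A.adjugate *ᵥ fun i => m i / (d : ℤ)), ?_⟩
    rw [← dualVec_mulVec hdet]
    have h3 : A *ᵥ (e • (A.adjugate *ᵥ fun i => m i / (d : ℤ))) =
        fun i => (d : ℤ) * (m i / (d : ℤ)) := by
      rw [mulVec_smul, mulVec_mulVec, mul_adjugate, smul_mulVec, one_mulVec, smul_smul,
        mul_comm e, ← he]
      rfl
    have h4 : m = (fun i => (((m i % (d : ℤ)).toNat : ℕ) : ℤ)) +
        fun i => (d : ℤ) * (m i / (d : ℤ)) := by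
      ext i
      have h1 := Int.emod_nonneg (m i) (b := (d : ℤ)) (by exact_mod_cast hd0)
      simp only [Pi.add_apply, Int.toNat_of_nonneg h1, Int.emod_add_mul_ediv]
    rw [h3]
    simp only [AddSubgroup.coe_add, AddSubgroup.coe_neg]
    rw [eq_neg_add_iff_add_eq, ← dualVec_add, ← h4]

/-- A sum over the dual lattice as a sum over classes modulo the integral lattice. -/
lemma finsum_tsum_representatives (hdet : A.det ≠ 0) {F : (Fin r → ℝ) → ℂ}
    (hF : Summable fun m : Fin r → ℤ => F (dualVec A m)) (s : DiscGroup A → dualLattice A)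
    (hs : ∀ q, (QuotientAddGroup.mk (s q) : DiscGroup A) = q) :
    ∑ᶠ q : DiscGroup A, ∑' n : Fin r → ℤ, F (intVec n + (s q : Fin r → ℝ)) =
      ∑' m : Fin r → ℤ, F (dualVec A m) := by
  have := finite_discGroup hdet
  have := Fintype.ofFinite (DiscGroup A)
  -- The dual lattice is parametrized twice: by (class, integral vector) through the
  -- representatives, and by $m\mapsto A^{-1}m$.
  let φ : DiscGroup A × (Fin r → ℤ) → dualLattice A := fun p =>
    ⟨intVec p.2, intVec_mem_dualLattice hdet p.2⟩ + s p.1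
  let ψ : (Fin r → ℤ) → dualLattice A := fun m => ⟨dualVec A m, mem_dualLattice.2 ⟨m, rfl⟩⟩
  have hinj : Function.Injective (intVec (r := r)) := fun m n h => by
    ext i
    simpa [intVec] using congrFun h i
  have hφ : Function.Bijective φ := by
    have hmk : ∀ p, (QuotientAddGroup.mk (φ p) : DiscGroup A) = p.1 := by
      intro p
      rw [← hs p.1]
      refine (QuotientAddGroup.eq.2 ?_).symm
      rw [AddSubgroup.mem_addSubgroupOf]
      exact ⟨p.2, by simp [φ]; rfl⟩
    constructor
    · rintro ⟨q, n⟩ ⟨q', n'⟩ h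
      have h1 : q = q' := (hmk (q, n)).symm.trans
        ((congrArg (fun x => (QuotientAddGroup.mk x : DiscGroup A)) h).trans (hmk (q', n')))
      subst h1
      have h2 := add_right_cancel h
      rw [Subtype.mk.injEq] at h2
      exact Prod.ext rfl (hinj h2)
    · intro x
      have h1 : (QuotientAddGroup.mk (s (QuotientAddGroup.mk x)) : DiscGroup A) =
        QuotientAddGroup.mk x := hs _
      rw [QuotientAddGroup.eq, AddSubgroup.mem_addSubgroupOf] at h1
      obtain ⟨n, hn⟩ := mem_intLattice.1 h1
      refine ⟨(QuotientAddGroup.mk x, n), ?_⟩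
      apply Subtype.ext
      simp only [φ, AddSubgroup.coe_add, hn, AddSubgroup.coe_neg]
      abel
  have hψ : Function.Bijective ψ := by
    refine ⟨fun m n h => dualVec_injective hdet (congrArg Subtype.val h), fun x => ?_⟩
    obtain ⟨m, hm⟩ := mem_dualLattice.1 x.2
    exact ⟨m, Subtype.ext hm⟩
  have hF' : Summable fun x : dualLattice A => F x := by
    rw [← (Equiv.ofBijective ψ hψ).summable_iff]
    exact hF
  have h1 : ∑' m : Fin r → ℤ, F (dualVec A m) = ∑' x : dualLattice A, F x :=
    (Equiv.ofBijective ψ hψ).tsum_eq (fun x : dualLattice A => F x)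
  have h2 : ∑' x : dualLattice A, F x = ∑' p, F (φ p) :=
    ((Equiv.ofBijective φ hφ).tsum_eq (fun x : dualLattice A => F x)).symm
  have h3 : Summable fun p => F (φ p) := (Equiv.ofBijective φ hφ).summable_iff.2 hF'
  rw [h1, h2, h3.tsum_prod, tsum_fintype, finsum_eq_sum_of_fintype]
  rfl

end Lattices

/-! ### The inversion $\tau\mapsto-1/\tau$. -/

section Inversion

variable {r : ℕ} {A : Matrix (Fin r) (Fin r) ℤ}

/-- Since $\operatorname{Re}(-i\tau)>0$, inversion is compatible with the principal branch. -/
lemma errConst_neg_one_div {τ : ℂ} (hτ : 0 < τ.im) : errConst A (-1 / τ) =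
    Complex.I / ((√(-(A.det : ℝ)) : ℝ) : ℂ) * (-Complex.I * τ) ^ ((r : ℂ) / 2) := by
  have hτ0 : τ ≠ 0 := by rintro rfl; simp at hτ
  have h1 : -Complex.I * (-1 / τ) = (-Complex.I * τ)⁻¹ := by
    rw [mul_inv, inv_neg, Complex.inv_I]; field_simp
  have harg : (-Complex.I * τ).arg ≠ Real.pi := by
    intro h
    rw [Complex.arg_eq_pi_iff] at h
    simp at h
    linarith [h.1]
  rw [errConst, h1, Complex.inv_cpow _ _ harg, inv_pow, inv_inv, ← Complex.cpow_nat_mul]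
  push_cast
  rw [mul_one_div]
  ring

/-- Inversion acts on the real coordinates of $z=a\tau+b$ by $(a,b)\mapsto(-b,a)$. -/
lemma smul_toC_div {τ : ℂ} (hτ0 : τ ≠ 0) (a b : Fin r → ℝ) :
    (fun i => (τ • toC a + toC b) i / τ) = (-1 / τ) • toC (-b) + toC a := by
  ext i
  simp [toC]
  field_simp
  ring

lemma smul_toC_add_smul (τ : ℂ) (a b p : Fin r → ℝ) :
    τ • toC a + toC b + τ • toC p = τ • toC (a + p) + toC b := by
  rw [toC_add, smul_add]; abel

lemma Q_smul_toC_add (hsymm : A.IsSymm) (τ : ℂ) (a b : Fin r → ℝ) :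
    Q A (τ • toC a + toC b) = τ ^ 2 * (Q A a : ℝ) + (Q A b : ℝ) + τ * (B A a b : ℝ) := by
  rw [Q_add hsymm, Q_smul, B_smul_left, Q_toC, Q_toC, B_toC]

theorem theta_inversion_cone (hA : IsLorentzian A) {c₀ c₁ c₂ : Fin r → ℝ} (hc₀ : Q A c₀ < 0)
    (h₁ : c₁ ∈ coneC A c₀) (h₂ : c₂ ∈ coneC A c₀) {τ : ℂ} (hτ : 0 < τ.im) (z : Fin r → ℂ)
    (s : DiscGroup A → dualLattice A)
    (hs : ∀ q, (QuotientAddGroup.mk (s q) : DiscGroup A) = q) :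
    theta A c₁ c₂ (fun i => z i / τ) (-1 / τ) =
      Complex.I / ((√(-(A.det : ℝ)) : ℝ) : ℂ) * (-Complex.I * τ) ^ ((r : ℂ) / 2) *
        ∑ᶠ q : DiscGroup A,
          Complex.exp (2 * Real.pi * Complex.I * Q A (z + τ • toC (s q : Fin r → ℝ)) / τ) *
            theta A c₁ c₂ (z + τ • toC (s q : Fin r → ℝ)) τ := by
  have hτ0 : τ ≠ 0 := by rintro rfl; simp at hτ
  have hτ' := neg_one_div_im_pos hτ
  obtain ⟨b, hb⟩ := eq_smul_imQuot_add hτ z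
  set a := imQuot z τ
  -- Both sides have the same prefactor $\kappa$: on the right, $e^{2\pi iQ(z+p\tau)/\tau}$ cancels
  -- everything in the completed square except $Q(b)/\tau$, for every $p$.
  set κ := Complex.exp (2 * Real.pi * Complex.I * (Q A b : ℝ) / τ) with hκ
  have hL : theta A c₁ c₂ (fun i => z i / τ) (-1 / τ) = κ * ∑' n : Fin r → ℤ,
      errKer A (unitVec A c₁) (unitVec A c₂) (-1 / τ) (intVec n - b) *
        latChar A (intVec n) a := by
    rw [hb, smul_toC_div hτ0, theta, ← tsum_mul_left]
    refine tsum_congr fun n => ?_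
    rw [thetaTerm_eq hA.symm hτ', thetaKer_of_neg h₁.1 h₂.1, ← sub_eq_add_neg, Q_neg]
    have h3 : Complex.exp (-(2 * Real.pi * Complex.I * ((Q A b : ℝ) * (-1 / τ) +
        (B A (-b) a : ℝ)))) * latChar A (intVec n - b) a = κ * latChar A (intVec n) a := by
      rw [latChar, latChar, hκ, ← Complex.exp_add, ← Complex.exp_add, B_sub_left, B_neg_left]
      congr 1
      push_cast
      ring
    linear_combination errKer A (unitVec A c₁) (unitVec A c₂) (-1 / τ) (intVec n - b) * h3
  have hR : ∀ q : DiscGroup A,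
      Complex.exp (2 * Real.pi * Complex.I * Q A (z + τ • toC (s q : Fin r → ℝ)) / τ) *
        theta A c₁ c₂ (z + τ • toC (s q : Fin r → ℝ)) τ = κ * ∑' n : Fin r → ℤ,
      (errKer A (unitVec A c₁) (unitVec A c₂) τ ((intVec n + (s q : Fin r → ℝ)) + a) *
        latChar A ((intVec n + (s q : Fin r → ℝ)) + a) b) := by
    intro q
    rw [hb, smul_toC_add_smul, theta, ← tsum_mul_left, ← tsum_mul_left]
    refine tsum_congr fun n => ?_
    rw [thetaTerm_eq hA.symm hτ, thetaKer_of_neg h₁.1 h₂.1, Q_smul_toC_add hA.symm, ← mul_assoc,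
      ← Complex.exp_add, hκ, add_assoc (intVec n), add_comm (s q : Fin r → ℝ) a]
    congr 2
    field_simp
    ring
  obtain ⟨C, hC⟩ := hA.exists_errKer_le (Q_unitVec h₁.1) (Q_unitVec h₂.1)
    (B_unitVec_neg hA hc₀ h₁ h₂) hτ
  have hsum : Summable fun m : Fin r → ℤ => errKer A (unitVec A c₁) (unitVec A c₂) τ
      (dualVec A m + a) * latChar A (dualVec A m + a) b := by
    refine Summable.of_norm (Summable.of_nonneg_of_le (fun _ => norm_nonneg _) (fun m => ?_)
      ((summable_decayWeight_dualVec_add hA.det_ne_zero a).mul_left C))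
    rw [norm_mul, norm_latChar, mul_one]
    exact hC _
  simp_rw [hR]
  rw [hL, hA.tsum_errKer (Q_unitVec h₁.1) (Q_unitVec h₂.1) (B_unitVec_neg hA hc₀ h₁ h₂) hτ,
    errConst_neg_one_div hτ]
  have := finite_discGroup hA.det_ne_zero
  have := Fintype.ofFinite (DiscGroup A)
  rw [← finsum_tsum_representatives hA.det_ne_zero (F := fun v => errKer A (unitVec A c₁)
      (unitVec A c₂) τ (v + a) * latChar A (v + a) b) hsum s hs]
  simp_rw [finsum_eq_sum_of_fintype]
  rw [← Finset.mul_sum]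
  ring

lemma neg_mem_R {c a : Fin r → ℝ} (ha : a ∈ R A c) : -a ∈ R A c := by
  unfold R at ha ⊢
  split_ifs at ha ⊢
  · trivial
  · intro m hm
    rw [B_neg_right] at hm
    exact ha (-m) (by push_cast; linarith)

/-- For a cusp $c$, which is integral, $B(c,p)\in\mathbb Z$ when $p\in A^{-1}\mathbb Z^r$. -/
lemma add_mem_R (hA : IsLorentzian A) {c₀ c a p : Fin r → ℝ} (hc : c ∈ coneBar A c₀)
    (ha : a ∈ R A c) (hp : p ∈ dualLattice A) : a + p ∈ R A c := by
  obtain ⟨n, rfl⟩ := mem_dualLattice.1 hp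
  unfold R at ha ⊢
  split_ifs at ha ⊢ with h
  · trivial
  · have hcusp : c ∈ cuspS A c₀ := hc.resolve_left fun h' => h h'.1
    obtain ⟨k, -, rfl⟩ := hcusp.1
    intro m hm
    rw [B_add_right, B_dualVec_right hA.det_ne_zero] at hm
    refine ha (m - k ⬝ᵥ n) ?_
    have h2 : ((k ⬝ᵥ n : ℤ) : ℝ) = (fun i => (k i : ℝ)) ⬝ᵥ intVec n := by
      simp [dotProduct, intVec]
    push_cast
    rw [h2]
    linarith

lemma mem_D'_iff {c : Fin r → ℝ} {τ : ℂ} (a b : Fin r → ℝ) :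
    ((τ • toC a + toC b, τ) : (Fin r → ℂ) × ℂ) ∈ D' A c ↔ 0 < τ.im ∧ a ∈ R A c ∧ b ∈ R A c := by
  simp only [D', Set.mem_ofPred_eq, mem_D_iff]
  constructor
  · rintro ⟨⟨hτ, ha⟩, h⟩
    have hτ0 : τ ≠ 0 := by rintro rfl; simp at hτ
    rw [smul_toC_div hτ0, mem_D_iff] at h
    exact ⟨hτ, ha, by simpa using neg_mem_R h.2⟩
  · rintro ⟨hτ, ha, hb⟩
    have hτ0 : τ ≠ 0 := by rintro rfl; simp at hτ
    refine ⟨⟨hτ, ha⟩, ?_⟩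
    rw [smul_toC_div hτ0, mem_D_iff]
    exact ⟨neg_one_div_im_pos hτ, neg_mem_R hb⟩

lemma D'_eq (c : Fin r → ℝ) : D' A c = {p : (Fin r → ℂ) × ℂ | 0 < p.2.im ∧
    ∃ a ∈ R A c, ∃ b ∈ R A c, p.1 = p.2 • toC a + toC b} := by
  ext ⟨z, τ⟩
  constructor
  · intro h
    have hτ : 0 < τ.im := h.1.1
    obtain ⟨b, hb⟩ := eq_smul_imQuot_add hτ z
    have h' := h
    rw [hb, mem_D'_iff] at h'
    exact ⟨hτ, _, h'.2.1, b, h'.2.2, hb⟩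
  · rintro ⟨hτ, a, ha, b, hb, hz⟩
    simp only at hz hτ
    rw [hz, mem_D'_iff]
    exact ⟨hτ, ha, hb⟩

lemma mem_D_add_smul (hA : IsLorentzian A) {c₀ c : Fin r → ℝ} (hc : c ∈ coneBar A c₀)
    {z : Fin r → ℂ} {τ : ℂ} (hz : (z, τ) ∈ D A c) {p : Fin r → ℝ} (hp : p ∈ dualLattice A) :
    (z + τ • toC p, τ) ∈ D A c := by
  obtain ⟨b, hb⟩ := eq_smul_imQuot_add hz.1 z
  rw [hb, mem_D_iff] at hz
  rw [hb, smul_toC_add_smul, mem_D_iff]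
  exact ⟨hz.1, add_mem_R hA hc hz.2 hp⟩

lemma add_smul_mem_coneC (hA : IsLorentzian A) {c₀ c₂ c₃ : Fin r → ℝ} (hc₀ : Q A c₀ < 0)
    (h₂ : c₂ ∈ cuspS A c₀) (h₃ : c₃ ∈ coneC A c₀) {t : ℝ} (ht : 0 < t) :
    c₂ + t • c₃ ∈ coneC A c₀ := by
  have h := hA.B_neg_of_mem hc₀ h₃.1 h₃.2 h₂.2.1.le h₂.2.2
  have h3 := h₃.1
  have h4 := h₃.2
  have h5 := h₂.2.2
  constructor
  · rw [Q_add hA.symm, Q_smul, B_smul_right, h₂.2.1, B_comm hA.symm c₂ c₃]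
    have : 0 < t ^ 2 := by positivity
    nlinarith
  · rw [B_add_left, B_smul_left]
    nlinarith

theorem tendsto_theta_cusp (hA : IsLorentzian A) {c₀ c₁ c₂ c₃ : Fin r → ℝ} (hc₀ : Q A c₀ < 0)
    (h₁ : c₁ ∈ coneC A c₀) (h₂ : c₂ ∈ cuspS A c₀) (h₃ : c₃ ∈ coneC A c₀) {z : Fin r → ℂ} {τ : ℂ}
    (hz : (z, τ) ∈ D A c₂) :
    Tendsto (fun t : ℝ => theta A c₁ (c₂ + t • c₃) z τ) (𝓝[>] 0) (𝓝 (theta A c₁ c₂ z τ)) := by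
  have hcone : ∀ {c}, c ∈ coneC A c₀ → (z, τ) ∈ D A c := fun {c} hc =>
    ⟨hz.1, by rw [R, if_pos hc.1]; trivial⟩
  have h := ((cusp_limit hA hc₀ h₂ h₃ hz).2.neg).const_add (theta A c₁ c₃ z τ)
  have e : theta A c₁ c₂ z τ = theta A c₁ c₃ z τ + -theta A c₂ c₃ z τ := by
    rw [← theta_swap, theta_add hA hc₀ (Or.inl h₁) (Or.inl h₃) (Or.inr h₂) (hcone h₁) (hcone h₃) hz]
  rw [e]
  refine h.congr' ?_
  filter_upwards [self_mem_nhdsWithin] with t ht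
  have ht' := add_smul_mem_coneC hA hc₀ h₂ h₃ ht
  rw [← theta_swap, theta_add hA hc₀ (Or.inl h₁) (Or.inl h₃) (Or.inl ht') (hcone h₁) (hcone h₃)
    (hcone ht')]

/-- The inversion formula for a cone point and an arbitrary point. -/
lemma theta_inversion_left (hA : IsLorentzian A) {c₀ c : Fin r → ℝ} (hc₀ : Q A c₀ < 0)
    (hc : c ∈ coneBar A c₀) {z : Fin r → ℂ} {τ : ℂ} (hz : (z, τ) ∈ D' A c)
    (s : DiscGroup A → dualLattice A)
    (hs : ∀ q, (QuotientAddGroup.mk (s q) : DiscGroup A) = q) :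
    theta A c₀ c (fun i => z i / τ) (-1 / τ) =
      Complex.I / ((√(-(A.det : ℝ)) : ℝ) : ℂ) * (-Complex.I * τ) ^ ((r : ℂ) / 2) *
        ∑ᶠ q : DiscGroup A,
          Complex.exp (2 * Real.pi * Complex.I * Q A (z + τ • toC (s q : Fin r → ℝ)) / τ) *
            theta A c₀ c (z + τ • toC (s q : Fin r → ℝ)) τ := by
  have h₀ := mem_coneC hc₀
  rcases hc with h | h
  · exact theta_inversion_cone hA hc₀ h₀ h hz.1.1 z s hs
  have hL := tendsto_theta_cusp hA hc₀ h₀ h h₀ hz.2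
  have := finite_discGroup hA.det_ne_zero
  have := Fintype.ofFinite (DiscGroup A)
  -- Both sides, taken at the cone points $c+tc_0$, agree for $t>0$ and converge as $t\downarrow0$;
  -- the sum over classes is finite.
  refine tendsto_nhds_unique_of_eventuallyEq hL (g := fun t : ℝ =>
    Complex.I / ((√(-(A.det : ℝ)) : ℝ) : ℂ) * (-Complex.I * τ) ^ ((r : ℂ) / 2) *
        ∑ᶠ q : DiscGroup A,
          Complex.exp (2 * Real.pi * Complex.I * Q A (z + τ • toC (s q : Fin r → ℝ)) / τ) *
            theta A c₀ (c + t • c₀) (z + τ • toC (s q : Fin r → ℝ)) τ) ?_ ?_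
  · simp_rw [finsum_eq_sum_of_fintype]
    refine Tendsto.const_mul _ (tendsto_finsetSum _ fun q _ => Tendsto.const_mul _ ?_)
    exact tendsto_theta_cusp hA hc₀ h₀ h h₀ (mem_D_add_smul hA (Or.inr h) hz.1 (s q).2)
  · filter_upwards [self_mem_nhdsWithin] with t ht
    exact theta_inversion_cone hA hc₀ h₀ (add_smul_mem_coneC hA hc₀ h h₀ ht) hz.1.1 z s hs

/-- The cocycle relation writes $\theta^{c_1,c_2}=\theta^{c_0,c_2}-\theta^{c_0,c_1}$, and the
formula is linear in $\theta$. -/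
theorem theta_inversion (hA : IsLorentzian A) {c₀ c₁ c₂ : Fin r → ℝ} (hc₀ : Q A c₀ < 0)
    (h₁ : c₁ ∈ coneBar A c₀) (h₂ : c₂ ∈ coneBar A c₀) {z : Fin r → ℂ} {τ : ℂ}
    (hz₁ : (z, τ) ∈ D' A c₁) (hz₂ : (z, τ) ∈ D' A c₂) (s : DiscGroup A → dualLattice A)
    (hs : ∀ q, (QuotientAddGroup.mk (s q) : DiscGroup A) = q) :
    theta A c₁ c₂ (fun i => z i / τ) (-1 / τ) =
      Complex.I / ((√(-(A.det : ℝ)) : ℝ) : ℂ) * (-Complex.I * τ) ^ ((r : ℂ) / 2) *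
        ∑ᶠ q : DiscGroup A,
          Complex.exp (2 * Real.pi * Complex.I * Q A (z + τ • toC (s q : Fin r → ℝ)) / τ) *
            theta A c₁ c₂ (z + τ • toC (s q : Fin r → ℝ)) τ := by
  have hτ : 0 < τ.im := hz₁.1.1
  have h₀ : c₀ ∈ coneBar A c₀ := Or.inl (mem_coneC hc₀)
  have hD₀ : ∀ (w : Fin r → ℂ) {σ : ℂ}, 0 < σ.im → (w, σ) ∈ D A c₀ := fun w σ hσ =>
    ⟨hσ, by rw [R, if_pos hc₀]; trivial⟩
  have hsub : ∀ {w : Fin r → ℂ} {σ : ℂ}, 0 < σ.im → (w, σ) ∈ D A c₁ → (w, σ) ∈ D A c₂ →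
      theta A c₁ c₂ w σ = theta A c₀ c₂ w σ - theta A c₀ c₁ w σ := fun hσ hw₁ hw₂ => by
    rw [← theta_add hA hc₀ h₁ h₀ h₂ hw₁ (hD₀ _ hσ) hw₂, theta_swap c₀ c₁]; ring
  have := finite_discGroup hA.det_ne_zero
  have := Fintype.ofFinite (DiscGroup A)
  rw [hsub (neg_one_div_im_pos hτ) hz₁.2 hz₂.2, theta_inversion_left hA hc₀ h₂ hz₂ s hs,
    theta_inversion_left hA hc₀ h₁ hz₁ s hs, ← mul_sub]
  simp_rw [finsum_eq_sum_of_fintype]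
  rw [← Finset.sum_sub_distrib]
  congr 1
  refine Finset.sum_congr rfl fun q _ => ?_
  rw [hsub hτ (mem_D_add_smul hA h₁ hz₁.1 (s q).2) (mem_D_add_smul hA h₂ hz₂.1 (s q).2), mul_sub]

end Inversion

/-! ### Continuity in the parameters. -/

section Continuity

variable {r : ℕ} {A : Matrix (Fin r) (Fin r) ℤ}

lemma isOpen_setOf_Q_lt (x : ℝ) : IsOpen {c : Fin r → ℝ | Q A c < x} :=
  isOpen_lt (continuous_Q continuous_id) continuous_const

lemma continuousAt_unitVec {c : Fin r → ℝ} (hc : Q A c < 0) : ContinuousAt (unitVec A) c := by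
  unfold unitVec
  have hQ : Continuous fun c : Fin r → ℝ => Q A c := continuous_Q continuous_id
  have h0 : √(-Q A c) ≠ 0 := (Real.sqrt_pos.2 (by linarith)).ne'
  exact ((hQ.neg.sqrt.continuousAt).inv₀ h0).smul continuousAt_id

/-- Dominated convergence: near $c$ the normalized vectors stay in a closed ball, convex and
compact, on which $Q<-1/2$. -/
lemma tendsto_theta_self (hA : IsLorentzian A) {c : Fin r → ℝ} (hc : Q A c < 0) (z : Fin r → ℂ)
    {τ : ℂ} (hτ : 0 < τ.im) : Tendsto (fun c' => theta A c' c z τ) (𝓝 c) (𝓝 0) := by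
  have hzero : theta A c c z τ = 0 := by simp [theta, thetaTerm, rho]
  rw [← hzero]
  set e := unitVec A c with he
  have hQe : Q A e = -1 := Q_unitVec hc
  obtain ⟨ε, hε, hball⟩ := Metric.nhds_basis_closedBall.mem_iff.1
    ((isOpen_setOf_Q_lt (A := A) (-(1 / 2))).mem_nhds (show Q A e < -(1 / 2) by
      rw [hQe]; norm_num))
  obtain ⟨C, hC⟩ := hA.exists_errKer_le_of_convex (isCompact_closedBall e ε)
    (convex_closedBall e ε) (fun c' hc' => hball hc') hτ
  have hmem : ∀ᶠ c' in 𝓝 c, Q A c' < 0 ∧ unitVec A c' ∈ Metric.closedBall e ε := by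
    have h1 : ∀ᶠ c' in 𝓝 c, Q A c' < 0 := (isOpen_setOf_Q_lt (A := A) 0).mem_nhds hc
    have h2 : ∀ᶠ c' in 𝓝 c, unitVec A c' ∈ Metric.closedBall e ε :=
      (continuousAt_unitVec hc).preimage_mem_nhds (Metric.closedBall_mem_nhds e hε)
    exact h1.and h2
  obtain ⟨M, hM0, hM⟩ := norm_thetaTerm hA.symm hτ z
  unfold theta
  refine tendsto_tsum_of_dominated_convergence
    (((summable_decayWeight_add (imQuot z τ)).mul_left C).mul_left M) (fun n => ?_) ?_
  · obtain ⟨b, hb⟩ := eq_smul_imQuot_add hτ z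
    set a := imQuot z τ with ha
    have h1 : Tendsto (fun c' => errKer A (unitVec A c') e τ (intVec n + a)) (𝓝 c)
        (𝓝 (errKer A e e τ (intVec n + a))) := by
      have h2 : Continuous fun x => errKer A x e τ (intVec n + a) := by
        unfold errKer
        have h3 : Continuous fun x : Fin r → ℝ => B A x (intVec n + a) :=
          continuous_B continuous_id continuous_const
        have h4 := continuous_E
        fun_prop
      exact h2.continuousAt.comp (continuousAt_unitVec hc)
    rw [he, ← thetaKer_of_neg hc hc] at h1
    have h5 := (h1.mul_const (latChar A (intVec n + a) b)).const_mul
      (Complex.exp (-(2 * Real.pi * Complex.I * ((Q A a : ℝ) * τ + (B A a b : ℝ)))))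
    rw [← thetaTerm_eq hA.symm hτ, ← hb] at h5
    refine h5.congr' ?_
    filter_upwards [hmem] with c' hc'
    conv_rhs => rw [hb, thetaTerm_eq hA.symm hτ, thetaKer_of_neg hc'.1 hc]
  · filter_upwards [hmem] with c' hc' n
    rw [hM, thetaKer_of_neg hc'.1 hc]
    exact mul_le_mul_of_nonneg_left (hC _ hc'.2 _ (Metric.mem_closedBall_self hε.le) _) hM0

theorem continuousOn_theta (hA : IsLorentzian A) {c₀ : Fin r → ℝ} (hc₀ : Q A c₀ < 0)
    (z : Fin r → ℂ) {τ : ℂ} (hτ : 0 < τ.im) :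
    ContinuousOn (fun p : (Fin r → ℝ) × (Fin r → ℝ) => theta A p.1 p.2 z τ)
      (coneC A c₀ ×ˢ coneC A c₀) := by
  have hD : ∀ {c}, c ∈ coneC A c₀ → (z, τ) ∈ D A c := fun {c} hc =>
    ⟨hτ, by rw [R, if_pos hc.1]; trivial⟩
  have h₀ := mem_coneC hc₀
  have hcont : ContinuousOn (fun c => theta A c c₀ z τ) (coneC A c₀) := by
    intro c hc
    -- By the cocycle relation, $\theta^{c',c_0}-\theta^{c,c_0}=\theta^{c',c}\to0$.
    have h := ((tendsto_theta_self hA hc.1 z hτ).mono_left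
      (nhdsWithin_le_nhds (s := coneC A c₀))).add_const (theta A c c₀ z τ)
    rw [zero_add] at h
    refine h.congr' ?_
    filter_upwards [self_mem_nhdsWithin] with c' hc'
    exact theta_add hA hc₀ (Or.inl hc') (Or.inl hc) (Or.inl h₀) (hD hc') (hD hc) (hD h₀)
  have h1 : ContinuousOn (fun p : (Fin r → ℝ) × (Fin r → ℝ) =>
      theta A p.1 c₀ z τ - theta A p.2 c₀ z τ) (coneC A c₀ ×ˢ coneC A c₀) :=
    (hcont.comp continuousOn_fst fun p hp => hp.1).sub
      (hcont.comp continuousOn_snd fun p hp => hp.2)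
  refine h1.congr fun p hp => ?_
  simp only
  rw [← theta_add hA hc₀ (Or.inl hp.1) (Or.inl h₀) (Or.inl hp.2) (hD hp.1) (hD h₀) (hD hp.2),
    theta_swap p.2 c₀, sub_eq_add_neg]

end Continuity

/-! ### Elliptic law, oddness and translations of $\tau$. -/

section Transformations

variable {r : ℕ} {A : Matrix (Fin r) (Fin r) ℤ}

lemma latChar_intVec_dual (hdet : A.det ≠ 0) (n : Fin r → ℤ) {μ : Fin r → ℝ}
    (hμ : μ ∈ dualLattice A) : latChar A (intVec n) μ = 1 := by
  obtain ⟨m, rfl⟩ := mem_dualLattice.1 hμ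
  rw [latChar, B_dualVec_right hdet, Complex.exp_eq_one_iff]
  exact ⟨n ⬝ᵥ m, by simp [intVec, dotProduct, mul_comm]⟩

lemma mem_D_add_real {c : Fin r → ℝ} {z : Fin r → ℂ} {τ : ℂ} (hz : (z, τ) ∈ D A c)
    (μ : Fin r → ℝ) : (z + toC μ, τ) ∈ D A c := by
  obtain ⟨b, hb⟩ := eq_smul_imQuot_add hz.1 z
  rw [hb, mem_D_iff] at hz
  rwa [hb, add_assoc, ← toC_add, mem_D_iff]

/-- Translation by $\lambda\tau$ replaces $a$ by $a+\lambda$ and is undone by reindexing;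
translation by $\mu$ inserts a character trivial on $\mathbb Z^r$. -/
theorem theta_elliptic (hA : IsLorentzian A) (c₁ c₂ : Fin r → ℝ) (z : Fin r → ℂ) {τ : ℂ}
    (hτ : 0 < τ.im) (l : Fin r → ℤ) {μ : Fin r → ℝ} (hμ : μ ∈ dualLattice A) :
    theta A c₁ c₂ (z + τ • toC (intVec l) + toC μ) τ =
      Complex.exp (-2 * Real.pi * Complex.I * Q A (toC (intVec l)) * τ -
        2 * Real.pi * Complex.I * B A z (toC (intVec l))) * theta A c₁ c₂ z τ := by
  obtain ⟨b, hb⟩ := eq_smul_imQuot_add hτ z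
  set a := imQuot z τ
  rw [hb, smul_toC_add_smul, add_assoc, ← toC_add, theta, theta, ← tsum_mul_left,
    ← (Equiv.addRight l).tsum_eq (fun n => Complex.exp (-2 * Real.pi * Complex.I *
      Q A (toC (intVec l)) * τ - 2 * Real.pi * Complex.I * B A (τ • toC a + toC b)
        (toC (intVec l))) * thetaTerm A c₁ c₂ (τ • toC a + toC b) τ n)]
  refine tsum_congr fun n => ?_
  rw [thetaTerm_eq hA.symm hτ, thetaTerm_eq hA.symm hτ]
  have hv : intVec ((Equiv.addRight l) n) + a = intVec n + (a + intVec l) := by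
    simp only [Equiv.coe_addRight, intVec_add]; abel
  have hn := latChar_intVec_dual hA.det_ne_zero n hμ
  have hl := latChar_intVec_dual hA.det_ne_zero l hμ
  have hBz : B A (τ • toC a + toC b) (toC (intVec l)) =
      τ * (B A a (intVec l) : ℝ) + (B A (intVec l) b : ℝ) := by
    rw [B_add_left, B_smul_left, B_toC, B_toC, B_comm hA.symm b]
  have hB : B A (a + intVec l) (b + μ) =
      B A a b + B A a μ + (B A (intVec l) b + B A (intVec l) μ) := by
    rw [B_add_left, B_add_right, B_add_right]
  rw [hv, latChar_add_right _ b μ, latChar_add_left _ _ μ, latChar_add_left _ _ μ, hn, hl,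
    hBz, Q_toC, Q_add hA.symm, hB]
  have h3 : Complex.exp (-(2 * Real.pi * Complex.I * (((Q A a + Q A (intVec l) +
      B A a (intVec l) : ℝ) : ℂ) * τ + ((B A a b + B A a μ + (B A (intVec l) b +
        B A (intVec l) μ) : ℝ) : ℂ)))) * (latChar A a μ * latChar A (intVec l) μ) =
      Complex.exp (-2 * Real.pi * Complex.I * (Q A (intVec l) : ℝ) * τ -
        2 * Real.pi * Complex.I * (τ * (B A a (intVec l) : ℝ) + (B A (intVec l) b : ℝ))) *
      Complex.exp (-(2 * Real.pi * Complex.I * ((Q A a : ℝ) * τ + (B A a b : ℝ)))) := by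
    rw [latChar, latChar, ← Complex.exp_add, ← Complex.exp_add, ← Complex.exp_add]
    congr 1
    push_cast
    ring
  rw [hl, mul_one] at h3
  linear_combination (thetaKer A c₁ c₂ τ (intVec n + (a + intVec l)) *
    latChar A (intVec n + (a + intVec l)) b) * h3

lemma rhoOne_neg (c v : Fin r → ℝ) (τ : ℂ) : rhoOne A c (-v) τ = -rhoOne A c v τ := by
  unfold rhoOne
  split_ifs
  · rw [B_neg_right, neg_div, neg_mul, E_neg]
  · rw [B_neg_right, Real.sign_neg]

lemma neg_smul_toC_add (τ : ℂ) (a b : Fin r → ℝ) :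
    -(τ • toC a + toC b) = τ • toC (-a) + toC (-b) := by
  rw [toC_neg, toC_neg, smul_neg]; abel

lemma mem_D_neg {c : Fin r → ℝ} {z : Fin r → ℂ} {τ : ℂ} (hz : (z, τ) ∈ D A c) :
    (-z, τ) ∈ D A c := by
  obtain ⟨b, hb⟩ := eq_smul_imQuot_add hz.1 z
  rw [hb, mem_D_iff] at hz
  rw [hb, neg_smul_toC_add, mem_D_iff]
  exact ⟨hz.1, neg_mem_R hz.2⟩

theorem theta_neg (hsymm : A.IsSymm) (c₁ c₂ : Fin r → ℝ) (z : Fin r → ℂ) {τ : ℂ}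
    (hτ : 0 < τ.im) : theta A c₁ c₂ (-z) τ = -theta A c₁ c₂ z τ := by
  obtain ⟨b, hb⟩ := eq_smul_imQuot_add hτ z
  set a := imQuot z τ
  rw [hb, neg_smul_toC_add, theta, theta, ← tsum_neg, ← (Equiv.neg (Fin r → ℤ)).tsum_eq]
  refine tsum_congr fun n => ?_
  rw [thetaTerm_eq hsymm hτ, thetaTerm_eq hsymm hτ]
  have hv : intVec ((Equiv.neg (Fin r → ℤ)) n) + -a = -(intVec n + a) := by
    rw [Equiv.neg_apply, intVec_neg]; abel
  rw [hv, Q_neg, B_neg_left, B_neg_right, neg_neg, latChar, B_neg_left, B_neg_right, neg_neg,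
    ← latChar, thetaKer, thetaKer, rho, rho, rhoOne_neg, rhoOne_neg, Q_neg]
  push_cast
  ring

/-- Off-diagonal entries come in equal pairs. -/
lemma exists_sum_eq_trace_add {n : ℕ} (f : Fin n → Fin n → ℤ) (hf : ∀ i j, f i j = f j i) :
    ∃ k : ℤ, ∑ i, ∑ j, f i j = ∑ i, f i i + 2 * k := by
  induction n with
  | zero => exact ⟨0, by simp⟩
  | succ n ih =>
    obtain ⟨k, hk⟩ := ih (fun i j => f i.succ j.succ) (fun i j => hf _ _)
    refine ⟨k + ∑ j : Fin n, f 0 j.succ, ?_⟩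
    simp only [Fin.sum_univ_succ, Finset.sum_add_distrib, hk]
    simp only [hf _ 0]
    ring

/-- $2Q(n)\equiv\sum A_{ii}n_i^2\equiv\sum A_{ii}n_i$ modulo $2$, as $n_i^2\equiv n_i$. Hence
$e^{2\pi iQ(n)}$ is a character of $n$, given by `halfDiag`. -/
lemma exists_two_Q_intVec (hsymm : A.IsSymm) (n : Fin r → ℤ) :
    ∃ k : ℤ, 2 * Q A (intVec n) = ∑ i, (A i i : ℝ) * (n i : ℝ) + 2 * k := by
  obtain ⟨k, hk⟩ := exists_sum_eq_trace_add (fun i j => n i * (A i j * n j)) (fun i j => by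
    rw [hsymm.apply j i]; ring)
  have h : ∀ i, ∃ k : ℤ, n i * (A i i * n i) = A i i * n i + 2 * k := by
    intro i
    obtain ⟨k, hk⟩ := Int.even_mul_pred_self (n i)
    exact ⟨A i i * k, by linear_combination A i i * hk⟩
  choose e he using h
  refine ⟨k + ∑ i, e i, ?_⟩
  rw [← B_self, B_intVec]
  have h2 : n ⬝ᵥ (A *ᵥ n) = ∑ i, A i i * n i + 2 * (k + ∑ i, e i) := by
    simp only [dotProduct, mulVec, Finset.mul_sum]
    rw [hk]
    simp only [he, Finset.sum_add_distrib, ← Finset.mul_sum]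
    ring
  rw [h2]
  push_cast
  ring

lemma B_halfDiag (hdet : A.det ≠ 0) (x : Fin r → ℝ) :
    B A x (halfDiag A) = 1 / 2 * ∑ i, (A i i : ℝ) * x i := by
  rw [halfDiag, B_smul_right]
  have h : B A x ((A.map Int.cast)⁻¹ *ᵥ fun i => (A i i : ℝ)) = x ⬝ᵥ fun i => (A i i : ℝ) :=
    B_dualVec_right hdet x (fun i => A i i)
  rw [h]
  simp [dotProduct, mul_comm]

lemma thetaTerm_add_int (c₁ c₂ : Fin r → ℝ) (z : Fin r → ℂ) (τ : ℂ) (k : ℤ) (n : Fin r → ℤ) :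
    thetaTerm A c₁ c₂ z (τ + k) n =
      thetaTerm A c₁ c₂ z τ n *
        Complex.exp (2 * Real.pi * Complex.I * (k * (Q A (intVec n) : ℝ))) := by
  have him : (τ + k).im = τ.im := by simp
  have h1 : imQuot z (τ + k) = imQuot z τ := by unfold imQuot; rw [him]
  rw [thetaTerm, thetaTerm, h1, ← toC_intVec, Q_toC,
    mul_assoc (Complex.ofReal _), ← Complex.exp_add]
  simp only [rho, rhoOne, him]
  congr 2
  ring

lemma thetaTerm_add_real (c₁ c₂ : Fin r → ℝ) (z : Fin r → ℂ) (τ : ℂ) (μ : Fin r → ℝ)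
    (n : Fin r → ℤ) :
    thetaTerm A c₁ c₂ (z + toC μ) τ n = thetaTerm A c₁ c₂ z τ n * latChar A (intVec n) μ := by
  have h1 : imQuot (z + toC μ) τ = imQuot z τ := by
    unfold imQuot; simp [toC]
  rw [thetaTerm, thetaTerm, h1, ← toC_intVec, latChar,
    mul_assoc (Complex.ofReal _), ← Complex.exp_add, B_add_right,
    B_toC]
  congr 2
  ring

lemma exp_two_pi_int_mul (k : ℤ) : Complex.exp (2 * Real.pi * Complex.I * k) = 1 := by
  rw [Complex.exp_eq_one_iff]
  exact ⟨k, by ring⟩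

lemma mem_D_add_int {c : Fin r → ℝ} {z : Fin r → ℂ} {τ : ℂ} (hz : (z, τ) ∈ D A c) (k : ℤ) :
    (z, τ + k) ∈ D A c := by
  have him : (τ + k).im = τ.im := by simp
  have h1 : imQuot z (τ + k) = imQuot z τ := by unfold imQuot; rw [him]
  exact ⟨by simpa using hz.1, by simp only [h1]; exact hz.2⟩

theorem theta_add_one (hA : IsLorentzian A) (c₁ c₂ : Fin r → ℝ) (z : Fin r → ℂ) (τ : ℂ) :
    theta A c₁ c₂ z (τ + 1) = theta A c₁ c₂ (z + toC (halfDiag A)) τ := by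
  unfold theta
  refine tsum_congr fun n => ?_
  have h := thetaTerm_add_int (A := A) c₁ c₂ z τ 1 n
  rw [Int.cast_one] at h
  rw [h, thetaTerm_add_real]
  congr 1
  obtain ⟨k, hk⟩ := exists_two_Q_intVec hA.symm n
  rw [latChar, B_halfDiag hA.det_ne_zero]
  have h2 : Q A (intVec n) = 1 / 2 * ∑ i, (A i i : ℝ) * intVec n i + k := by
    have : ∑ i, (A i i : ℝ) * intVec n i = ∑ i, (A i i : ℝ) * (n i : ℝ) := rfl
    rw [this]
    linarith
  rw [h2, one_mul, Complex.ofReal_add, mul_add, Complex.exp_add, Complex.ofReal_intCast,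
    exp_two_pi_int_mul, mul_one]

theorem theta_add_two (c₁ c₂ : Fin r → ℝ) (z : Fin r → ℂ) (τ : ℂ) :
    theta A c₁ c₂ z (τ + 2) = theta A c₁ c₂ z τ := by
  unfold theta
  refine tsum_congr fun n => ?_
  have h := thetaTerm_add_int (A := A) c₁ c₂ z τ 2 n
  rw [Int.cast_ofNat] at h
  have h2 : (2 : ℂ) * (Q A (intVec n) : ℝ) = ((n ⬝ᵥ (A *ᵥ n) : ℤ) : ℂ) := by
    have h3 : 2 * Q A (intVec n) = ((n ⬝ᵥ (A *ᵥ n) : ℤ) : ℝ) := by rw [← B_self, B_intVec]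
    exact_mod_cast congrArg (Complex.ofReal) h3
  rw [h, h2, exp_two_pi_int_mul, mul_one]

theorem theta_add_one_of_even (hA : IsLorentzian A) (heven : ∀ i, Even (A i i))
    (c₁ c₂ : Fin r → ℝ) (z : Fin r → ℂ) (τ : ℂ) :
    theta A c₁ c₂ z (τ + 1) = theta A c₁ c₂ z τ := by
  unfold theta
  refine tsum_congr fun n => ?_
  have h := thetaTerm_add_int (A := A) c₁ c₂ z τ 1 n
  rw [Int.cast_one] at h
  choose e he using heven
  obtain ⟨k, hk⟩ := exists_two_Q_intVec hA.symm n
  have h2 : Q A (intVec n) = ((∑ i, e i * n i + k : ℤ) : ℝ) := by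
    have h3 : ∑ i, (A i i : ℝ) * (n i : ℝ) = 2 * ∑ i, (e i : ℝ) * (n i : ℝ) := by
      rw [Finset.mul_sum]
      refine Finset.sum_congr rfl fun i _ => ?_
      rw [he i]; push_cast; ring
    rw [h3] at hk
    push_cast
    linarith
  rw [h, h2, one_mul, Complex.ofReal_intCast, exp_two_pi_int_mul, mul_one]

end Transformations

/-! ### The main theorem. -/

theorem mainTheorem2 (r : ℕ) (A : Matrix (Fin r) (Fin r) ℤ) (hsymm : A.IsSymm)
    (hdet : A.det ≠ 0) (htype : HasType A (r - 1) 1)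
    (c₀ : Fin r → ℝ) (hc₀ : Q A c₀ < 0) :
    -- absolute convergence
    (∀ c₁ ∈ coneBar A c₀, ∀ c₂ ∈ coneBar A c₀, ∀ (z : Fin r → ℂ) (τ : ℂ),
      (z, τ) ∈ D A c₁ ∩ D A c₂ → Summable fun n => ‖thetaTerm A c₁ c₂ z τ n‖) ∧
    -- cocycle conditions
    (∀ c₁ ∈ coneBar A c₀, ∀ c₂ ∈ coneBar A c₀, ∀ (z : Fin r → ℂ) (τ : ℂ),
      (z, τ) ∈ D A c₁ ∩ D A c₂ → theta A c₁ c₂ z τ + theta A c₂ c₁ z τ = 0) ∧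
    (∀ c₁ ∈ coneBar A c₀, ∀ c₂ ∈ coneBar A c₀, ∀ c₃ ∈ coneBar A c₀,
      ∀ (z : Fin r → ℂ) (τ : ℂ), (z, τ) ∈ D A c₁ ∩ D A c₂ ∩ D A c₃ →
      theta A c₁ c₂ z τ + theta A c₂ c₃ z τ + theta A c₃ c₁ z τ = 0) ∧
    -- elliptic transformations
    (∀ c₁ ∈ coneBar A c₀, ∀ c₂ ∈ coneBar A c₀, ∀ (z : Fin r → ℂ) (τ : ℂ),
      (z, τ) ∈ D A c₁ ∩ D A c₂ → ∀ l : Fin r → ℤ, ∀ μ ∈ dualLattice A,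
      (z + τ • (fun i => (l i : ℂ)) + toC μ, τ) ∈ D A c₁ ∩ D A c₂ ∧
      theta A c₁ c₂ (z + τ • (fun i => (l i : ℂ)) + toC μ) τ =
        Complex.exp (-2 * Real.pi * Complex.I * Q A (fun i => (l i : ℂ)) * τ -
          2 * Real.pi * Complex.I * B A z (fun i => (l i : ℂ))) * theta A c₁ c₂ z τ) ∧
    -- oddness
    (∀ c₁ ∈ coneBar A c₀, ∀ c₂ ∈ coneBar A c₀, ∀ (z : Fin r → ℂ) (τ : ℂ),
      (z, τ) ∈ D A c₁ ∩ D A c₂ →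
      (-z, τ) ∈ D A c₁ ∩ D A c₂ ∧ theta A c₁ c₂ (-z) τ = -theta A c₁ c₂ z τ) ∧
    -- continuity in the parameters
    (∀ (z : Fin r → ℂ) (τ : ℂ), 0 < τ.im →
      ContinuousOn (fun p : (Fin r → ℝ) × (Fin r → ℝ) => theta A p.1 p.2 z τ)
        (coneC A c₀ ×ˢ coneC A c₀)) ∧
    -- behaviour at a cusp
    (∀ c₁ ∈ coneC A c₀, ∀ c₃ ∈ coneC A c₀, ∀ c₂ ∈ cuspS A c₀, ∀ (z : Fin r → ℂ) (τ : ℂ),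
      (z, τ) ∈ D A c₂ →
      (∀ t : ℝ, 0 < t → c₂ + t • c₃ ∈ coneC A c₀) ∧
      Tendsto (fun t : ℝ => theta A c₁ (c₂ + t • c₃) z τ) (𝓝[>] 0)
        (𝓝 (theta A c₁ c₂ z τ))) ∧
    -- translations of the modular variable
    (∀ c₁ ∈ coneBar A c₀, ∀ c₂ ∈ coneBar A c₀, ∀ (z : Fin r → ℂ) (τ : ℂ),
      (z, τ) ∈ D A c₁ ∩ D A c₂ →
      (z, τ + 1) ∈ D A c₁ ∩ D A c₂ ∧ (z + toC (halfDiag A), τ) ∈ D A c₁ ∩ D A c₂ ∧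
      theta A c₁ c₂ z (τ + 1) = theta A c₁ c₂ (z + toC (halfDiag A)) τ ∧
      theta A c₁ c₂ z (τ + 2) = theta A c₁ c₂ z τ ∧
      ((∀ i, Even (A i i)) → theta A c₁ c₂ z (τ + 1) = theta A c₁ c₂ z τ)) ∧
    -- the inversion of the modular variable
    (∀ c ∈ coneBar A c₀,
      D' A c = {p : (Fin r → ℂ) × ℂ | 0 < p.2.im ∧
        ∃ a ∈ R A c, ∃ b ∈ R A c, p.1 = p.2 • toC a + toC b}) ∧
    Finite (DiscGroup A) ∧
    (∀ c₁ ∈ coneBar A c₀, ∀ c₂ ∈ coneBar A c₀, ∀ (z : Fin r → ℂ) (τ : ℂ),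
      (z, τ) ∈ D' A c₁ ∩ D' A c₂ →
      (∀ p ∈ dualLattice A, (z + τ • toC p, τ) ∈ D A c₁ ∩ D A c₂) ∧
      -- `s` is an arbitrary choice of representatives of the classes in `A⁻¹ ℤ ^ r / ℤ ^ r`
      ∀ s : DiscGroup A → dualLattice A, (∀ q, (QuotientAddGroup.mk (s q) : DiscGroup A) = q) →
      theta A c₁ c₂ (fun i => z i / τ) (-1 / τ) =
        Complex.I / ((√(-(A.det : ℝ)) : ℝ) : ℂ) * (-Complex.I * τ) ^ ((r : ℂ) / 2) *
          ∑ᶠ q : DiscGroup A,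
            Complex.exp (2 * Real.pi * Complex.I * Q A (z + τ • toC (s q : Fin r → ℝ)) / τ) *
              theta A c₁ c₂ (z + τ • toC (s q : Fin r → ℝ)) τ) := by
  have hA := isLorentzian_of_hasType hsymm hdet htype
  refine ⟨?_, ?_, ?_, ?_, ?_, ?_, ?_, ?_, fun c _ => D'_eq c, finite_discGroup hdet, ?_⟩
  · intro c₁ h₁ c₂ h₂ z τ hz
    exact summable_thetaTerm hA hc₀ h₁ h₂ hz.1 hz.2
  · intro c₁ _ c₂ _ z τ _
    rw [theta_swap c₁ c₂, add_neg_cancel]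
  · intro c₁ h₁ c₂ h₂ c₃ h₃ z τ hz
    rw [theta_add hA hc₀ h₁ h₂ h₃ hz.1.1 hz.1.2 hz.2, theta_swap c₁ c₃, add_neg_cancel]
  · intro c₁ h₁ c₂ h₂ z τ hz l μ hμ
    have hl := intVec_mem_dualLattice hdet l
    rw [← toC_intVec]
    exact ⟨⟨mem_D_add_real (mem_D_add_smul hA h₁ hz.1 hl) μ,
      mem_D_add_real (mem_D_add_smul hA h₂ hz.2 hl) μ⟩, theta_elliptic hA c₁ c₂ z hz.1.1 l hμ⟩
  · intro c₁ _ c₂ _ z τ hz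
    exact ⟨⟨mem_D_neg hz.1, mem_D_neg hz.2⟩, theta_neg hsymm c₁ c₂ z hz.1.1⟩
  · intro z τ hτ
    exact continuousOn_theta hA hc₀ z hτ
  · intro c₁ h₁ c₃ h₃ c₂ h₂ z τ hz
    exact ⟨fun t ht => add_smul_mem_coneC hA hc₀ h₂ h₃ ht, tendsto_theta_cusp hA hc₀ h₁ h₂ h₃ hz⟩
  · intro c₁ _ c₂ _ z τ hz
    refine ⟨⟨?_, ?_⟩, ⟨mem_D_add_real hz.1 _, mem_D_add_real hz.2 _⟩, theta_add_one hA c₁ c₂ z τ,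
      theta_add_two c₁ c₂ z τ, fun heven => theta_add_one_of_even hA heven c₁ c₂ z τ⟩
    · simpa using mem_D_add_int hz.1 1
    · simpa using mem_D_add_int hz.2 1
  · intro c₁ h₁ c₂ h₂ z τ hz
    exact ⟨fun p hp => ⟨mem_D_add_smul hA h₁ hz.1.1 hp, mem_D_add_smul hA h₂ hz.2.1 hp⟩,
      fun s hs => theta_inversion hA hc₀ h₁ h₂ hz.1 hz.2 s hs⟩
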